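/- Let $\Omega\subset\mathbb R^2$ be a bounded connected domain whose boundary is a disjoint union $\partial\Omega=\partial_1\Omega\cup\dots\cup\partial_q\Omega$ of $q$ piecewise smooth (piecewise $C^1$ suffices) simple closed curves. Parametrize each $\partial_\alpha\Omega$ by arclength $s\in[0,|\partial_\alpha\Omega|)$ with the positive orientation ($\Omega$ on the left). Let $\Phi$ be the billiard map phase space, with coordinates $(\alpha,s,\theta)$, where $(\alpha,s)$ is the footpoint, on $\partial_\alpha\Omega$, and $0\le\theta\le\pi$ is the angle between the positive tangent and the direction of motion; let $d\nu=\sin\theta\,ds\,d\theta$ be the Liouville measure on $\Phi$, and let $\varphi$ be the billiard map: the ball moves from the footpoint along a straight segment inside $\Omega$ until it hits the boundary, where it is reflected with angle of incidence equal to angle of reflection ($\varphi$ is undefined if the footpoint or the point hit is a corner, or if the ball leaves or hits the boundary tangentially). For $z\in\Phi$ with an infinite forward orbit, $1\le\alpha\le q$ and $N\in\mathbb N$, let $0\le k_0<\dots<k_n\le N$ be the consecutive times at which the footpoint of $\varphi^{k_i}(z)$ lies on $\partial_\alpha\Omega$, let $s_0,\dots,s_n$ be the arclength coordinates of these footpoints,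 and let $\xi_i\in[0,|\partial_\alpha\Omega|)$ be the number with $s_i+\xi_i\in\{s_{i+1},\,s_{i+1}+|\partial_\alpha\Omega|\}$. Put $$\upsilon_\alpha(z)=\lim_{N\to\infty}\frac{\xi_0+\dots+\xi_{n-1}}{N},\qquad \rho_\alpha(z)=\frac{\upsilon_\alpha(z)}{|\partial_\alpha\Omega|},\qquad \rho(z)=\rho_1(z)+\dots+\rho_q(z);$$ the rotation number $\rho(z)$ is defined at those $z$ for which all these limits exist. Then $\rho$ is defined for $\nu$-almost all $z\in\Phi$, and it is a measurable function with values in $[0,1]$. Suppose moreover that the set of phase points whose orbit leaves the boundary component of its footpoint and, at its first return to that component, comes back to exactly the same footpoint, has $\nu$-measure zero (this set is empty if $q=1$). Then: 1. for every Borel set $X\subset[0,1]$, $\nu(\rho^{-1}(1-X))=\nu(\rho^{-1}(X))$, where $1-X=\{1-x:x\in X\}$; 2. $\dfrac{1}{\nu(\Phi)}\displaystyle\int_\Phi\rho\,d\nu=\dfrac12$; 3. if the billiard map of $\Omega$ is ergodic with respect to $\nu$, then $\rho(z)=1/2$ for $\nu$-almost all $z\in\Phi$. -/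

import Mathlib

open Set Filter Topology MeasureTheory

noncomputable section

/-- `γ` restricted to `[0, L]` is piecewise smooth and parametrized by arclength: there is a finite
partition of `[0, L]` such that on each closed subinterval `γ` is continuously differentiable (with
one-sided derivatives at the ends) and has unit speed. The plane is `ℂ`. -/
def IsPiecewiseSmoothArclength (γ : ℝ → ℂ) (L : ℝ) : Prop :=
  ∃ (m : ℕ) (t : Fin (m + 1) → ℝ), StrictMono t ∧ t 0 = 0 ∧ t (Fin.last m) = L ∧
    ∀ i : Fin m,
      ContDiffOn ℝ 1 γ (Icc (t i.castSucc) (t i.succ)) ∧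
      ∀ s ∈ Icc (t i.castSucc) (t i.succ),
        ‖derivWithin γ (Icc (t i.castSucc) (t i.succ)) s‖ = 1

/-- A billiard table: a bounded connected domain in the plane `ℂ` whose boundary is the disjoint
union of `q` piecewise smooth simple closed curves, each parametrized by arclength (from a chosen
reference point) with the positive orientation, i.e. with the domain on the left. -/
structure BilliardTable (q : ℕ) where
  /-- The domain. -/
  Ω : Set ℂ
  isOpen : IsOpen Ω
  isConnected : IsConnected Ω
  isBounded : Bornology.IsBounded Ω
  /-- The lengths of the boundary components. -/
  len : Fin q → ℝ
  len_pos : ∀ α, 0 < len α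
  /-- The arclength parametrizations of the boundary components. -/
  γ : Fin q → ℝ → ℂ
  periodic : ∀ α, Function.Periodic (γ α) (len α)
  injOn : ∀ α, InjOn (γ α) (Ico 0 (len α))
  piecewiseSmooth : ∀ α, IsPiecewiseSmoothArclength (γ α) (len α)
  disjoint : Pairwise fun α β => Disjoint (range (γ α)) (range (γ β))
  frontier_eq : frontier Ω = ⋃ α, range (γ α)
  positivelyOriented : ∀ α s, ContDiffAt ℝ 1 (γ α) s →
    ∀ᶠ ε : ℝ in 𝓝[>] 0, γ α s + ε * (Complex.I * deriv (γ α) s) ∈ Ω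

/-- Coordinates `(α, s, θ)` of phase points: the boundary component, the arclength coordinate of
the footpoint on it, and the angle between the positive tangent and the outgoing direction. -/
abbrev PhasePoint (q : ℕ) : Type := Fin q × ℝ × ℝ

/-- The boundary component carrying the footpoint. -/
abbrev PhasePoint.comp {q : ℕ} (z : PhasePoint q) : Fin q := z.1

/-- The arclength coordinate of the footpoint. -/
abbrev PhasePoint.arc {q : ℕ} (z : PhasePoint q) : ℝ := z.2.1

/-- The angle of the outgoing direction with the positive tangent. -/
abbrev PhasePoint.angle {q : ℕ} (z : PhasePoint q) : ℝ := z.2.2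

/-- For `s, s' ∈ [0, L)`, the unique `ξ ∈ [0, L)` with `s + ξ = s'` or `s + ξ = s' + L`. -/
def footpointIncrement (L s s' : ℝ) : ℝ := if s ≤ s' then s' - s else s' + L - s

namespace BilliardTable

variable {q : ℕ} (T : BilliardTable q)

/-- The phase space `Φ` of the billiard map. -/
def phaseSpace : Set (PhasePoint q) :=
  {z | z.arc ∈ Ico 0 (T.len z.comp) ∧ z.angle ∈ Icc 0 Real.pi}

/-- The Liouville measure `dν = sin θ ds dθ` on `Φ`. -/
def liouville : Measure (PhasePoint q) :=
  ((Measure.count.prod (volume : Measure (ℝ × ℝ))).restrict T.phaseSpace).withDensity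
    fun z : PhasePoint q => ENNReal.ofReal (Real.sin z.angle)

/-- The footpoint, a point of the boundary. -/
def footpoint (z : PhasePoint q) : ℂ := T.γ z.comp z.arc

/-- The unit tangent vector at the footpoint, in the positive direction. -/
def tangent (z : PhasePoint q) : ℂ := deriv (T.γ z.comp) z.arc

/-- The phase points at which the boundary is smooth and the direction is transversal to it. -/
def regular : Set (PhasePoint q) :=
  {z ∈ T.phaseSpace | ContDiffAt ℝ 1 (T.γ z.comp) z.arc ∧ z.angle ∈ Ioo 0 Real.pi}

/-- The unit direction of the billiard ball leaving the footpoint. -/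
def outgoing (z : PhasePoint q) : ℂ := T.tangent z * Complex.exp (z.angle * Complex.I)

/-- The unit direction of the billiard ball just before its reflection at the footpoint: the mirror
image of the outgoing direction in the tangent line. -/
def incoming (z : PhasePoint q) : ℂ := T.tangent z * Complex.exp (-(z.angle * Complex.I))

/-- The billiard ball that leaves the footpoint of `z` in the direction of `z` moves inside `Ω`
along a straight segment until it hits the boundary at the footpoint of `w`, where it is reflected
(the angle of incidence equals the angle of reflection) into the direction of `w`. Hits at corners
and tangential hits are excluded. There is at most one such `w`. -/
def IsBilliardStep (z w : PhasePoint q) : Prop :=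
  z ∈ T.regular ∧ w ∈ T.regular ∧
    ∃ t : ℝ, 0 < t ∧ (∀ r ∈ Ioo 0 t, T.footpoint z + r * T.outgoing z ∈ T.Ω) ∧
      T.footpoint w = T.footpoint z + t * T.outgoing z ∧
      T.incoming w = T.outgoing z

/-- The set of phase points at which the billiard map is defined. -/
def mapDomain : Set (PhasePoint q) := {z | ∃ w, T.IsBilliardStep z w}

open Classical in
/-- The billiard map `φ`. Outside its domain of definition it is continued by the identity. -/
def billiardMap (z : PhasePoint q) : PhasePoint q :=
  if h : ∃ w, T.IsBilliardStep z w then h.choose else z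

/-- The sum `ξ₀ + ⋯ + ξₙ₋₁` of the footpoint increments between the consecutive visits
`0 ≤ k₀ < ⋯ < kₙ ≤ N` of the orbit of `z` to the boundary component `α`. -/
def gainSum (α : Fin q) (z : PhasePoint q) (N : ℕ) : ℝ :=
  ∑ i ∈ Finset.range (Nat.count (fun k => (T.billiardMap^[k] z).1 = α) (N + 1) - 1),
    footpointIncrement (T.len α)
      (T.billiardMap^[Nat.nth (fun k => (T.billiardMap^[k] z).1 = α) i] z).arc
      (T.billiardMap^[Nat.nth (fun k => (T.billiardMap^[k] z).1 = α) (i + 1)] z).arc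

/-- The number `v` is the footpoint gain of `z` along the boundary component `α`. -/
def HasFootpointGain (α : Fin q) (z : PhasePoint q) (v : ℝ) : Prop :=
  Tendsto (fun N : ℕ => T.gainSum α z N / N) atTop (𝓝 v)

/-- The domain of definition of the rotation vector and of the rotation number: the phase points
with an infinite forward orbit for which all the limits defining the footpoint gains exist. -/
def rotationDomain : Set (PhasePoint q) :=
  {z ∈ T.phaseSpace | (∀ k : ℕ, T.billiardMap^[k] z ∈ T.mapDomain) ∧
    ∀ α, ∃ v, T.HasFootpointGain α z v}

/-- The footpoint gain along the boundary component `α`. -/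
def footpointGain (α : Fin q) (z : PhasePoint q) : ℝ :=
  limUnder atTop fun N : ℕ => T.gainSum α z N / N

/-- The rotation vector (meaningful on `rotationDomain`). -/
def rotationVector (z : PhasePoint q) (α : Fin q) : ℝ := T.footpointGain α z / T.len α

/-- The rotation number function (meaningful on `rotationDomain`). -/
def rotationNumber (z : PhasePoint q) : ℝ := ∑ α, T.rotationVector z α

/-- The phase points whose orbit leaves the boundary component of its footpoint and, on its first
return to this component, comes back to exactly the same footpoint. -/
def returnLoops : Set (PhasePoint q) :=
  {z | ∃ k : ℕ, 2 ≤ k ∧ (∀ j, 0 < j → j < k → (T.billiardMap^[j] z).comp ≠ z.comp) ∧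
    (T.billiardMap^[k] z).comp = z.comp ∧ (T.billiardMap^[k] z).arc = z.arc}

end BilliardTable

end

/-! Existence. Put on each component `α` the bounded function `returnIncrement`: the increment up to
the first return if the footpoint lies on `α` and returns, and zero otherwise. Its Birkhoff sums
differ from the footpoint gains by a bounded amount (`birkhoffSum_returnIncrement_sub_gainSum`), so
the limits exist almost everywhere by the pointwise ergodic theorem, once the billiard map φ is
known to preserve ν. Each increment is at most the length of its component and each time belongs to
exactly one component, so ρ lies in [0, 1].

Symmetry. Let R be the time reversal θ ↦ π - θ. From R(φ^N z) the ball retraces the first N steps of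
z backwards, and every increment ξ between distinct footpoints on a component of length L becomes L
- ξ. Only ξ = 0 breaks this rule, whence the hypothesis on `returnLoops`. The number of turns made
in N steps therefore becomes N minus itself, up to an error of at most q + 1 (`turnSum_reverse`).
Since R ∘ φ^N preserves ν, the two normalized turn counts have the same law for every N; in the
limit ρ and 1 - ρ have the same law (`map_rotationNumber_eq`). So the mean is 1/2, and under
ergodicity the invariant function ρ is constant, hence equal to 1/2.

Geometry. It remains to show that φ is measurable, defined almost everywhere and ν-preserving for a
piecewise C¹ boundary. In absolute directions v, the measure ν is the integral over the unit circle
of the measures |Im(v/γ')| ds on the boundary (`liouville_eq_lintegral_lineMeasure`), and each of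
these is locally the Lebesgue measure in the coordinate transversal to v. A flight does not change
this coordinate, which gives invariance (`liouville_reverse_image`); a one-dimensional Sard argument
discards the lines through corners and the tangent lines. Finally, reflection at a transversal hit
makes sense only if Ω does not also lie to the right of its boundary. The orientation hypothesis
does not say so; it follows because the winding integral is constant on the connected set Ω but
jumps by 2πi across the curve (`not_eventually_right_mem_Ω`). -/

noncomputable section

/-! ### The pointwise ergodic theorem for bounded functions. -/

section PointwiseErgodic

variable {X : Type*}

/-- The maximum of `0` and the first `N` Birkhoff sums of `g`. -/
def birkhoffMax (T : X → X) (g : X → ℝ) : ℕ → X → ℝ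
  | 0, _ => 0
  | N + 1, x => max 0 (g x + birkhoffMax T g N (T x))

theorem birkhoffMax_nonneg (T : X → X) (g : X → ℝ) (N : ℕ) (x : X) : 0 ≤ birkhoffMax T g N x := by
  cases N with
  | zero => exact le_rfl
  | succ N => exact le_max_left _ _

theorem birkhoffMax_le_succ (T : X → X) (g : X → ℝ) (N : ℕ) (x : X) :
    birkhoffMax T g N x ≤ birkhoffMax T g (N + 1) x := by
  induction N generalizing x with
  | zero => exact birkhoffMax_nonneg T g 1 x
  | succ N ih => exact max_le_max le_rfl (by simpa using ih (T x))

theorem birkhoffSum_le_birkhoffMax (T : X → X) (g : X → ℝ) {n N : ℕ} (h : n ≤ N) (x : X) :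
    birkhoffSum T g n x ≤ birkhoffMax T g N x := by
  induction N generalizing n x with
  | zero => simp [Nat.le_zero.1 h, birkhoffMax]
  | succ N ih =>
    cases n with
    | zero => simpa using birkhoffMax_nonneg T g _ x
    | succ n =>
      rw [birkhoffSum_succ']
      exact le_max_of_le_right (by simpa using ih (Nat.le_of_succ_le_succ h) (T x))

theorem birkhoffMax_le {T : X → X} {g : X → ℝ} {C : ℝ} (hC : ∀ x, |g x| ≤ C) (N : ℕ) (x : X) :
    birkhoffMax T g N x ≤ N * C := by
  have hC0 : 0 ≤ C := (abs_nonneg _).trans (hC x)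
  induction N generalizing x with
  | zero => simp [birkhoffMax]
  | succ N ih =>
    refine max_le (by positivity) ?_
    have h1 := ih (T x)
    have h2 := (le_abs_self _).trans (hC x)
    push_cast
    linarith

theorem abs_birkhoffAverage_le {T : X → X} {f : X → ℝ} {C : ℝ} (hC : ∀ x, |f x| ≤ C)
    (n : ℕ) (x : X) : |birkhoffAverage ℝ T f n x| ≤ C := by
  have hC0 : 0 ≤ C := (abs_nonneg _).trans (hC x)
  rcases Nat.eq_zero_or_pos n with rfl | hn
  · simpa [birkhoffAverage] using hC0
  have hn' : (0 : ℝ) < n := by exact_mod_cast hn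
  rw [birkhoffAverage, smul_eq_mul, abs_mul, abs_inv, abs_of_pos hn', inv_mul_le_iff₀ hn']
  calc |birkhoffSum T f n x| ≤ ∑ k ∈ Finset.range n, |f (T^[k] x)| :=
        Finset.abs_sum_le_sum_abs _ _
    _ ≤ ∑ k ∈ Finset.range n, C := Finset.sum_le_sum fun k _ => hC _
    _ = n * C := by simp

variable [MeasurableSpace X]

theorem measurable_birkhoffMax {T : X → X} {g : X → ℝ} (hT : Measurable T) (hg : Measurable g)
    (N : ℕ) : Measurable (birkhoffMax T g N) := by
  induction N with
  | zero => exact measurable_const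
  | succ N ih => exact measurable_const.max (hg.add (ih.comp hT))

/-- The maximal ergodic inequality. -/
theorem integral_nonneg_of_exists_birkhoffSum_pos {μ : Measure X} [IsFiniteMeasure μ] {T : X → X}
    (hT : MeasurePreserving T μ μ) {g : X → ℝ} (hg : Measurable g) {C : ℝ} (hC : ∀ x, |g x| ≤ C)
    (hpos : ∀ᵐ x ∂μ, ∃ n, 0 < birkhoffSum T g n x) : 0 ≤ ∫ x, g x ∂μ := by
  have hint : ∀ {f : X → ℝ} (D : ℝ), Measurable f → (∀ x, |f x| ≤ D) → Integrable f μ :=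
    fun D hf hD => Integrable.of_bound hf.aestronglyMeasurable D (ae_of_all _ hD)
  have hMm := measurable_birkhoffMax hT.measurable hg
  have hMi : ∀ N, Integrable (birkhoffMax T g N) μ := fun N => hint (N * C) (hMm N) fun x => by
    rw [abs_of_nonneg (birkhoffMax_nonneg T g N x)]; exact birkhoffMax_le hC N x
  have hgi := hint C hg hC
  -- Write M_N for `birkhoffMax T g N`. Then g = M_{N+1} - M_N ∘ T - r_N. The first two terms have
  -- nonnegative integral by invariance and monotonicity in N, and r_N is bounded by C and vanishes
  -- once N reaches the length of a positive Birkhoff sum.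
  set r : ℕ → X → ℝ := fun N x => max 0 (-(g x + birkhoffMax T g N (T x))) with hr
  have hrm : ∀ N, Measurable (r N) := fun N =>
    measurable_const.max (hg.add ((hMm N).comp hT.measurable)).neg
  have hrb : ∀ N x, |r N x| ≤ C := fun N x => by
    rw [abs_of_nonneg (le_max_left _ _)]
    have := birkhoffMax_nonneg T g N (T x)
    have h2 := neg_abs_le (g x)
    exact max_le ((abs_nonneg _).trans (hC x)) (by linarith [hC x])
  have hlim : Tendsto (fun N => ∫ x, r N x ∂μ) atTop (𝓝 (∫ _, (0 : ℝ) ∂μ)) := by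
    refine tendsto_integral_of_dominated_convergence (fun _ => C)
      (fun N => (hrm N).aestronglyMeasurable) (integrable_const C)
      (fun N => ae_of_all _ fun x => by simpa using hrb N x) ?_
    filter_upwards [hpos] with x ⟨n, hn⟩
    refine tendsto_const_nhds.congr' ?_
    filter_upwards [eventually_ge_atTop n] with N hN
    have h1 := hn.trans_le (birkhoffSum_le_birkhoffMax T g (hN.trans (Nat.le_succ N)) x)
    have h2 : 0 < g x + birkhoffMax T g N (T x) := by
      by_contra h
      simp only [birkhoffMax] at h1
      rw [max_eq_left (not_lt.1 h)] at h1
      exact lt_irrefl _ h1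
    simp only [hr]
    rw [max_eq_left (by linarith)]
  rw [integral_zero] at hlim
  have key : ∀ N, -∫ x, r N x ∂μ ≤ ∫ x, g x ∂μ := fun N => by
    have hcomp : ∫ x, birkhoffMax T g N (T x) ∂μ = ∫ x, birkhoffMax T g N x ∂μ := by
      have := integral_map (μ := μ) hT.aemeasurable (f := birkhoffMax T g N)
        (hMm N).aestronglyMeasurable
      rw [hT.map_eq] at this
      exact this.symm
    have hMT : Integrable (fun x => birkhoffMax T g N (T x)) μ :=
      hT.integrable_comp_of_integrable (hMi N)
    have e : ∀ x, g x = birkhoffMax T g (N + 1) x - birkhoffMax T g N (T x) - r N x := fun x => by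
      simp only [birkhoffMax, hr]
      rcases le_total 0 (g x + birkhoffMax T g N (T x)) with h | h
      · rw [max_eq_right h, max_eq_left (by linarith)]; ring
      · rw [max_eq_left h, max_eq_right (by linarith)]; ring
    have hsum : ∫ x, g x ∂μ = ∫ x, birkhoffMax T g (N + 1) x ∂μ - ∫ x, birkhoffMax T g N (T x) ∂μ
        - ∫ x, r N x ∂μ := by
      have hD : Integrable (fun x => birkhoffMax T g (N + 1) x - birkhoffMax T g N (T x)) μ :=
        (hMi _).sub hMT
      rw [← integral_sub (hMi _) hMT, ← integral_sub hD (hint C (hrm N) (hrb N))]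
      exact integral_congr_ae (ae_of_all _ e)
    have hmono : ∫ x, birkhoffMax T g N x ∂μ ≤ ∫ x, birkhoffMax T g (N + 1) x ∂μ :=
      integral_mono (hMi N) (hMi _) (birkhoffMax_le_succ T g N)
    linarith
  have := le_of_tendsto' hlim.neg key
  simpa using this

theorem measurable_birkhoffAverage {T : X → X} {f : X → ℝ} (hT : Measurable T) (hf : Measurable f)
    (n : ℕ) : Measurable (birkhoffAverage ℝ T f n) := by
  have : Measurable (birkhoffSum T f n) :=
    Finset.measurable_sum _ fun k _ => hf.comp (hT.iterate k)
  exact this.const_smul ((n : ℝ)⁻¹)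

/-- The pointwise ergodic theorem for bounded measurable functions on a finite measure space:
the Birkhoff averages converge almost everywhere. -/
theorem ae_exists_tendsto_birkhoffAverage {μ : Measure X} [IsFiniteMeasure μ] {T : X → X}
    (hT : MeasurePreserving T μ μ) {f : X → ℝ} (hf : Measurable f) {C : ℝ} (hC : ∀ x, |f x| ≤ C) :
    ∀ᵐ x ∂μ, ∃ l, Tendsto (fun n => birkhoffAverage ℝ T f n x) atTop (𝓝 l) := by
  have hb : ∀ n x, birkhoffAverage ℝ T f n x ∈ Icc (-C) C := fun n x =>
    abs_le.1 (abs_birkhoffAverage_le hC n x)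
  have hA := measurable_birkhoffAverage hT.measurable hf
  set U : X → ℝ := fun x => limsup (fun n => birkhoffAverage ℝ T f n x) atTop with hU
  set V : X → ℝ := fun x => liminf (fun n => birkhoffAverage ℝ T f n x) atTop with hV
  have hUm : Measurable U := Measurable.limsup hA
  have hVm : Measurable V := Measurable.liminf hA
  have bA : ∀ x, IsBoundedUnder (· ≤ ·) atTop (fun n => birkhoffAverage ℝ T f n x) := fun x =>
    isBoundedUnder_of ⟨C, fun n => (hb n x).2⟩
  have bB : ∀ x, IsBoundedUnder (· ≥ ·) atTop (fun n => birkhoffAverage ℝ T f n x) := fun x =>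
    isBoundedUnder_of ⟨-C, fun n => (hb n x).1⟩
  have hdiff : ∀ x, Tendsto (fun n => birkhoffAverage ℝ T f n (T x) - birkhoffAverage ℝ T f n x)
      atTop (𝓝 0) := fun x =>
    tendsto_birkhoffAverage_apply_sub_birkhoffAverage' ℝ
      ((Metric.isBounded_Icc (-C) C).subset (range_subset_iff.2 fun x => abs_le.1 (hC x))) T x
  -- strict comparison of the upper and the lower limits along the orbit
  have hfreqU : ∀ x b, b < U x ↔ ∃ c, b < c ∧ ∃ᶠ n in atTop, c < birkhoffAverage ℝ T f n x := by
    intro x b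
    constructor
    · intro h
      obtain ⟨c, hc1, hc2⟩ := exists_between h
      exact ⟨c, hc1, frequently_lt_of_lt_limsup (bB x).isCoboundedUnder_le hc2⟩
    · rintro ⟨c, hc1, hc2⟩
      exact hc1.trans_le (le_limsup_of_frequently_le (hc2.mono fun _ h => h.le) (bA x))
  have hfreqV : ∀ x b, V x < b ↔ ∃ c, c < b ∧ ∃ᶠ n in atTop, birkhoffAverage ℝ T f n x < c := by
    intro x b
    constructor
    · intro h
      obtain ⟨c, hc1, hc2⟩ := exists_between h
      exact ⟨c, hc2, frequently_lt_of_liminf_lt (bA x).isCoboundedUnder_ge hc1⟩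
    · rintro ⟨c, hc1, hc2⟩
      exact (liminf_le_of_frequently_le (hc2.mono fun _ h => h.le) (bB x)).trans_lt hc1
  -- The averages at x and at T x differ by a null sequence; lowering the threshold c to some d
  -- still above b absorbs this difference.
  have invU : ∀ x b, b < U (T x) ↔ b < U x := by
    intro x b
    rw [hfreqU, hfreqU]
    constructor
    · rintro ⟨c, hc1, hc2⟩
      obtain ⟨d, hd1, hd2⟩ := exists_between hc1
      refine ⟨d, hd1, (hc2.and_eventually ((hdiff x).eventually_lt_const
        (sub_pos.2 hd2))).mono fun n hn => by linarith [hn.1, hn.2]⟩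
    · rintro ⟨c, hc1, hc2⟩
      obtain ⟨d, hd1, hd2⟩ := exists_between hc1
      refine ⟨d, hd1, (hc2.and_eventually ((hdiff x).eventually_const_lt
        (sub_neg.2 hd2))).mono fun n hn => by linarith [hn.1, hn.2]⟩
  have invV : ∀ x b, V (T x) < b ↔ V x < b := by
    intro x b
    rw [hfreqV, hfreqV]
    constructor
    · rintro ⟨c, hc1, hc2⟩
      obtain ⟨d, hd1, hd2⟩ := exists_between hc1
      refine ⟨d, hd2, (hc2.and_eventually ((hdiff x).eventually_const_lt
        (sub_neg.2 hd1))).mono fun n hn => by linarith [hn.1, hn.2]⟩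
    · rintro ⟨c, hc1, hc2⟩
      obtain ⟨d, hd1, hd2⟩ := exists_between hc1
      refine ⟨d, hd2, (hc2.and_eventually ((hdiff x).eventually_lt_const
        (sub_pos.2 hd1))).mono fun n hn => by linarith [hn.1, hn.2]⟩
  have havg : ∀ (g : X → ℝ) (n : ℕ) x, 0 < birkhoffAverage ℝ T g n x → 0 < birkhoffSum T g n x := by
    intro g n x h
    rw [birkhoffAverage, smul_eq_mul] at h
    exact (pos_iff_pos_of_mul_pos h).1 (by
      rcases Nat.eq_zero_or_pos n with rfl | hn
      · simp at h
      · positivity)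
  have hconst : ∀ (c : ℝ) {n : ℕ} (x : X), n ≠ 0 →
      birkhoffAverage ℝ T (fun y => f y - c) n x = birkhoffAverage ℝ T f n x - c := by
    intro c n x hn
    have hn' : (n : ℝ) ≠ 0 := by exact_mod_cast hn
    simp only [birkhoffAverage, birkhoffSum, smul_eq_mul, Finset.sum_sub_distrib, Finset.sum_const,
      Finset.card_range, nsmul_eq_mul]
    field_simp
  have hconst' : ∀ (c : ℝ) {n : ℕ} (x : X), n ≠ 0 →
      birkhoffAverage ℝ T (fun y => c - f y) n x = c - birkhoffAverage ℝ T f n x := by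
    intro c n x hn
    have hn' : (n : ℝ) ≠ 0 := by exact_mod_cast hn
    simp only [birkhoffAverage, birkhoffSum, smul_eq_mul, Finset.sum_sub_distrib, Finset.sum_const,
      Finset.card_range, nsmul_eq_mul]
    field_simp
  -- The set E is invariant, so the maximal inequality applies to f - b and a - f on E and gives b
  -- μ(E) ≤ ∫ f ≤ a μ(E) over E, which forces μ(E) = 0.
  have hnull : ∀ a b : ℝ, a < b → μ {x | V x < a ∧ b < U x} = 0 := by
    intro a b hab
    set E := {x | V x < a ∧ b < U x} with hE
    have hEm : MeasurableSet E := (measurableSet_lt hVm measurable_const).inter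
      (measurableSet_lt measurable_const hUm)
    have hTE : T ⁻¹' E = E := by
      ext x
      simp only [hE, mem_preimage, mem_ofPred_eq, invU, invV]
    have hTμ : MeasurePreserving T (μ.restrict E) (μ.restrict E) := by
      have := hT.restrict_preimage hEm
      rwa [hTE] at this
    have hfi : Integrable f (μ.restrict E) :=
      Integrable.of_bound hf.aestronglyMeasurable C (ae_of_all _ hC)
    have h1 : 0 ≤ ∫ x, (f x - b) ∂μ.restrict E := by
      refine integral_nonneg_of_exists_birkhoffSum_pos hTμ (hf.sub_const b) (C := C + |b|)
        (fun x => (abs_sub _ _).trans (by linarith [hC x])) ?_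
      filter_upwards [ae_restrict_mem hEm] with x hx
      obtain ⟨c, hc1, hc2⟩ := (hfreqU x b).1 hx.2
      obtain ⟨n, hn, hn0⟩ := (hc2.and_eventually (eventually_ge_atTop 1)).exists
      exact ⟨n, havg _ n x (by rw [hconst b x (by omega)]; linarith)⟩
    have h2 : 0 ≤ ∫ x, (a - f x) ∂μ.restrict E := by
      refine integral_nonneg_of_exists_birkhoffSum_pos hTμ (hf.const_sub a) (C := |a| + C)
        (fun x => (abs_sub _ _).trans (by linarith [hC x])) ?_
      filter_upwards [ae_restrict_mem hEm] with x hx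
      obtain ⟨c, hc1, hc2⟩ := (hfreqV x a).1 hx.1
      obtain ⟨n, hn, hn0⟩ := (hc2.and_eventually (eventually_ge_atTop 1)).exists
      exact ⟨n, havg _ n x (by rw [hconst' a x (by omega)]; linarith)⟩
    rw [integral_sub hfi (integrable_const b)] at h1
    rw [integral_sub (integrable_const a) hfi] at h2
    simp only [integral_const, smul_eq_mul, measureReal_restrict_apply_univ] at h1 h2
    have h3 : 0 ≤ μ.real E := measureReal_nonneg
    have h4 : μ.real E = 0 := by nlinarith
    exact (measureReal_eq_zero_iff).1 h4
  have hall : ∀ᵐ x ∂μ, ∀ a b : ℚ, (a : ℝ) < b → ¬ (V x < a ∧ b < U x) := by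
    simp only [ae_all_iff]
    intro a b hab
    exact measure_eq_zero_iff_ae_notMem.1 (hnull a b hab)
  filter_upwards [hall] with x hx
  refine ⟨U x, tendsto_of_le_liminf_of_limsup_le ?_ le_rfl (bA x) (bB x)⟩
  by_contra hlt
  obtain ⟨a, ha1, ha2⟩ := exists_rat_btwn (not_le.1 hlt)
  obtain ⟨b, hb1, hb2⟩ := exists_rat_btwn ha2
  exact hx a b hb1 ⟨ha1, hb2⟩

end PointwiseErgodic


/-! ### Regularity of the boundary curves, and the domain near a smooth boundary point. -/

/-- Half-open pieces of a partition cover the interval. -/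
theorem exists_mem_Ioc_of_fin_partition {m : ℕ} (t : Fin (m + 1) → ℝ) {s : ℝ}
    (hs : s ∈ Ioc (t 0) (t (Fin.last m))) : ∃ i : Fin m, s ∈ Ioc (t i.castSucc) (t i.succ) := by
  have key : ∀ k : Fin (m + 1), s ∈ Ioc (t 0) (t k) →
      ∃ i : Fin m, s ∈ Ioc (t i.castSucc) (t i.succ) := by
    intro k
    induction k using Fin.induction with
    | zero => intro h; exact absurd h.1 (not_lt.2 h.2)
    | succ i ih =>
      intro h
      rcases le_or_gt s (t i.castSucc) with h' | h'
      · exact ih ⟨h.1, h'⟩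
      · exact ⟨i, h', h.2⟩
  exact key _ hs

namespace IsPiecewiseSmoothArclength

variable {γ : ℝ → ℂ} {L : ℝ}

theorem continuousOn (h : IsPiecewiseSmoothArclength γ L) (hL : 0 < L) :
    ContinuousOn γ (Icc 0 L) := by
  obtain ⟨m, t, ht, h0, h1, hp⟩ := h
  have hc : ContinuousOn γ (⋃ i : Fin m, Icc (t i.castSucc) (t i.succ)) :=
    (locallyFinite_of_finite _).continuousOn_iUnion (fun _ => isClosed_Icc)
      fun i => (hp i).1.continuousOn
  refine hc.mono fun s hs => ?_
  rcases hs.1.eq_or_lt with rfl | hs0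
  · have hm : 0 < m := by
      rcases Nat.eq_zero_or_pos m with rfl | hm
      · exfalso
        have : Fin.last 0 = 0 := rfl
        rw [this, h0] at h1
        exact hL.ne h1
      · exact hm
    refine mem_iUnion.2 ⟨⟨0, hm⟩, ?_, ?_⟩
    · exact h0.le
    · rw [← h0]; exact ht.monotone (Fin.zero_le _)
  · obtain ⟨i, hi⟩ := exists_mem_Ioc_of_fin_partition t (s := s) (by rw [h0, h1]; exact ⟨hs0, hs.2⟩)
    exact mem_iUnion.2 ⟨i, Ioc_subset_Icc_self hi⟩

theorem norm_deriv_eq_one (h : IsPiecewiseSmoothArclength γ L) {s : ℝ} (hs : s ∈ Ioc 0 L)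
    (hd : DifferentiableAt ℝ γ s) : ‖deriv γ s‖ = 1 := by
  obtain ⟨m, t, ht, h0, h1, hp⟩ := h
  obtain ⟨i, hi⟩ := exists_mem_Ioc_of_fin_partition t (s := s) (by rwa [h0, h1])
  have hi' := Ioc_subset_Icc_self hi
  rw [← hd.derivWithin (uniqueDiffOn_Icc (ht i.castSucc_lt_succ) s hi')]
  exact (hp i).2 s hi'

theorem finite_not_contDiffAt (h : IsPiecewiseSmoothArclength γ L) :
    {s ∈ Ioc 0 L | ¬ ContDiffAt ℝ 1 γ s}.Finite := by
  obtain ⟨m, t, ht, h0, h1, hp⟩ := h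
  refine (finite_range t).subset fun s hs => ?_
  obtain ⟨i, hi⟩ := exists_mem_Ioc_of_fin_partition t (s := s) (by rw [h0, h1]; exact hs.1)
  rcases hi.2.eq_or_lt with h | h
  · exact ⟨_, h.symm⟩
  · exact absurd ((hp i).1.contDiffAt (Icc_mem_nhds hi.1 h)) hs.2

end IsPiecewiseSmoothArclength

namespace BilliardTable

variable {q : ℕ} (T : BilliardTable q)

/-- Continuity on one closed period and equal values at its ends let the curve descend to a
continuous map on the circle. -/
theorem continuous_γ (α : Fin q) : Continuous (T.γ α) := by
  have : Fact (0 < T.len α) := ⟨T.len_pos α⟩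
  have h := (T.piecewiseSmooth α).continuousOn (T.len_pos α)
  have h' : ContinuousOn (T.γ α) (Icc 0 (0 + T.len α)) := by rwa [zero_add]
  have hc := AddCircle.liftIco_continuous (T.periodic α 0).symm h'
  have e : T.γ α = AddCircle.liftIco (T.len α) 0 (T.γ α) ∘ (fun s : ℝ => (s : AddCircle (T.len α))) := by
    funext s
    obtain ⟨y, hy, hys⟩ : ∃ y ∈ Ico 0 (0 + T.len α), T.γ α s = T.γ α y ∧
        (s : AddCircle (T.len α)) = y := by
      obtain ⟨n, hn, -⟩ := existsUnique_add_zsmul_mem_Ico (T.len_pos α) s 0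
      refine ⟨_, hn, ?_, ?_⟩
      · rw [(T.periodic α).zsmul n s]
      · simp
    rw [Function.comp_apply, hys.2, AddCircle.liftIco_coe_apply hy, hys.1]
  rw [e]
  exact hc.comp (AddCircle.continuous_mk' _)

theorem exists_int_mul_len_mem_Ioc (α : Fin q) (s a : ℝ) :
    ∃ n : ℤ, s + n * T.len α ∈ Ioc a (a + T.len α) := by
  obtain ⟨n, hn, -⟩ := existsUnique_add_zsmul_mem_Ioc (T.len_pos α) s a
  exact ⟨n, by simpa using hn⟩

theorem exists_int_mul_len_mem_Ico (α : Fin q) (s a : ℝ) :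
    ∃ n : ℤ, s + n * T.len α ∈ Ico a (a + T.len α) := by
  obtain ⟨n, hn, -⟩ := existsUnique_add_zsmul_mem_Ico (T.len_pos α) s a
  exact ⟨n, by simpa using hn⟩

theorem γ_add_int_mul (α : Fin q) (s : ℝ) (n : ℤ) : T.γ α (s + n * T.len α) = T.γ α s :=
  (T.periodic α).int_mul n s

theorem γ_comp_add_int_mul (α : Fin q) (n : ℤ) :
    (fun s => T.γ α (s + n * T.len α)) = T.γ α := funext fun s => T.γ_add_int_mul α s n

theorem deriv_γ_add_int_mul (α : Fin q) (s : ℝ) (n : ℤ) :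
    deriv (T.γ α) (s + n * T.len α) = deriv (T.γ α) s := by
  rw [← deriv_comp_add_const, T.γ_comp_add_int_mul]

theorem contDiffAt_γ_add_int_mul {α : Fin q} {s : ℝ} (h : ContDiffAt ℝ 1 (T.γ α) s) (n : ℤ) :
    ContDiffAt ℝ 1 (T.γ α) (s + n * T.len α) := by
  have e : T.γ α = T.γ α ∘ fun x => x + -(n * T.len α) := by
    funext x
    have := T.γ_add_int_mul α x (-n)
    simp only [Function.comp_apply]
    rw [← this]; push_cast; ring_nf
  rw [e]
  refine ContDiffAt.comp _ ?_ (contDiffAt_id.add contDiffAt_const)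
  simpa using h

theorem differentiableAt_γ_add_int_mul {α : Fin q} {s : ℝ} (h : DifferentiableAt ℝ (T.γ α) s)
    (n : ℤ) : DifferentiableAt ℝ (T.γ α) (s + n * T.len α) := by
  have e : T.γ α = T.γ α ∘ fun x => x + -(n * T.len α) := by
    funext x
    have := T.γ_add_int_mul α x (-n)
    simp only [Function.comp_apply]
    rw [← this]; push_cast; ring_nf
  rw [e]
  refine DifferentiableAt.comp _ ?_ (differentiableAt_id.add_const _)
  simpa using h

theorem norm_deriv_γ {α : Fin q} {s : ℝ} (h : DifferentiableAt ℝ (T.γ α) s) :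
    ‖deriv (T.γ α) s‖ = 1 := by
  obtain ⟨n, hn⟩ := T.exists_int_mul_len_mem_Ioc α s 0
  rw [← T.deriv_γ_add_int_mul α s n]
  rw [zero_add] at hn
  exact (T.piecewiseSmooth α).norm_deriv_eq_one hn (T.differentiableAt_γ_add_int_mul h n)

theorem norm_deriv_γ_le (α : Fin q) (s : ℝ) : ‖deriv (T.γ α) s‖ ≤ 1 := by
  by_cases h : DifferentiableAt ℝ (T.γ α) s
  · exact (T.norm_deriv_γ h).le
  · simp [deriv_zero_of_not_differentiableAt h]

theorem countable_not_contDiffAt (α : Fin q) : {s | ¬ ContDiffAt ℝ 1 (T.γ α) s}.Countable := by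
  have h : {s | ¬ ContDiffAt ℝ 1 (T.γ α) s} ⊆ ⋃ n : ℤ, (fun s => s + n * T.len α) ''
      {s ∈ Ioc 0 (T.len α) | ¬ ContDiffAt ℝ 1 (T.γ α) s} := by
    intro s hs
    obtain ⟨n, hn⟩ := T.exists_int_mul_len_mem_Ioc α s 0
    rw [zero_add] at hn
    refine mem_iUnion.2 ⟨-n, s + n * T.len α, ⟨hn, fun hc => hs ?_⟩, by push_cast; ring⟩
    have := T.contDiffAt_γ_add_int_mul hc (-n)
    push_cast at this
    simpa using this
  exact (countable_iUnion fun n =>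
    ((T.piecewiseSmooth α).finite_not_contDiffAt.image _).countable).mono h

/-- Equal points have parameters that differ by a multiple of the period, and zero is the only
multiple shorter than a period. This frees injectivity from the chosen reference point, so that
windows may be centred at any parameter. -/
theorem γ_eq_imp {α : Fin q} {s s' : ℝ} (h : T.γ α s = T.γ α s') (hlt : |s - s'| < T.len α) :
    s = s' := by
  obtain ⟨n, hn⟩ := T.exists_int_mul_len_mem_Ico α s 0
  obtain ⟨n', hn'⟩ := T.exists_int_mul_len_mem_Ico α s' 0
  rw [zero_add] at hn hn'
  have e := T.injOn α hn hn' (by rw [T.γ_add_int_mul, T.γ_add_int_mul, h])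
  have e2 : s - s' = (n' - n : ℤ) * T.len α := by push_cast; linarith
  have hpos := T.len_pos α
  rw [e2, abs_mul, abs_of_pos hpos] at hlt
  have h3 : |((n' - n : ℤ) : ℝ)| < 1 := by
    by_contra hc
    nlinarith [not_lt.1 hc]
  have h4 : n' - n = 0 := by
    rw [← Int.abs_lt_one_iff]
    exact_mod_cast h3
  rw [h4] at e2
  simp at e2
  linarith

theorem isCompact_image_γ (α : Fin q) {K : Set ℝ} (hK : IsCompact K) : IsCompact (T.γ α '' K) :=
  hK.image (T.continuous_γ α)

theorem range_γ (α : Fin q) (a : ℝ) : range (T.γ α) = T.γ α '' Icc a (a + T.len α) := by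
  refine (image_subset_range _ _).antisymm' ?_
  rintro _ ⟨s, rfl⟩
  obtain ⟨n, hn⟩ := T.exists_int_mul_len_mem_Ico α s a
  exact ⟨_, Ico_subset_Icc_self hn, T.γ_add_int_mul α s n⟩

theorem isClosed_range_γ (α : Fin q) : IsClosed (range (T.γ α)) := by
  rw [T.range_γ α 0]
  exact (T.isCompact_image_γ α isCompact_Icc).isClosed

theorem γ_mem_frontier (α : Fin q) (s : ℝ) : T.γ α s ∈ frontier T.Ω := by
  rw [T.frontier_eq]
  exact mem_iUnion.2 ⟨α, s, rfl⟩

theorem notMem_Ω_of_mem_frontier {x : ℂ} (h : x ∈ frontier T.Ω) : x ∉ T.Ω := by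
  intro hx
  have := h.2
  rw [T.isOpen.interior_eq] at this
  exact this hx

theorem γ_notMem_Ω (α : Fin q) (s : ℝ) : T.γ α s ∉ T.Ω :=
  T.notMem_Ω_of_mem_frontier (T.γ_mem_frontier α s)

theorem exists_mem_Ico_of_mem_frontier {x : ℂ} (h : x ∈ frontier T.Ω) :
    ∃ α, ∃ s ∈ Ico 0 (T.len α), T.γ α s = x := by
  rw [T.frontier_eq] at h
  obtain ⟨α, s, rfl⟩ := mem_iUnion.1 h
  obtain ⟨n, hn⟩ := T.exists_int_mul_len_mem_Ico α s 0
  rw [zero_add] at hn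
  exact ⟨α, _, hn, T.γ_add_int_mul α s n⟩

/-- Near a boundary point, the boundary consists of the arc around this point. -/
theorem exists_arc_of_frontier_near (α : Fin q) (s₀ : ℝ) {η : ℝ} (hη : 0 < η) :
    ∃ δ > 0, ∀ x ∈ frontier T.Ω, ‖x - T.γ α s₀‖ < δ → ∃ h, |h| < η ∧ x = T.γ α (s₀ + h) := by
  set L := T.len α with hL
  have hLpos : 0 < L := T.len_pos α
  -- The part of the boundary to be kept away: the other components, and the points of a period
  -- centred at `s₀` whose parameter is at distance at least η from `s₀`. It is closed and misses
  -- the point, so some ball avoids it.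
  set K : Set ℂ := (⋃ β : {β // β ≠ α}, range (T.γ β)) ∪
    T.γ α '' (Icc (s₀ - L / 2) (s₀ - L / 2 + L) ∩ {s | η ≤ |s - s₀|}) with hK
  have hKc : IsClosed K := by
    refine IsClosed.union (isClosed_iUnion_of_finite fun β => T.isClosed_range_γ β) ?_
    refine (T.isCompact_image_γ α (isCompact_Icc.inter_right ?_)).isClosed
    exact isClosed_le continuous_const (by fun_prop)
  have hnot : T.γ α s₀ ∉ K := by
    rintro (h | ⟨s, ⟨hs, hs2⟩, he⟩)
    · obtain ⟨⟨β, hβ⟩, hx⟩ := mem_iUnion.1 h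
      exact (Set.disjoint_left.1 (T.disjoint hβ)) hx ⟨s₀, rfl⟩
    · have : s = s₀ := T.γ_eq_imp he (by
        rw [abs_lt]; constructor <;> linarith [hs.1, hs.2])
      rw [this] at hs2
      simp only [mem_ofPred_eq, sub_self, abs_zero] at hs2
      linarith
  obtain ⟨δ, hδ, hb⟩ := Metric.isOpen_iff.1 hKc.isOpen_compl _ hnot
  refine ⟨δ, hδ, fun x hx hxd => ?_⟩
  have hxK : x ∉ K := hb (by rwa [Metric.mem_ball, dist_eq_norm])
  rw [T.frontier_eq] at hx
  obtain ⟨β, hxβ⟩ := mem_iUnion.1 hx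
  have hβ : β = α := by
    by_contra hne
    exact hxK (Or.inl (mem_iUnion.2 ⟨⟨β, hne⟩, hxβ⟩))
  subst hβ
  rw [T.range_γ β (s₀ - L / 2)] at hxβ
  obtain ⟨s, hs, rfl⟩ := hxβ
  refine ⟨s - s₀, ?_, by ring_nf⟩
  by_contra hc
  exact hxK (Or.inr ⟨s, ⟨hs, not_lt.1 hc⟩, rfl⟩)

/-- The double cone with the normal axis at a smooth boundary point does not meet the boundary
near this point. -/
theorem exists_cone_disjoint_frontier {α : Fin q} {s : ℝ} (hd : DifferentiableAt ℝ (T.γ α) s)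
    {c : ℝ} (hc : 0 < c) :
    ∃ δ > 0, ∀ z : ℂ, ‖z‖ < δ → c * ‖z‖ < |z.im| →
      T.γ α s + deriv (T.γ α) s * z ∉ frontier T.Ω := by
  set τ := deriv (T.γ α) s with hτ
  have hτ1 : ‖τ‖ = 1 := T.norm_deriv_γ hd
  have hτ0 : τ ≠ 0 := by rw [← norm_ne_zero_iff, hτ1]; exact one_ne_zero
  -- A boundary point with parameter s + h has tangent-frame coordinate z with |z - h| ≤ c'|h|. The
  -- bound 1/2 gives |h| ≤ 2‖z‖, and then c/2 gives |Im z| ≤ c‖z‖, so the point is outside the cone.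
  set c' := min (c / 2) (1 / 2) with hc'
  have hc'0 : 0 < c' := by positivity
  have hder := hd.hasDerivAt.isLittleO
  rw [Asymptotics.isLittleO_iff] at hder
  have h1 := hder hc'0
  obtain ⟨η, hη, hη2⟩ := Metric.eventually_nhds_iff.1 h1
  obtain ⟨δ, hδ, hfr⟩ := T.exists_arc_of_frontier_near α s hη
  refine ⟨δ, hδ, fun z hz hzc hmem => ?_⟩
  obtain ⟨h, hh, he⟩ := hfr _ hmem (by
    rw [add_sub_cancel_left, norm_mul, hτ1, one_mul]; exact hz)
  have h2 := hη2 (y := s + h) (by rw [Real.dist_eq, add_sub_cancel_left]; exact hh)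
  rw [← he, add_sub_cancel_left, add_sub_cancel_left, ← hτ, Real.norm_eq_abs] at h2
  have e : τ * z - h • τ = τ * (z - h) := by rw [Complex.real_smul]; ring
  rw [e, norm_mul, hτ1, one_mul] at h2
  have h3 : |z.im| ≤ c' * |h| := by
    have := (Complex.abs_im_le_norm (z - h)).trans h2
    simpa using this
  have h4 : |h| ≤ ‖z‖ + c' * |h| := by
    have : ‖(h : ℂ)‖ ≤ ‖z‖ + ‖z - h‖ := by
      rw [← norm_sub_rev]
      calc ‖(h : ℂ)‖ = ‖z - (z - h)‖ := by ring_nf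
        _ ≤ ‖z‖ + ‖z - h‖ := norm_sub_le _ _
        _ = ‖z‖ + ‖↑h - z‖ := by rw [norm_sub_rev z]
    rw [Complex.norm_real, Real.norm_eq_abs] at this
    linarith
  have h5 : c' ≤ c / 2 := min_le_left _ _
  have h6 : c' ≤ 1 / 2 := min_le_right _ _
  have h7 : |h| ≤ 2 * ‖z‖ := by nlinarith [abs_nonneg h]
  nlinarith [abs_nonneg h, norm_nonneg z]

/-- Supplies connectedness: a connected set that misses the frontier lies in Ω as soon as it meets
Ω. -/
theorem convex_normal_cone (c δ : ℝ) (hc : 0 ≤ c) :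
    Convex ℝ {z : ℂ | ‖z‖ < δ ∧ c * ‖z‖ < z.im} := by
  have h1 : Convex ℝ {z : ℂ | ‖z‖ < δ} := by
    have := convex_ball (0 : ℂ) δ
    simpa [Metric.ball, dist_eq_norm] using this
  refine h1.inter ?_
  intro x hx y hy a b ha hb hab
  have hx' : c * ‖x‖ < x.im := hx
  have hy' : c * ‖y‖ < y.im := hy
  change c * ‖a • x + b • y‖ < (a • x + b • y).im
  rw [Complex.add_im, Complex.smul_im, Complex.smul_im, smul_eq_mul, smul_eq_mul]
  have h : ‖a • x + b • y‖ ≤ a * ‖x‖ + b * ‖y‖ := by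
    refine (norm_add_le _ _).trans_eq ?_
    rw [norm_smul, norm_smul, Real.norm_of_nonneg ha, Real.norm_of_nonneg hb]
  rcases ha.eq_or_lt with rfl | ha'
  · have : b = 1 := by linarith
    subst this
    simpa using hy'
  · nlinarith [mul_le_mul_of_nonneg_left h hc, mul_lt_mul_of_pos_left hx' ha',
      mul_le_mul_of_nonneg_left hy'.le hb]

/-- The inner cone at a smooth boundary point is contained in the domain near this point. -/
theorem exists_cone_subset_Ω {α : Fin q} {s : ℝ} (hd : ContDiffAt ℝ 1 (T.γ α) s)
    {c : ℝ} (hc : 0 < c) (hc1 : c < 1) :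
    ∃ δ > 0, ∀ z : ℂ, ‖z‖ < δ → c * ‖z‖ < z.im → T.γ α s + deriv (T.γ α) s * z ∈ T.Ω := by
  obtain ⟨δ, hδ, hfr⟩ := T.exists_cone_disjoint_frontier (hd.differentiableAt one_ne_zero) hc
  refine ⟨δ, hδ, ?_⟩
  set C := {z : ℂ | ‖z‖ < δ ∧ c * ‖z‖ < z.im} with hC
  have hpre : IsPreconnected ((fun z => T.γ α s + deriv (T.γ α) s * z) '' C) :=
    (convex_normal_cone c δ hc.le).isPreconnected.image _ (by fun_prop)
  have hsub := hpre.subset_of_closure_inter_subset T.isOpen ?_ ?_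
  · exact fun z h1 h2 => hsub ⟨z, ⟨h1, h2⟩, rfl⟩
  -- The orientation gives a point of Ω on the normal axis, and the axis lies in the cone because c
  -- < 1.
  · obtain ⟨ε, hε, hε0, hεδ⟩ := ((T.positivelyOriented α s hd).and
      (Ioo_mem_nhdsGT hδ)).exists
    refine ⟨_, ⟨Complex.I * ε, ⟨?_, ?_⟩, ?_⟩, hε⟩
    · simpa [abs_of_pos hε0] using hεδ
    · simp only [norm_mul, Complex.norm_I, Complex.norm_real, Real.norm_eq_abs, abs_of_pos hε0,
        one_mul, Complex.mul_im, Complex.I_re, Complex.I_im, Complex.ofReal_re, Complex.ofReal_im]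
      nlinarith
    · ring
  · rintro _ ⟨hx, z, hz, rfl⟩
    by_contra hn
    refine hfr z hz.1 (hz.2.trans_le (le_abs_self _)) ⟨hx, ?_⟩
    rwa [T.isOpen.interior_eq]

end BilliardTable

/-! ### Winding integrals and the one-sidedness of the boundary. -/

namespace BilliardTable

variable {q : ℕ} (T : BilliardTable q)

/-- `2πi` times the winding number of a boundary component. -/
def windingIntegral (α : Fin q) (a : ℝ) (z : ℂ) : ℂ :=
  ∫ s in a..a + T.len α, deriv (T.γ α) s / (T.γ α s - z)

theorem intervalIntegrable_deriv_div (α : Fin q) (a b : ℝ) {f : ℝ → ℂ} (hf : Continuous f)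
    (h0 : ∀ s, f s ≠ 0) : IntervalIntegrable (fun s => deriv (T.γ α) s / f s) volume a b := by
  have h1 : IntervalIntegrable (deriv (T.γ α)) volume a b := by
    refine (intervalIntegrable_const (c := (1 : ℝ))).mono_fun
      (measurable_deriv _).aestronglyMeasurable (ae_of_all _ fun s => ?_)
    simpa using T.norm_deriv_γ_le α s
  simp only [div_eq_mul_inv]
  exact h1.mul_continuousOn (hf.inv₀ h0).continuousOn

theorem hasDerivAt_windingIntegral (α : Fin q) (a : ℝ) {z₀ : ℂ} (hz : z₀ ∈ T.Ω) :
    HasDerivAt (T.windingIntegral α a) 0 z₀ := by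
  obtain ⟨r, hr, hball⟩ := Metric.isOpen_iff.1 T.isOpen z₀ hz
  have hdist : ∀ s, ∀ z ∈ Metric.ball z₀ (r / 2), r / 2 ≤ ‖T.γ α s - z‖ := by
    intro s z hz
    by_contra hlt
    refine T.γ_notMem_Ω α s (hball ?_)
    rw [Metric.mem_ball, dist_eq_norm] at hz ⊢
    calc ‖T.γ α s - z₀‖ = ‖(T.γ α s - z) + (z - z₀)‖ := by ring_nf
      _ ≤ ‖T.γ α s - z‖ + ‖z - z₀‖ := norm_add_le _ _
      _ < r := by linarith [not_le.1 hlt]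
  have hne : ∀ s, ∀ z ∈ Metric.ball z₀ (r / 2), T.γ α s - z ≠ 0 := fun s z hz h => by
    have := hdist s z hz
    rw [h, norm_zero] at this
    linarith
  have hz₀ : z₀ ∈ Metric.ball z₀ (r / 2) := Metric.mem_ball_self (by positivity)
  have hc := T.continuous_γ α
  have key := intervalIntegral.hasDerivAt_integral_of_dominated_loc_of_deriv_le
    (F := fun z s => deriv (T.γ α) s / (T.γ α s - z))
    (F' := fun z s => deriv (T.γ α) s / (T.γ α s - z) ^ 2)
    (bound := fun _ => 1 / (r / 2) ^ 2) (a := a) (b := a + T.len α) (μ := volume)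
    (Metric.ball_mem_nhds z₀ (by positivity : 0 < r / 2))
    (Eventually.of_forall fun z =>
      ((measurable_deriv _).div (hc.measurable.sub_const z)).aestronglyMeasurable)
    (T.intervalIntegrable_deriv_div α _ _ (hc.sub continuous_const) fun s => hne s z₀ hz₀)
    ((measurable_deriv _).div ((hc.measurable.sub_const z₀).pow_const 2)).aestronglyMeasurable
    (ae_of_all _ fun s _ z hz => ?_) intervalIntegrable_const
    (ae_of_all _ fun s _ z hz => ?_)
  -- The integrand is the derivative of -1/(γ - z₀) off the countably many corners, and this
  -- primitive takes the same value at both ends of a period.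
  · have h0 : ∫ s in a..a + T.len α, deriv (T.γ α) s / (T.γ α s - z₀) ^ 2 = 0 := by
      have h := MeasureTheory.integral_eq_of_hasDerivAt_off_countable
        (fun s => -(T.γ α s - z₀)⁻¹) (fun s => deriv (T.γ α) s / (T.γ α s - z₀) ^ 2)
        (a := a) (b := a + T.len α) (T.countable_not_contDiffAt α)
        ((hc.sub continuous_const).inv₀ fun s => hne s z₀ hz₀).neg.continuousOn
        (fun s hs => ?_)
        (T.intervalIntegrable_deriv_div α _ _ ((hc.sub continuous_const).pow 2)
          fun s => pow_ne_zero 2 (hne s z₀ hz₀))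
      · rw [h, T.periodic α a]; ring
      · have hs' : ContDiffAt ℝ 1 (T.γ α) s := not_not.1 hs.2
        have hd := (hs'.differentiableAt one_ne_zero).hasDerivAt
        have := ((hd.sub_const z₀).inv (hne s z₀ hz₀)).neg
        exact this.congr_deriv (by rw [neg_div, neg_neg])
    rw [← h0]
    exact key.2
  · have h1 := hdist s z hz
    rw [norm_div, norm_pow]
    exact div_le_div₀ zero_le_one (T.norm_deriv_γ_le α s) (by positivity)
      (pow_le_pow_left₀ (by positivity) h1 2)
  · have h1 : HasDerivAt (fun z => T.γ α s - z) (-1) z := (hasDerivAt_id z).const_sub _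
    have := (h1.inv (hne s z hz)).const_mul (deriv (T.γ α) s)
    refine (this.congr_deriv ?_).congr_of_eventuallyEq
      (Eventually.of_forall fun y => div_eq_mul_inv _ _)
    rw [neg_neg, mul_one_div]

/-- A vanishing complex derivative on a connected open set suffices; integrality of the winding
number is never used. -/
theorem windingIntegral_eq (α : Fin q) (a : ℝ) {z w : ℂ} (hz : z ∈ T.Ω) (hw : w ∈ T.Ω) :
    T.windingIntegral α a z = T.windingIntegral α a w :=
  T.isOpen.is_const_of_deriv_eq_zero T.isConnected.isPreconnected
    (fun _ hx => (T.hasDerivAt_windingIntegral α a hx).differentiableAt.differentiableWithinAt)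
    (fun _ hx => (T.hasDerivAt_windingIntegral α a hx).deriv) hz hw

/-- A quadratic lower bound for the product of the distances to two points symmetric with respect
to a smooth boundary point. -/
theorem exists_quadratic_lower_bound {α : Fin q} {s₀ : ℝ}
    (hd : DifferentiableAt ℝ (T.γ α) s₀) :
    ∃ κ > 0, ∃ ε₀ > 0, ∀ ε h : ℝ, 0 < ε → ε < ε₀ → |h| ≤ T.len α / 2 →
      κ * (h ^ 2 + ε ^ 2) ≤
        ‖(T.γ α (s₀ + h) - T.γ α s₀) ^ 2 + (ε * deriv (T.γ α) s₀) ^ 2‖ := by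
  set τ := deriv (T.γ α) s₀ with hτ
  set L := T.len α with hL
  have hLpos : 0 < L := T.len_pos α
  have hτ1 : ‖τ‖ = 1 := T.norm_deriv_γ hd
  have hτ0 : τ ≠ 0 := by rw [← norm_ne_zero_iff, hτ1]; exact one_ne_zero
  set u : ℝ → ℂ := fun h => (T.γ α (s₀ + h) - T.γ α s₀) / τ with hu
  have hnorm : ∀ ε h : ℝ, ‖(T.γ α (s₀ + h) - T.γ α s₀) ^ 2 + (ε * τ) ^ 2‖ =
      ‖u h ^ 2 + (ε : ℂ) ^ 2‖ := by
    intro ε h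
    have : (T.γ α (s₀ + h) - T.γ α s₀) ^ 2 + (ε * τ) ^ 2 = τ ^ 2 * (u h ^ 2 + (ε : ℂ) ^ 2) := by
      simp only [hu]; field_simp
    rw [this, norm_mul, norm_pow, hτ1]; ring
  have hder := hd.hasDerivAt.isLittleO
  rw [Asymptotics.isLittleO_iff] at hder
  -- With relative error 1/8, the square of u h has real part at least h²/2.
  obtain ⟨η, hη, hη2⟩ := Metric.eventually_nhds_iff.1 (hder (by norm_num : (0 : ℝ) < 1 / 8))
  have hnear : ∀ h, |h| < η → ‖u h - h‖ ≤ 1 / 8 * |h| := by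
    intro h hh
    have h2 := hη2 (y := s₀ + h) (by rw [Real.dist_eq, add_sub_cancel_left]; exact hh)
    rw [add_sub_cancel_left, Real.norm_eq_abs] at h2
    have : u h - h = (T.γ α (s₀ + h) - T.γ α s₀ - h • deriv (T.γ α) s₀) / τ := by
      simp only [hu, Complex.real_smul, ← hτ]; field_simp
    rw [this, norm_div, hτ1, div_one]
    exact h2
  -- away from the point
  have hfar : ∃ d > 0, ∀ h, η ≤ |h| → |h| ≤ L / 2 → d ≤ ‖u h‖ := by
    have hK : IsCompact (Icc (-(L / 2)) (L / 2) ∩ {h | η ≤ |h|}) :=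
      isCompact_Icc.inter_right (isClosed_le continuous_const continuous_abs)
    have hcu : Continuous fun h => ‖u h‖ :=
      (((T.continuous_γ α).comp (continuous_const.add continuous_id)).sub
        continuous_const).div_const τ |>.norm
    rcases (Icc (-(L / 2)) (L / 2) ∩ {h | η ≤ |h|}).eq_empty_or_nonempty with he | hne
    · refine ⟨1, one_pos, fun h h1 h2 => ?_⟩
      have : h ∈ Icc (-(L / 2)) (L / 2) ∩ {h | η ≤ |h|} := ⟨abs_le.1 h2, h1⟩
      rw [he] at this
      exact this.elim
    · obtain ⟨x, hx, hmin⟩ := hK.exists_isMinOn hne hcu.continuousOn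
      refine ⟨‖u x‖, ?_, fun h h1 h2 => hmin ⟨abs_le.2 (abs_le.1 h2) |> abs_le.1, h1⟩⟩
      refine norm_pos_iff.2 fun h0 => ?_
      simp only [hu, div_eq_zero_iff, hτ0, or_false, sub_eq_zero] at h0
      have hx1 := abs_le.2 hx.1
      have := T.γ_eq_imp h0 (by rw [add_sub_cancel_left]; linarith)
      have hx0 : x = 0 := by linarith
      have := hx.2
      rw [hx0] at this
      simp only [mem_ofPred_eq, abs_zero] at this
      linarith
  obtain ⟨d, hd0, hdf⟩ := hfar
  -- The constant 1/2 serves for |h| < η. Otherwise ‖u h‖ ≥ d and ε < d/2 give modulus at least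
  -- d²/2, while h² + ε² ≤ (L² + d²)/4; the second constant is the quotient.
  refine ⟨min (1 / 2) (2 * d ^ 2 / (L ^ 2 + d ^ 2)), by positivity, d / 2, by positivity,
    fun ε h hε0 hε1 hh => ?_⟩
  rw [hnorm]
  rcases lt_or_ge |h| η with hn | hf
  · have h1 := hnear h hn
    have h2 : (h ^ 2 + ε ^ 2) / 2 ≤ (u h ^ 2 + (ε : ℂ) ^ 2).re := by
      have hre := (Complex.abs_re_le_norm _).trans h1
      have him := (Complex.abs_im_le_norm _).trans h1
      simp only [Complex.sub_re, Complex.sub_im, Complex.ofReal_re, Complex.ofReal_im,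
        sub_zero] at hre him
      have e : (u h ^ 2 + (ε : ℂ) ^ 2).re = (u h).re ^ 2 - (u h).im ^ 2 + ε ^ 2 := by
        simp [pow_two]
      rw [e]
      have h3 : (u h).im ^ 2 ≤ 1 / 64 * h ^ 2 := by
        rw [← sq_abs, ← sq_abs h]; nlinarith [abs_nonneg (u h).im, abs_nonneg h]
      have h4 : ((u h).re - h) ^ 2 ≤ 1 / 64 * h ^ 2 := by
        rw [← sq_abs, ← sq_abs h]; nlinarith [abs_nonneg ((u h).re - h), abs_nonneg h]
      nlinarith [sq_nonneg ((u h).re - h - h / 8), sq_nonneg ((u h).re - h + h / 8), sq_nonneg h,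
        sq_nonneg ε]
    calc _ ≤ 1 / 2 * (h ^ 2 + ε ^ 2) := by gcongr; exact min_le_left _ _
      _ = (h ^ 2 + ε ^ 2) / 2 := by ring
      _ ≤ _ := h2.trans (Complex.re_le_norm _)
  · have h1 := hdf h hf hh
    have h2 : d ^ 2 / 2 ≤ ‖u h ^ 2 + (ε : ℂ) ^ 2‖ := by
      have h3 : ‖u h ^ 2‖ - ‖(ε : ℂ) ^ 2‖ ≤ ‖u h ^ 2 + (ε : ℂ) ^ 2‖ := by
        have := norm_sub_norm_le (u h ^ 2) (-(ε : ℂ) ^ 2)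
        simpa using this
      rw [norm_pow, norm_pow, Complex.norm_real, Real.norm_eq_abs, abs_of_pos hε0] at h3
      nlinarith
    have h3 : h ^ 2 + ε ^ 2 ≤ (L ^ 2 + d ^ 2) / 4 := by
      rw [← sq_abs h]; nlinarith [abs_nonneg h]
    calc _ ≤ 2 * d ^ 2 / (L ^ 2 + d ^ 2) * ((L ^ 2 + d ^ 2) / 4) := by
          gcongr; exact min_le_right _ _
      _ = d ^ 2 / 2 := by field_simp; ring
      _ ≤ _ := h2

/-- The jump of the winding integral across the boundary. -/
theorem tendsto_windingIntegral_jump {α : Fin q} {s₀ : ℝ} (hd : ContDiffAt ℝ 1 (T.γ α) s₀) :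
    Tendsto (fun ε : ℝ => ∫ s in s₀ - T.len α / 2..s₀ + T.len α / 2,
      deriv (T.γ α) s * (2 * Complex.I * ε * deriv (T.γ α) s₀ /
        ((T.γ α s - T.γ α s₀) ^ 2 + (ε * deriv (T.γ α) s₀) ^ 2))) (𝓝[>] 0)
      (𝓝 (2 * Complex.I * Real.pi)) := by
  set τ := deriv (T.γ α) s₀ with hτ
  set L := T.len α with hL
  have hLpos : 0 < L := T.len_pos α
  have hdiff := hd.differentiableAt one_ne_zero
  have hτ1 : ‖τ‖ = 1 := T.norm_deriv_γ hdiff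
  have hτ0 : τ ≠ 0 := by rw [← norm_ne_zero_iff, hτ1]; exact one_ne_zero
  obtain ⟨κ, hκ, ε₀, hε₀, hbound⟩ := T.exists_quadratic_lower_bound hdiff
  -- The integrand after the substitution s = s₀ + εy, with its Jacobian ε. It tends to 2i/(1 + y²)
  -- and is dominated by a multiple of 1/(1 + y²) thanks to the quadratic lower bound; the limit has
  -- integral 2πi.
  set G : ℝ → ℝ → ℂ := fun ε y => deriv (T.γ α) (s₀ + ε * y) * (2 * Complex.I * ε ^ 2 * τ /
        ((T.γ α (s₀ + ε * y) - T.γ α s₀) ^ 2 + (ε * τ) ^ 2)) with hG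
  have hGm : ∀ ε, Measurable (G ε) := fun ε => by
    have h1 : Measurable fun y : ℝ => s₀ + ε * y := by fun_prop
    exact ((measurable_deriv _).comp h1).mul (measurable_const.div
      (((((T.continuous_γ α).measurable.comp h1).sub_const _).pow_const 2).add_const _))
  have hlim : Tendsto (fun ε : ℝ => ∫ y, (Ioc (-(L / 2) / ε) (L / 2 / ε)).indicator (G ε) y)
      (𝓝[>] 0) (𝓝 (∫ y : ℝ, 2 * Complex.I * ((1 + y ^ 2)⁻¹ : ℝ))) := by
    refine tendsto_integral_filter_of_dominated_convergence
      (fun y => 2 / κ * (1 + y ^ 2)⁻¹) ?_ ?_ (integrable_inv_one_add_sq.const_mul _) ?_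
    · exact Eventually.of_forall fun ε =>
        ((hGm ε).indicator measurableSet_Ioc).aestronglyMeasurable
    · filter_upwards [Ioo_mem_nhdsGT hε₀] with ε hε
      refine ae_of_all _ fun y => ?_
      have hεpos := hε.1
      by_cases hy : y ∈ Ioc (-(L / 2) / ε) (L / 2 / ε)
      · rw [indicator_of_mem hy]
        have hy1 : |ε * y| ≤ L / 2 := by
          have h1 := (div_lt_iff₀ hεpos).1 hy.1
          have h2 := (le_div_iff₀ hεpos).1 hy.2
          rw [abs_le]; constructor <;> linarith
        have hb := hbound ε (ε * y) hεpos hε.2 hy1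
        have hpos : 0 < κ * ((ε * y) ^ 2 + ε ^ 2) := by positivity
        simp only [hG]
        rw [norm_mul, norm_div]
        have hnum : ‖2 * Complex.I * (ε : ℂ) ^ 2 * τ‖ = 2 * ε ^ 2 := by
          simp [hτ1]
        rw [hnum]
        calc _ ≤ 1 * (2 * ε ^ 2 / (κ * ((ε * y) ^ 2 + ε ^ 2))) := by
              gcongr
              exact T.norm_deriv_γ_le α _
          _ = 2 / κ * (1 + y ^ 2)⁻¹ := by field_simp; ring
      · rw [indicator_of_notMem hy, norm_zero]; positivity
    · refine ae_of_all _ fun y => ?_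
      have h0 : Tendsto (fun ε : ℝ => s₀ + ε * y) (𝓝[>] 0) (𝓝 s₀) := by
        have : Tendsto (fun ε : ℝ => s₀ + ε * y) (𝓝 0) (𝓝 (s₀ + 0 * y)) :=
          Continuous.tendsto (by fun_prop) 0
        rw [zero_mul, add_zero] at this
        exact this.mono_left nhdsWithin_le_nhds
      have h1 : Tendsto (fun ε : ℝ => deriv (T.γ α) (s₀ + ε * y)) (𝓝[>] 0) (𝓝 τ) := by
        have : ContinuousAt (deriv (T.γ α)) s₀ := by
          obtain ⟨u, hu, hcu⟩ := hd.contDiffOn le_rfl (by simp)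
          obtain ⟨v, hvu, hvo, hv⟩ := mem_nhds_iff.1 (by simpa using hu)
          exact ((hcu.mono hvu).continuousOn_deriv_of_isOpen hvo le_rfl).continuousAt
            (hvo.mem_nhds hv)
        exact this.tendsto.comp h0
      have h2 : Tendsto (fun ε : ℝ => (T.γ α (s₀ + ε * y) - T.γ α s₀) / ε) (𝓝[>] 0)
          (𝓝 (τ * y)) := by
        have hy : HasDerivAt (fun ε : ℝ => T.γ α (s₀ + ε * y)) (y • τ) 0 := by
          have ha : HasDerivAt (fun ε : ℝ => s₀ + ε * y) y 0 := by
            simpa using ((hasDerivAt_id (0 : ℝ)).mul_const y).const_add s₀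
          have hb : HasDerivAt (T.γ α) τ (s₀ + 0 * y) := by
            rw [zero_mul, add_zero]; exact hdiff.hasDerivAt
          exact hb.scomp (0 : ℝ) ha
        have := hy.tendsto_slope_zero_right
        simp only [zero_add, zero_mul, add_zero, Complex.real_smul] at this
        rw [mul_comm τ]
        refine this.congr fun ε => ?_
        push_cast
        rw [div_eq_inv_mul]
      have h3 : Tendsto (fun ε : ℝ => deriv (T.γ α) (s₀ + ε * y) * (2 * Complex.I * τ /
          (((T.γ α (s₀ + ε * y) - T.γ α s₀) / ε) ^ 2 + τ ^ 2))) (𝓝[>] 0)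
          (𝓝 (τ * (2 * Complex.I * τ / ((τ * y) ^ 2 + τ ^ 2)))) := by
        refine h1.mul (tendsto_const_nhds.div ((h2.pow 2).add tendsto_const_nhds) ?_)
        have : (τ * y) ^ 2 + τ ^ 2 = τ ^ 2 * ((1 + y ^ 2 : ℝ) : ℂ) := by push_cast; ring
        rw [this]
        refine mul_ne_zero (pow_ne_zero 2 hτ0) ?_
        exact_mod_cast (by positivity : (1 + y ^ 2 : ℝ) ≠ 0)
      have h4 : τ * (2 * Complex.I * τ / ((τ * y) ^ 2 + τ ^ 2)) =
          2 * Complex.I * ((1 + y ^ 2)⁻¹ : ℝ) := by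
        have h5 : (1 + (y : ℂ) ^ 2) ≠ 0 := by
          exact_mod_cast (by positivity : (1 + y ^ 2 : ℝ) ≠ 0)
        have : (τ * y) ^ 2 + τ ^ 2 = τ ^ 2 * (1 + (y : ℂ) ^ 2) := by ring
        rw [this]
        push_cast
        field_simp
      rw [h4] at h3
      refine h3.congr' ?_
      have hmem : ∀ᶠ ε : ℝ in 𝓝[>] 0, |ε * y| < L / 2 := by
        have : Tendsto (fun ε : ℝ => |ε * y|) (𝓝 0) (𝓝 |0 * y|) :=
          Continuous.tendsto (by fun_prop) 0
        rw [zero_mul, abs_zero] at this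
        exact (this.mono_left nhdsWithin_le_nhds).eventually_lt_const (by positivity)
      filter_upwards [hmem, self_mem_nhdsWithin] with ε hε hεpos
      have hεpos : 0 < ε := hεpos
      have hε' := abs_lt.1 hε
      rw [indicator_of_mem]
      · simp only [hG]
        congr 1
        have hεc : (ε : ℂ) ≠ 0 := by exact_mod_cast hεpos.ne'
        have : (T.γ α (s₀ + ε * y) - T.γ α s₀) ^ 2 + (ε * τ) ^ 2 =
            (ε : ℂ) ^ 2 * (((T.γ α (s₀ + ε * y) - T.γ α s₀) / ε) ^ 2 + τ ^ 2) := by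
          field_simp
        rw [this, show 2 * Complex.I * (ε : ℂ) ^ 2 * τ = (ε : ℂ) ^ 2 * (2 * Complex.I * τ) by ring,
          mul_div_mul_left _ _ (pow_ne_zero 2 hεc)]
      · constructor
        · rw [div_lt_iff₀ hεpos]; linarith [hε'.1]
        · rw [le_div_iff₀ hεpos]; linarith [hε'.2]
  have hval : ∫ y : ℝ, 2 * Complex.I * (((1 + y ^ 2)⁻¹ : ℝ) : ℂ) = 2 * Complex.I * Real.pi := by
    rw [integral_const_mul, integral_complex_ofReal, integral_univ_inv_one_add_sq]
  rw [hval] at hlim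
  refine hlim.congr' ?_
  filter_upwards [self_mem_nhdsWithin] with ε hεpos
  have hεpos : 0 < ε := hεpos
  rw [integral_indicator measurableSet_Ioc, ← intervalIntegral.integral_of_le (by
    gcongr; linarith)]
  have hsub := intervalIntegral.smul_integral_comp_add_mul (a := -(L / 2) / ε) (b := L / 2 / ε)
    (fun s => deriv (T.γ α) s * (2 * Complex.I * ε * τ /
        ((T.γ α s - T.γ α s₀) ^ 2 + (ε * τ) ^ 2))) ε s₀
  rw [mul_div_cancel₀ _ hεpos.ne', mul_div_cancel₀ _ hεpos.ne', ← sub_eq_add_neg] at hsub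
  rw [← hsub, ← intervalIntegral.integral_smul]
  refine intervalIntegral.integral_congr fun y _ => ?_
  simp only [hG, Complex.real_smul]
  ring

/-- The domain lies on the left side of its boundary only. -/
theorem not_eventually_right_mem_Ω {α : Fin q} {s : ℝ} (hd : ContDiffAt ℝ 1 (T.γ α) s) :
    ¬ ∀ᶠ ε : ℝ in 𝓝[>] 0, T.γ α s - ε * (Complex.I * deriv (T.γ α) s) ∈ T.Ω := by
  intro hright
  have hlim := T.tendsto_windingIntegral_jump hd
  -- If the points at distance ε on both normals lie in Ω, their winding integrals agree. The
  -- integrand is exactly the difference of the two winding integrands, so the jump would be zero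
  -- instead of 2πi.
  have hzero : Tendsto (fun ε : ℝ => ∫ s' in s - T.len α / 2..s + T.len α / 2,
      deriv (T.γ α) s' * (2 * Complex.I * ε * deriv (T.γ α) s /
        ((T.γ α s' - T.γ α s) ^ 2 + (ε * deriv (T.γ α) s) ^ 2))) (𝓝[>] 0) (𝓝 0) := by
    refine tendsto_const_nhds.congr' ?_
    filter_upwards [hright, T.positivelyOriented α s hd] with ε h1 h2
    have h3 := T.windingIntegral_eq α (s - T.len α / 2) h2 h1
    rw [windingIntegral, windingIntegral, ← sub_eq_zero] at h3
    have hc := T.continuous_γ α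
    have hne : ∀ z ∈ T.Ω, ∀ s, T.γ α s - z ≠ 0 := fun z hz s h => by
      rw [sub_eq_zero] at h
      exact T.γ_notMem_Ω α s (h ▸ hz)
    have hi : ∀ z ∈ T.Ω, IntervalIntegrable (fun s' => deriv (T.γ α) s' / (T.γ α s' - z)) volume
        (s - T.len α / 2) (s - T.len α / 2 + T.len α) := fun z hz =>
      T.intervalIntegrable_deriv_div α _ _ (hc.sub continuous_const) (hne z hz)
    rw [← intervalIntegral.integral_sub (hi _ h2) (hi _ h1)] at h3
    rw [← h3, show s - T.len α / 2 + T.len α = s + T.len α / 2 by ring]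
    refine intervalIntegral.integral_congr fun s' _ => ?_
    have h4 := hne _ h1 s'
    have h5 := hne _ h2 s'
    have h6 : (T.γ α s' - T.γ α s) ^ 2 + (ε * deriv (T.γ α) s) ^ 2 =
        (T.γ α s' - (T.γ α s - ε * (Complex.I * deriv (T.γ α) s))) *
        (T.γ α s' - (T.γ α s + ε * (Complex.I * deriv (T.γ α) s))) := by
      linear_combination (ε * deriv (T.γ α) s) ^ 2 * Complex.I_sq
    rw [h6, div_sub_div _ _ h5 h4, mul_div_assoc', mul_comm (T.γ α s' - _) (T.γ α s' - (_ + _))]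
    congr 1
    ring
  have := tendsto_nhds_unique hlim hzero
  simp [Real.pi_ne_zero] at this

end BilliardTable

/-! ### The billiard step: existence, time reversal and uniqueness. -/

namespace BilliardTable

variable {q : ℕ} (T : BilliardTable q)

/-- The outer cone at a smooth boundary point does not meet the domain near this point. -/
theorem exists_cone_disjoint_Ω {α : Fin q} {s : ℝ} (hd : ContDiffAt ℝ 1 (T.γ α) s)
    {c : ℝ} (hc : 0 < c) (hc1 : c < 1) :
    ∃ δ > 0, ∀ z : ℂ, ‖z‖ < δ → c * ‖z‖ < -z.im → T.γ α s + deriv (T.γ α) s * z ∉ T.Ω := by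
  obtain ⟨δ, hδ, hfr⟩ := T.exists_cone_disjoint_frontier (hd.differentiableAt one_ne_zero) hc
  refine ⟨δ, hδ, fun z hz1 hz2 hzΩ => ?_⟩
  set C := {z : ℂ | ‖z‖ < δ ∧ c * ‖z‖ < z.im} with hC
  have hpre : IsPreconnected ((fun z => T.γ α s - deriv (T.γ α) s * z) '' C) :=
    (convex_normal_cone c δ hc.le).isPreconnected.image _ (by fun_prop)
  -- If the outer cone met Ω it would be contained in Ω, together with its normal axis.
  have hsub := hpre.subset_of_closure_inter_subset T.isOpen
    ⟨_, ⟨-z, ⟨by simpa using hz1, by simpa using hz2⟩, rfl⟩, by simpa using hzΩ⟩ (by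
      rintro _ ⟨hx, y, hy, rfl⟩
      by_contra hn
      refine hfr (-y) (by simpa using hy.1)
        (by rw [norm_neg, Complex.neg_im, abs_neg]; exact hy.2.trans_le (le_abs_self _)) ?_
      rw [mul_neg, ← sub_eq_add_neg]
      exact ⟨hx, by rwa [T.isOpen.interior_eq]⟩)
  refine T.not_eventually_right_mem_Ω hd ?_
  filter_upwards [Ioo_mem_nhdsGT hδ] with ε hε
  refine hsub ⟨Complex.I * ε, ⟨?_, ?_⟩, ?_⟩
  · simpa [abs_of_pos hε.1] using hε.2
  · simp only [norm_mul, Complex.norm_I, Complex.norm_real, Real.norm_eq_abs, abs_of_pos hε.1,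
      one_mul, Complex.mul_im, Complex.I_re, Complex.I_im, Complex.ofReal_re, Complex.ofReal_im]
    nlinarith [hε.1]
  · ring

theorem deriv_γ_ne_zero {α : Fin q} {s : ℝ} (hd : ContDiffAt ℝ 1 (T.γ α) s) :
    deriv (T.γ α) s ≠ 0 := by
  rw [← norm_ne_zero_iff, T.norm_deriv_γ (hd.differentiableAt one_ne_zero)]
  exact one_ne_zero

/-- A transversal ray that points to the left of the boundary enters the domain. -/
theorem exists_ray_subset_Ω {α : Fin q} {s : ℝ} (hd : ContDiffAt ℝ 1 (T.γ α) s) {v : ℂ}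
    (hv : ‖v‖ = 1) (him : 0 < (v / deriv (T.γ α) s).im) :
    ∃ δ > 0, ∀ r : ℝ, 0 < r → r < δ → T.γ α s + r * v ∈ T.Ω := by
  have hτ1 := T.norm_deriv_γ (hd.differentiableAt one_ne_zero)
  have hτ0 := T.deriv_γ_ne_zero hd
  have hn : ‖v / deriv (T.γ α) s‖ = 1 := by rw [norm_div, hv, hτ1, div_one]
  have hle : (v / deriv (T.γ α) s).im ≤ 1 := hn ▸ Complex.im_le_norm _
  -- Half the sine of the angle between the ray and the tangent is an aperture for which the ray
  -- lies strictly inside the cone.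
  obtain ⟨δ, hδ, h⟩ := T.exists_cone_subset_Ω hd (half_pos him) (by linarith)
  refine ⟨δ, hδ, fun r hr hrδ => ?_⟩
  have := h (r * (v / deriv (T.γ α) s))
    (by rw [norm_mul, hn, Complex.norm_real, Real.norm_of_nonneg hr.le, mul_one]; exact hrδ)
    (by rw [norm_mul, hn, Complex.norm_real, Real.norm_of_nonneg hr.le,
          Complex.im_ofReal_mul]; nlinarith)
  convert this using 2
  field_simp

/-- A transversal ray that points to the right of the boundary leaves the domain. -/
theorem exists_ray_disjoint_Ω {α : Fin q} {s : ℝ} (hd : ContDiffAt ℝ 1 (T.γ α) s) {v : ℂ}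
    (hv : ‖v‖ = 1) (him : 0 < (v / deriv (T.γ α) s).im) :
    ∃ δ > 0, ∀ r : ℝ, 0 < r → r < δ → T.γ α s - r * v ∉ T.Ω := by
  have hτ1 := T.norm_deriv_γ (hd.differentiableAt one_ne_zero)
  have hτ0 := T.deriv_γ_ne_zero hd
  have hn : ‖v / deriv (T.γ α) s‖ = 1 := by rw [norm_div, hv, hτ1, div_one]
  have hle : (v / deriv (T.γ α) s).im ≤ 1 := hn ▸ Complex.im_le_norm _
  obtain ⟨δ, hδ, h⟩ := T.exists_cone_disjoint_Ω hd (half_pos him) (by linarith)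
  refine ⟨δ, hδ, fun r hr hrδ => ?_⟩
  have := h (-(r * (v / deriv (T.γ α) s)))
    (by rw [norm_neg, norm_mul, hn, Complex.norm_real, Real.norm_of_nonneg hr.le, mul_one]
        exact hrδ)
    (by rw [norm_neg, norm_mul, hn, Complex.norm_real, Real.norm_of_nonneg hr.le, Complex.neg_im,
          Complex.im_ofReal_mul]; nlinarith)
  convert this using 2
  field_simp
  ring

/-- A ray that enters the domain hits the boundary. -/
theorem exists_hit {x v : ℂ} (hv : ‖v‖ = 1)
    (hx : ∃ δ > 0, ∀ r : ℝ, 0 < r → r < δ → x + r * v ∈ T.Ω) :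
    ∃ t : ℝ, 0 < t ∧ (∀ r ∈ Ioo 0 t, x + r * v ∈ T.Ω) ∧ x + t * v ∈ frontier T.Ω := by
  obtain ⟨δ, hδ, hin⟩ := hx
  set S := {t : ℝ | 0 < t ∧ x + t * v ∉ T.Ω} with hS
  have hne : S.Nonempty := by
    obtain ⟨R, hR⟩ := T.isBounded.subset_ball x
    refine ⟨|R| + 1, by positivity, fun h => ?_⟩
    have := hR h
    rw [Metric.mem_ball, dist_eq_norm, add_sub_cancel_left, norm_mul, hv, mul_one,
      Complex.norm_real, Real.norm_of_nonneg (by positivity)] at this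
    linarith [le_abs_self R]
  have hbd : ∀ t ∈ S, δ ≤ t := fun t ht => not_lt.1 fun h => ht.2 (hin t ht.1 h)
  have hbb : BddBelow S := ⟨δ, hbd⟩
  have ht0 : 0 < sInf S := hδ.trans_le (le_csInf hne hbd)
  have hlt : ∀ r ∈ Ioo 0 (sInf S), x + r * v ∈ T.Ω := fun r hr => by
    by_contra h
    exact (notMem_of_lt_csInf hr.2 hbb) ⟨hr.1, h⟩
  have hcont : Continuous fun t : ℝ => x + t * v := by fun_prop
  have hnot : x + (sInf S : ℝ) * v ∉ T.Ω := by
    intro h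
    have hnh : (fun t : ℝ => x + t * v) ⁻¹' T.Ω ∈ 𝓝 (sInf S) :=
      (T.isOpen.preimage hcont).mem_nhds h
    obtain ⟨ε, hε, hball⟩ := Metric.mem_nhds_iff.1 hnh
    have : sInf S + ε ≤ sInf S := le_csInf hne fun t ht => by
      by_contra hc
      refine ht.2 (hball ?_)
      rw [Metric.mem_ball, Real.dist_eq, abs_lt]
      have := csInf_le hbb ht
      constructor <;> linarith
    linarith
  refine ⟨sInf S, ht0, hlt, ?_, by rwa [T.isOpen.interior_eq]⟩
  have hmem : sInf S ∈ closure (Ioo 0 (sInf S)) := by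
    rw [closure_Ioo ht0.ne]; exact ⟨ht0.le, le_rfl⟩
  exact closure_mono (by rintro _ ⟨r, hr, rfl⟩; exact hlt r hr)
    (image_closure_subset_closure_image hcont ⟨_, hmem, rfl⟩)

/-- The coordinate of a point transversal to the direction `v`. -/
def lineCoord (v x : ℂ) : ℝ := (v * (starRingEnd ℂ) x).im

theorem lineCoord_add_mul (v x : ℂ) (r : ℝ) : lineCoord v (x + r * v) = lineCoord v x := by
  simp only [lineCoord, map_add, map_mul, Complex.conj_ofReal, mul_add, Complex.add_im,
    Complex.mul_im, Complex.conj_re, Complex.conj_im, Complex.ofReal_re, Complex.ofReal_im,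
    Complex.mul_re]
  ring

theorem norm_tangent {z : PhasePoint q} (hz : z ∈ T.regular) : ‖T.tangent z‖ = 1 :=
  T.norm_deriv_γ (hz.2.1.differentiableAt one_ne_zero)

theorem tangent_ne_zero {z : PhasePoint q} (hz : z ∈ T.regular) : T.tangent z ≠ 0 :=
  T.deriv_γ_ne_zero hz.2.1

theorem norm_outgoing {z : PhasePoint q} (hz : z ∈ T.regular) : ‖T.outgoing z‖ = 1 := by
  rw [outgoing, norm_mul, T.norm_tangent hz, Complex.norm_exp_ofReal_mul_I, one_mul]

theorem outgoing_div_tangent_im {z : PhasePoint q} (hz : z ∈ T.regular) :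
    (T.outgoing z / T.tangent z).im = Real.sin z.angle := by
  rw [outgoing, mul_div_cancel_left₀ _ (T.tangent_ne_zero hz), Complex.exp_ofReal_mul_I_im]

theorem outgoing_div_tangent_im_pos {z : PhasePoint q} (hz : z ∈ T.regular) :
    0 < (T.outgoing z / T.tangent z).im := by
  rw [T.outgoing_div_tangent_im hz]
  exact Real.sin_pos_of_mem_Ioo hz.2.2

/-- The billiard map is defined at a phase point if the line of motion meets the boundary
transversally at smooth points. -/
theorem mem_mapDomain_of_forall_transversal {z : PhasePoint q} (hz : z ∈ T.regular)
    (h : ∀ β, ∀ s ∈ Ico 0 (T.len β),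
      lineCoord (T.outgoing z) (T.γ β s) = lineCoord (T.outgoing z) (T.footpoint z) →
      ContDiffAt ℝ 1 (T.γ β) s ∧ (T.outgoing z / deriv (T.γ β) s).im ≠ 0) :
    z ∈ T.mapDomain := by
  set v := T.outgoing z with hv
  have hv1 : ‖v‖ = 1 := T.norm_outgoing hz
  obtain ⟨t, ht0, hin, hfr⟩ := T.exists_hit hv1
    (T.exists_ray_subset_Ω hz.2.1 hv1 (T.outgoing_div_tangent_im_pos hz))
  obtain ⟨β, s, hs, he⟩ := T.exists_mem_Ico_of_mem_frontier hfr
  obtain ⟨hd, him⟩ := h β s hs (by rw [he, lineCoord_add_mul]; rfl)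
  -- At the hit the ball must move to the right of the tangent: otherwise the end of its flight
  -- would lie in the outer cone, which is outside Ω.
  have hneg : (v / deriv (T.γ β) s).im < 0 := by
    refine lt_of_le_of_ne (not_lt.1 fun hpos => ?_) him
    obtain ⟨δ, hδ, hout⟩ := T.exists_ray_disjoint_Ω hd hv1 hpos
    have hr0 : 0 < min (δ / 2) (t / 2) := by positivity
    refine hout (min (δ / 2) (t / 2)) hr0
      ((min_le_left _ _).trans_lt (half_lt_self hδ)) ?_
    rw [he]
    have := hin (t - min (δ / 2) (t / 2)) ⟨by linarith [min_le_right (δ / 2) (t / 2)], by linarith⟩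
    convert this using 1
    push_cast
    ring
  have hτ0 := T.deriv_γ_ne_zero hd
  -- The arriving direction has argument in (-π, 0) relative to the tangent; reflection changes its
  -- sign.
  refine ⟨(β, s, -(v / deriv (T.γ β) s).arg), hz, ⟨⟨hs, ?_⟩, hd, ?_⟩, t, ht0, hin, he, ?_⟩
  · have h1 := Complex.arg_neg_iff.2 hneg
    have h2 := Complex.neg_pi_lt_arg (v / deriv (T.γ β) s)
    exact ⟨by simp only [PhasePoint.angle]; linarith, by simp only [PhasePoint.angle]; linarith⟩
  · have h1 := Complex.arg_neg_iff.2 hneg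
    have h2 := Complex.neg_pi_lt_arg (v / deriv (T.γ β) s)
    exact ⟨by simp only [PhasePoint.angle]; linarith, by simp only [PhasePoint.angle]; linarith⟩
  · have h3 := Complex.norm_mul_exp_arg_mul_I (v / deriv (T.γ β) s)
    rw [norm_div, hv1, T.norm_deriv_γ (hd.differentiableAt one_ne_zero), div_one,
      Complex.ofReal_one, one_mul] at h3
    simp only [incoming, tangent, PhasePoint.angle]
    push_cast
    rw [neg_mul, neg_neg, h3, mul_div_cancel₀ _ hτ0]

/-- The time reversal of the phase space. -/
def reverse (z : PhasePoint q) : PhasePoint q := (z.1, z.2.1, Real.pi - z.2.2)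

@[simp] theorem reverse_reverse (z : PhasePoint q) : reverse (reverse z) = z := by
  simp [reverse]

theorem reverse_mem_phaseSpace {z : PhasePoint q} (h : z ∈ T.phaseSpace) :
    reverse z ∈ T.phaseSpace :=
  ⟨h.1, sub_nonneg.2 h.2.2, sub_le_self _ h.2.1⟩

theorem reverse_mem_regular {z : PhasePoint q} (h : z ∈ T.regular) : reverse z ∈ T.regular :=
  ⟨T.reverse_mem_phaseSpace h.1, h.2.1, sub_pos.2 h.2.2.2, sub_lt_self _ h.2.2.1⟩

theorem outgoing_reverse (z : PhasePoint q) : T.outgoing (reverse z) = -T.incoming z := by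
  simp only [outgoing, incoming, reverse, tangent, PhasePoint.angle, PhasePoint.comp,
    PhasePoint.arc]
  push_cast
  rw [sub_mul, Complex.exp_sub, Complex.exp_pi_mul_I, Complex.exp_neg]
  ring

theorem incoming_reverse (z : PhasePoint q) : T.incoming (reverse z) = -T.outgoing z := by
  have := T.outgoing_reverse (reverse z)
  rw [reverse_reverse] at this
  rw [this, neg_neg]

/-- The same segment is run through backwards, with r replaced by t - r; reversal exchanges the
incoming and outgoing directions up to sign. -/
theorem IsBilliardStep.reverse {z w : PhasePoint q} (h : T.IsBilliardStep z w) :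
    T.IsBilliardStep (reverse w) (reverse z) := by
  obtain ⟨hz, hw, t, ht, hin, hf, hi⟩ := h
  refine ⟨T.reverse_mem_regular hw, T.reverse_mem_regular hz, t, ht, fun r hr => ?_, ?_, ?_⟩
  · rw [T.outgoing_reverse, hi]
    change T.footpoint w + _ ∈ _
    rw [hf]
    have := hin (t - r) ⟨sub_pos.2 hr.2, sub_lt_self _ hr.1⟩
    convert this using 1
    push_cast
    ring
  · rw [T.outgoing_reverse, hi]
    change T.footpoint z = T.footpoint w + _
    rw [hf]
    ring
  · rw [T.incoming_reverse, T.outgoing_reverse, hi]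

theorem footpoint_inj {z w : PhasePoint q} (hz : z ∈ T.phaseSpace) (hw : w ∈ T.phaseSpace)
    (h : T.footpoint z = T.footpoint w) : z.1 = w.1 ∧ z.2.1 = w.2.1 := by
  obtain ⟨α, s, θ⟩ := z
  obtain ⟨β, s', θ'⟩ := w
  have hαβ : α = β := by
    by_contra hne
    exact Set.disjoint_left.1 (T.disjoint hne) ⟨s, rfl⟩ ⟨s', h.symm⟩
  subst hαβ
  exact ⟨rfl, T.injOn α hz.1 hw.1 h⟩

/-- Of two different hitting times the earlier would give a boundary point inside Ω. At the common
footpoint the incoming direction determines the angle, since angles in (0, π) can be read off from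
the argument. -/
theorem IsBilliardStep.unique {z w w' : PhasePoint q} (h : T.IsBilliardStep z w)
    (h' : T.IsBilliardStep z w') : w = w' := by
  obtain ⟨hz, hw, t, ht, hin, hf, hi⟩ := h
  obtain ⟨-, hw', t', ht', hin', hf', hi'⟩ := h'
  have htt : t = t' := by
    rcases lt_trichotomy t t' with hlt | heq | hlt
    · exact absurd (hf ▸ hin' t ⟨ht, hlt⟩) (T.γ_notMem_Ω _ _)
    · exact heq
    · exact absurd (hf' ▸ hin t' ⟨ht', hlt⟩) (T.γ_notMem_Ω _ _)
  subst htt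
  obtain ⟨h1, h2⟩ := T.footpoint_inj hw.1 hw'.1 (hf.trans hf'.symm)
  have hτ : T.tangent w = T.tangent w' := by
    simp only [tangent, PhasePoint.comp, PhasePoint.arc, h1, h2]
  have he := hi.trans hi'.symm
  rw [incoming, incoming, hτ] at he
  have he' := mul_left_cancel₀ (T.tangent_ne_zero hw') he
  have hang : w.2.2 = w'.2.2 := by
    have harg : ∀ u ∈ T.regular, (Complex.exp (-(PhasePoint.angle u * Complex.I))).arg = -u.2.2 := by
      intro u hu
      have hθ := hu.2.2
      rw [← neg_mul, ← Complex.ofReal_neg, Complex.arg_exp_mul_I, toIocMod_eq_self]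
      constructor
      · linarith [hθ.2]
      · linarith [hθ.1, Real.pi_pos]
    have := congrArg Complex.arg he'
    rw [harg w hw, harg w' hw'] at this
    linarith
  exact Prod.ext h1 (Prod.ext h2 hang)

theorem IsBilliardStep.unique_left {z z' w : PhasePoint q} (h : T.IsBilliardStep z w)
    (h' : T.IsBilliardStep z' w) : z = z' := by
  have := (h.reverse).unique T h'.reverse
  rw [← reverse_reverse z, this, reverse_reverse]

theorem IsBilliardStep.billiardMap_eq {z w : PhasePoint q} (h : T.IsBilliardStep z w) :
    T.billiardMap z = w := by
  have hex : ∃ w, T.IsBilliardStep z w := ⟨w, h⟩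
  rw [billiardMap, dif_pos hex]
  exact hex.choose_spec.unique T h

theorem isBilliardStep_billiardMap {z : PhasePoint q} (h : z ∈ T.mapDomain) :
    T.IsBilliardStep z (T.billiardMap z) := by
  obtain ⟨w, hw⟩ := h
  rwa [hw.billiardMap_eq T]

theorem billiardMap_of_notMem {z : PhasePoint q} (h : z ∉ T.mapDomain) :
    T.billiardMap z = z := dif_neg h

theorem mapDomain_subset_regular : T.mapDomain ⊆ T.regular := fun _ ⟨_, h⟩ => h.1

end BilliardTable

/-! ### Measurability of the billiard map. -/

/-- The rays that stay in an open set for a given time form a measurable set. -/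
theorem measurableSet_ray_subset {U : Set ℂ} (hU : IsOpen U) :
    MeasurableSet {p : ℂ × ℂ × ℝ | ∀ r ∈ Ioo 0 p.2.2, p.1 + r * p.2.1 ∈ U} := by
  -- In the rescaled time u = r/t the open interval is a countable union of fixed compact ones, and
  -- for each of them the condition is open by compactness.
  have key : {p : ℂ × ℂ × ℝ | ∀ r ∈ Ioo 0 p.2.2, p.1 + r * p.2.1 ∈ U} =
      {p | p.2.2 ≤ 0} ∪ ⋂ n : ℕ, {p | ∀ u ∈ Icc (1 / (n + 2) : ℝ) (1 - 1 / (n + 2)),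
        p.1 + ((u * p.2.2 : ℝ) : ℂ) * p.2.1 ∈ U} := by
    ext ⟨x, v, t⟩
    simp only [mem_ofPred_eq, mem_union, mem_iInter]
    constructor
    · intro h
      rcases le_or_gt t 0 with ht | ht
      · exact Or.inl ht
      · refine Or.inr fun n u hu => h _ ⟨?_, ?_⟩
        · have : (0 : ℝ) < 1 / (n + 2) := by positivity
          exact mul_pos (this.trans_le hu.1) ht
        · have : (0 : ℝ) < 1 / (n + 2) := by positivity
          nlinarith [hu.2]
    · rintro (ht | h) r hr
      · linarith [hr.1, hr.2]
      · have ht : 0 < t := hr.1.trans hr.2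
        have h1 : 0 < r / t := div_pos hr.1 ht
        have h2 : r / t < 1 := (div_lt_one ht).2 hr.2
        obtain ⟨n, hn⟩ := exists_nat_one_div_lt (lt_min h1 (sub_pos.2 h2))
        have hn' : (1 / (n + 2) : ℝ) ≤ 1 / (n + 1) := by
          apply one_div_le_one_div_of_le <;> linarith [(Nat.cast_nonneg n : (0 : ℝ) ≤ n)]
        have := h n (r / t) ⟨by linarith [min_le_left (r / t) (1 - r / t)],
          by linarith [min_le_right (r / t) (1 - r / t)]⟩
        rwa [div_mul_cancel₀ _ ht.ne'] at this
  rw [key]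
  refine (measurableSet_le (by fun_prop) (by fun_prop)).union (MeasurableSet.iInter fun n => ?_)
  apply IsOpen.measurableSet
  rw [isOpen_iff_eventually]
  intro p hp
  have hcont : Continuous fun y : (ℂ × ℂ × ℝ) × ℝ =>
      y.1.1 + ((y.2 * y.1.2.2 : ℝ) : ℂ) * y.1.2.1 := by fun_prop
  exact isCompact_Icc.eventually_forall_of_forall_eventually fun u hu =>
    hcont.continuousAt.eventually (hU.mem_nhds (hp u hu))

namespace BilliardTable

variable {q : ℕ} (T : BilliardTable q)

theorem measurable_footpoint : Measurable T.footpoint :=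
  measurable_from_prod_countable_right fun α => (T.continuous_γ α).measurable.comp measurable_fst

theorem measurable_tangent : Measurable T.tangent :=
  measurable_from_prod_countable_right fun α => (measurable_deriv (T.γ α)).comp measurable_fst

theorem measurable_outgoing : Measurable T.outgoing := by
  refine T.measurable_tangent.mul ?_
  have : Measurable fun z : PhasePoint q => z.2.2 := by fun_prop
  exact Complex.measurable_exp.comp ((Complex.measurable_ofReal.comp this).mul_const _)

theorem measurable_incoming : Measurable T.incoming := by
  refine T.measurable_tangent.mul ?_
  have : Measurable fun z : PhasePoint q => z.2.2 := by fun_prop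
  exact Complex.measurable_exp.comp ((Complex.measurable_ofReal.comp this).mul_const _).neg

theorem measurable_len_fst : Measurable fun z : PhasePoint q => T.len z.1 :=
  (measurable_of_finite T.len).comp measurable_fst

theorem measurableSet_phaseSpace : MeasurableSet T.phaseSpace := by
  have h1 : Measurable fun z : PhasePoint q => z.2.1 := by fun_prop
  have h2 : Measurable fun z : PhasePoint q => z.2.2 := by fun_prop
  exact ((measurableSet_le measurable_const h1).inter
    (measurableSet_lt h1 T.measurable_len_fst)).inter (h2 measurableSet_Icc)

theorem isOpen_contDiffAt (α : Fin q) : IsOpen {s | ContDiffAt ℝ 1 (T.γ α) s} := by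
  rw [isOpen_iff_eventually]
  intro s hs
  have hs' : ContDiffAt ℝ 1 (T.γ α) s := hs
  exact hs'.eventually (by simp)

theorem measurableSet_contDiffAt :
    MeasurableSet {z : PhasePoint q | ContDiffAt ℝ 1 (T.γ z.1) z.2.1} := by
  have : Measurable fun z : PhasePoint q => ContDiffAt ℝ 1 (T.γ z.1) z.2.1 :=
    measurable_from_prod_countable_right fun α =>
      measurableSet_setOfPred.1 (measurable_fst (T.isOpen_contDiffAt α).measurableSet)
  exact measurableSet_setOfPred.2 this

theorem measurableSet_regular : MeasurableSet T.regular := by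
  have h2 : Measurable fun z : PhasePoint q => z.2.2 := by fun_prop
  exact T.measurableSet_phaseSpace.inter (T.measurableSet_contDiffAt.inter (h2 measurableSet_Ioo))

/-- The flight time equals the distance between the footpoints, because the direction is a unit
vector; this removes the existential quantifier over times and leaves measurable conditions. -/
theorem measurableSet_isBilliardStep :
    MeasurableSet {p : PhasePoint q × PhasePoint q | T.IsBilliardStep p.1 p.2} := by
  have hf1 : Measurable fun p : PhasePoint q × PhasePoint q => T.footpoint p.1 :=
    T.measurable_footpoint.comp measurable_fst
  have hf2 : Measurable fun p : PhasePoint q × PhasePoint q => T.footpoint p.2 :=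
    T.measurable_footpoint.comp measurable_snd
  have ho : Measurable fun p : PhasePoint q × PhasePoint q => T.outgoing p.1 :=
    T.measurable_outgoing.comp measurable_fst
  have hi : Measurable fun p : PhasePoint q × PhasePoint q => T.incoming p.2 :=
    T.measurable_incoming.comp measurable_snd
  have ht : Measurable fun p : PhasePoint q × PhasePoint q =>
    ‖T.footpoint p.2 - T.footpoint p.1‖ := (hf2.sub hf1).norm
  have key : {p : PhasePoint q × PhasePoint q | T.IsBilliardStep p.1 p.2} =
      {p | p.1 ∈ T.regular} ∩ ({p | p.2 ∈ T.regular} ∩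
      ({p | 0 < ‖T.footpoint p.2 - T.footpoint p.1‖} ∩
      ((fun p : PhasePoint q × PhasePoint q => (T.footpoint p.1, T.outgoing p.1,
        ‖T.footpoint p.2 - T.footpoint p.1‖)) ⁻¹'
          {p : ℂ × ℂ × ℝ | ∀ r ∈ Ioo 0 p.2.2, p.1 + r * p.2.1 ∈ T.Ω} ∩
      ({p | T.footpoint p.2 = T.footpoint p.1 +
        ((‖T.footpoint p.2 - T.footpoint p.1‖ : ℝ) : ℂ) * T.outgoing p.1} ∩
      {p | T.incoming p.2 = T.outgoing p.1})))) := by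
    ext ⟨z, w⟩
    constructor
    · rintro ⟨hz, hw, t, ht, hin, hf, hi⟩
      have e : ‖T.footpoint w - T.footpoint z‖ = t := by
        rw [hf, add_sub_cancel_left, norm_mul, T.norm_outgoing hz, mul_one, Complex.norm_real,
          Real.norm_of_nonneg ht.le]
      refine ⟨hz, hw, ?_, ?_, ?_, hi⟩
      · change 0 < ‖T.footpoint w - T.footpoint z‖
        rwa [e]
      · change ∀ r ∈ Ioo 0 ‖T.footpoint w - T.footpoint z‖, _
        rwa [e]
      · change T.footpoint w = T.footpoint z +
          ((‖T.footpoint w - T.footpoint z‖ : ℝ) : ℂ) * T.outgoing z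
        rwa [e]
    · rintro ⟨hz, hw, ht, hin, hf, hi⟩
      exact ⟨hz, hw, _, ht, hin, hf, hi⟩
  rw [key]
  refine (measurable_fst T.measurableSet_regular).inter
    ((measurable_snd T.measurableSet_regular).inter
    ((measurableSet_lt measurable_const ht).inter
    (((hf1.prodMk (ho.prodMk ht)) (measurableSet_ray_subset T.isOpen)).inter
    ((measurableSet_eq_fun hf2 (hf1.add ((Complex.measurable_ofReal.comp ht).mul ho))).inter
    (measurableSet_eq_fun hi ho)))))

/-- By uniqueness of the next phase point the graph projects injectively, and an injective
measurable image of a Borel set is Borel (Lusin–Souslin). -/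
theorem measurableSet_mapDomain_inter {B : Set (PhasePoint q)} (hB : MeasurableSet B) :
    MeasurableSet {z | ∃ w ∈ B, T.IsBilliardStep z w} := by
  have hG := T.measurableSet_isBilliardStep.inter (measurable_snd hB)
  have := hG.image_of_measurable_injOn measurable_fst (by
    rintro ⟨z, w⟩ h ⟨z', w'⟩ h' (rfl : z = z')
    exact Prod.ext rfl (IsBilliardStep.unique T h.1 h'.1))
  convert this using 1
  ext z
  constructor
  · rintro ⟨w, hw, h⟩
    exact ⟨(z, w), ⟨h, hw⟩, rfl⟩
  · rintro ⟨⟨z, w⟩, ⟨h, hw⟩, rfl⟩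
    exact ⟨w, hw, h⟩

theorem measurableSet_mapDomain : MeasurableSet T.mapDomain := by
  have := T.measurableSet_mapDomain_inter MeasurableSet.univ
  simpa [mapDomain] using this

theorem measurable_billiardMap : Measurable T.billiardMap := by
  intro B hB
  have : T.billiardMap ⁻¹' B = {z | ∃ w ∈ B, T.IsBilliardStep z w} ∪ (T.mapDomainᶜ ∩ B) := by
    ext z
    by_cases hz : z ∈ T.mapDomain
    · have hs := T.isBilliardStep_billiardMap hz
      constructor
      · intro h
        exact Or.inl ⟨_, h, hs⟩
      · rintro (⟨w, hw, h⟩ | h)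
        · rw [mem_preimage, h.billiardMap_eq T]; exact hw
        · exact absurd hz h.1
    · rw [mem_preimage, T.billiardMap_of_notMem hz]
      constructor
      · intro h
        exact Or.inr ⟨hz, h⟩
      · rintro (⟨w, hw, h⟩ | h)
        · exact absurd ⟨w, h⟩ hz
        · exact h.2
  rw [this]
  exact (T.measurableSet_mapDomain_inter hB).union (T.measurableSet_mapDomain.compl.inter hB)

theorem measurable_reverse : Measurable (reverse : PhasePoint q → PhasePoint q) := by
  unfold reverse
  fun_prop

end BilliardTable

/-! ### The Liouville measure as an integral over directions of measures on lines. -/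

/-- Two sets related by a bijection that preserves a real coordinate `p` have the same measure, if
they are covered by countably many sets on which the measure is the Lebesgue measure of the image
under `p`. -/
theorem measure_eq_of_bijOn_of_coordinate {X : Type*} [MeasurableSpace X] [StandardBorelSpace X]
    {μ : Measure X} {p : X → ℝ} {C : ℕ → Set X} (hC : ∀ n, MeasurableSet (C n))
    (hCμ : ∀ n A, MeasurableSet A → A ⊆ C n → μ A = volume (p '' A)) {A B : Set X}
    (hA : MeasurableSet A) (hAC : A ⊆ ⋃ n, C n) (hBC : B ⊆ ⋃ n, C n) {H : X → X}
    (hH : Measurable H) (hbij : BijOn H A B) (hp : ∀ x ∈ A, p (H x) = p x) : μ A = μ B := by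
  set D := disjointed C with hD
  have hDm : ∀ n, MeasurableSet (D n) := fun n => MeasurableSet.disjointed hC n
  have hDU : ⋃ n, D n = ⋃ n, C n := iUnion_disjointed
  have hDd : Pairwise (Function.onFun Disjoint D) := disjoint_disjointed C
  -- Cut A according to the pieces that contain x and H x. On each part both measures are the
  -- Lebesgue measure of the same image under `p`.
  set S : ℕ × ℕ → Set X := fun i => A ∩ D i.1 ∩ H ⁻¹' D i.2 with hS
  have hSm : ∀ i, MeasurableSet (S i) := fun i => (hA.inter (hDm _)).inter (hH (hDm _))
  have hSA : ∀ i, S i ⊆ A := fun i x hx => hx.1.1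
  have hSd : Pairwise (Function.onFun Disjoint S) := by
    intro i j hij
    refine Set.disjoint_left.2 fun x hi hj => hij ?_
    have h1 : i.1 = j.1 := by
      by_contra h
      exact Set.disjoint_left.1 (hDd h) hi.1.2 hj.1.2
    have h2 : i.2 = j.2 := by
      by_contra h
      exact Set.disjoint_left.1 (hDd h) hi.2 hj.2
    exact Prod.ext h1 h2
  have hHSm : ∀ i, MeasurableSet (H '' S i) := fun i =>
    (hSm i).image_of_measurable_injOn hH (hbij.injOn.mono (hSA i))
  have hHSd : Pairwise (Function.onFun Disjoint fun i => H '' S i) := by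
    intro i j hij
    refine Set.disjoint_left.2 ?_
    rintro _ ⟨x, hx, rfl⟩ ⟨y, hy, hxy⟩
    have := hbij.injOn (hSA _ hy) (hSA _ hx) hxy
    subst this
    exact Set.disjoint_left.1 (hSd hij) hx hy
  have hAU : A = ⋃ i, S i := by
    refine subset_antisymm (fun x hx => ?_) (iUnion_subset hSA)
    have h1 := hAC hx
    have h2 := hBC (hbij.mapsTo hx)
    rw [← hDU] at h1 h2
    obtain ⟨i, hi⟩ := mem_iUnion.1 h1
    obtain ⟨j, hj⟩ := mem_iUnion.1 h2
    exact mem_iUnion.2 ⟨(i, j), ⟨hx, hi⟩, hj⟩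
  have hBU : B = ⋃ i, H '' S i := by
    rw [← image_iUnion, ← hAU, hbij.image_eq]
  have hpc : ∀ i, p '' (H '' S i) = p '' S i := fun i => by
    rw [image_image]
    exact image_congr fun x hx => hp x (hSA i hx)
  rw [hBU, measure_iUnion hHSd hHSm]
  nth_rewrite 1 [hAU]
  rw [measure_iUnion hSd hSm]
  congr 1
  funext i
  rw [hCμ i.1 (S i) (hSm i) fun x hx => disjointed_subset C _ hx.1.2,
    hCμ i.2 (H '' S i) (hHSm i) ?_, hpc]
  rintro _ ⟨x, hx, rfl⟩
  exact disjointed_subset C _ hx.2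

theorem measure_eq_zero_of_coordinate {X : Type*} [MeasurableSpace X]
    {μ : Measure X} {p : X → ℝ} {C : ℕ → Set X} (hC : ∀ n, MeasurableSet (C n))
    (hCμ : ∀ n A, MeasurableSet A → A ⊆ C n → μ A = volume (p '' A)) {A : Set X}
    (hA : MeasurableSet A) (hAC : A ⊆ ⋃ n, C n) (h0 : volume (p '' A) = 0) : μ A = 0 := by
  have : A = ⋃ n, A ∩ C n := by rw [← inter_iUnion, inter_eq_left.2 hAC]
  rw [this]
  refine measure_iUnion_null fun n => ?_
  rw [hCμ n _ (hA.inter (hC n)) inter_subset_right]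
  exact measure_mono_null (image_mono inter_subset_left) h0

theorem ContDiffAt.continuousAt_deriv_one {f : ℝ → ℂ} {s : ℝ} (hd : ContDiffAt ℝ 1 f s) :
    ContinuousAt (deriv f) s := by
  obtain ⟨u, hu, hcu⟩ := hd.contDiffOn le_rfl (by simp)
  obtain ⟨v, hvu, hvo, hv⟩ := mem_nhds_iff.1 (by simpa using hu)
  exact ((hcu.mono hvu).continuousOn_deriv_of_isOpen hvo le_rfl).continuousAt (hvo.mem_nhds hv)

/-- Rotation invariance of the integral over the unit circle. -/
theorem setLIntegral_exp_div (F : ℂ → ENNReal) {τ : ℂ} (hτ : ‖τ‖ = 1) :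
    ∫⁻ θ in Ioc (-Real.pi) Real.pi, F (Complex.exp (θ * Complex.I) / τ) =
      ∫⁻ θ in Ioc (-Real.pi) Real.pi, F (Complex.exp (θ * Complex.I)) := by
  set f : ℝ → ENNReal := fun θ => F (Complex.exp (θ * Complex.I)) with hf
  set a := τ.arg with ha
  have hτe : τ = Complex.exp (a * Complex.I) := by
    have := Complex.norm_mul_exp_arg_mul_I τ
    rw [hτ, Complex.ofReal_one, one_mul] at this
    exact this.symm
  have h1 : ∀ θ : ℝ, F (Complex.exp (θ * Complex.I) / τ) = f (θ - a) := fun θ => by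
    rw [hτe, ← Complex.exp_sub]
    simp only [hf]
    push_cast
    rw [sub_mul]
  simp only [h1]
  have h2 : ∫⁻ θ in Ioc (-Real.pi) Real.pi, f (θ - a) =
      ∫⁻ θ in Ioc (-Real.pi - a) (Real.pi - a), f θ := by
    have := (measurePreserving_sub_right (volume : Measure ℝ) a).setLIntegral_comp_preimage_emb
      (MeasurableEquiv.subRight a).measurableEmbedding f (Ioc (-Real.pi - a) (Real.pi - a))
    rw [← this]
    simp
  have h3 := isAddFundamentalDomain_Ioc Real.two_pi_pos (-Real.pi - a) volume
  have h4 := isAddFundamentalDomain_Ioc Real.two_pi_pos (-Real.pi) volume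
  rw [h2]
  have h5 := h3.setLIntegral_eq h4 f (by
    rintro ⟨g, hg⟩ x
    obtain ⟨n, rfl⟩ := AddSubgroup.mem_zmultiples_iff.1 hg
    change F (Complex.exp (((n • (2 * Real.pi) + x : ℝ) : ℂ) * Complex.I)) =
      F (Complex.exp (x * Complex.I))
    rw [Complex.ofReal_add, add_mul, Complex.exp_add]
    have : Complex.exp (((n • (2 * Real.pi) : ℝ) : ℂ) * Complex.I) = 1 := by
      rw [Complex.exp_eq_one_iff]
      exact ⟨n, by push_cast [zsmul_eq_mul]; ring⟩
    rw [this, one_mul])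
  rw [show -Real.pi - a + 2 * Real.pi = Real.pi - a by ring,
    show -Real.pi + 2 * Real.pi = Real.pi by ring] at h5
  exact h5

namespace BilliardTable

variable {q : ℕ} (T : BilliardTable q)

/-- The coordinate, transversal to the direction `v`, of a boundary point. -/
def boundaryCoord (v : ℂ) (x : Fin q × ℝ) : ℝ := lineCoord v (T.γ x.1 x.2)

/-- The boundary points at which the boundary is smooth and transversal to the direction `v`. -/
def transversal (v : ℂ) : Set (Fin q × ℝ) :=
  {x | x.2 ∈ Ico 0 (T.len x.1) ∧ ContDiffAt ℝ 1 (T.γ x.1) x.2 ∧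
    (v / deriv (T.γ x.1) x.2).im ≠ 0}

/-- The measure on the boundary that counts lines of direction `v`. -/
def lineMeasure (v : ℂ) : Measure (Fin q × ℝ) :=
  Measure.sum fun α => ((volume.restrict (Ico 0 (T.len α))).withDensity fun s =>
    ENNReal.ofReal |(v / deriv (T.γ α) s).im|).map (Prod.mk α)

theorem lineMeasure_apply (v : ℂ) {A : Set (Fin q × ℝ)} (hA : MeasurableSet A) :
    T.lineMeasure v A = ∑ α, ∫⁻ s in {s | (α, s) ∈ A} ∩ Ico 0 (T.len α),
      ENNReal.ofReal |(v / deriv (T.γ α) s).im| := by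
  rw [lineMeasure, Measure.sum_apply _ hA, tsum_fintype]
  refine Finset.sum_congr rfl fun α _ => ?_
  have hm : MeasurableSet (Prod.mk α ⁻¹' A) := measurable_prodMk_left hA
  rw [Measure.map_apply measurable_prodMk_left hA, withDensity_apply _ hm,
    Measure.restrict_restrict hm]
  rfl

/-- Unit speed makes the conjugate of the tangent its inverse. Hence the density of `lineMeasure` is
the absolute derivative of the transversal coordinate. -/
theorem hasDerivAt_boundaryCoord (v : ℂ) {α : Fin q} {s : ℝ} (hd : ContDiffAt ℝ 1 (T.γ α) s) :
    HasDerivAt (fun s => T.boundaryCoord v (α, s)) (v / deriv (T.γ α) s).im s := by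
  have hdiff := hd.differentiableAt one_ne_zero
  have h1 : v / deriv (T.γ α) s = v * (starRingEnd ℂ) (deriv (T.γ α) s) := by
    rw [div_eq_mul_inv, Complex.inv_def, Complex.normSq_eq_norm_sq, T.norm_deriv_γ hdiff]
    simp
  rw [h1]
  have h2 : HasDerivAt (fun s => (starRingEnd ℂ) (T.γ α s)) ((starRingEnd ℂ) (deriv (T.γ α) s)) s :=
    (Complex.conjCLE.toContinuousLinearMap.hasFDerivAt.comp_hasDerivAt s hdiff.hasDerivAt)
  exact (Complex.imCLM.hasFDerivAt.comp_hasDerivAt s (h2.const_mul v))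

theorem injOn_boundaryCoord {v : ℂ} {α : Fin q} {a b : ℝ}
    (h : (∀ s ∈ Ioo a b, ContDiffAt ℝ 1 (T.γ α) s ∧ 0 < (v / deriv (T.γ α) s).im) ∨
      (∀ s ∈ Ioo a b, ContDiffAt ℝ 1 (T.γ α) s ∧ (v / deriv (T.γ α) s).im < 0)) :
    InjOn (fun s => T.boundaryCoord v (α, s)) (Ioo a b) := by
  have hc : (∀ s ∈ Ioo a b, ContDiffAt ℝ 1 (T.γ α) s) →
      ContinuousOn (fun s => T.boundaryCoord v (α, s)) (Ioo a b) := fun h s hs =>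
    (T.hasDerivAt_boundaryCoord v (h s hs)).continuousAt.continuousWithinAt
  rcases h with h | h
  · refine (strictMonoOn_of_deriv_pos (convex_Ioo a b) (hc fun s hs => (h s hs).1)
      fun s hs => ?_).injOn
    rw [interior_Ioo] at hs
    rw [(T.hasDerivAt_boundaryCoord v (h s hs).1).deriv]
    exact (h s hs).2
  · refine (strictAntiOn_of_deriv_neg (convex_Ioo a b) (hc fun s hs => (h s hs).1)
      fun s hs => ?_).injOn
    rw [interior_Ioo] at hs
    rw [(T.hasDerivAt_boundaryCoord v (h s hs).1).deriv]
    exact (h s hs).2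

/-- Change of variables on an arc along which the transversal coordinate is strictly monotone. -/
theorem lineMeasure_eq_volume_image {v : ℂ} {α : Fin q} {a b : ℝ}
    (h : (∀ s ∈ Ioo a b, ContDiffAt ℝ 1 (T.γ α) s ∧ 0 < (v / deriv (T.γ α) s).im) ∨
      (∀ s ∈ Ioo a b, ContDiffAt ℝ 1 (T.γ α) s ∧ (v / deriv (T.γ α) s).im < 0))
    {A : Set (Fin q × ℝ)} (hA : MeasurableSet A)
    (hAC : A ⊆ {α} ×ˢ (Ioo a b ∩ Ico 0 (T.len α))) :
    T.lineMeasure v A = volume (T.boundaryCoord v '' A) := by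
  set S := {s | (α, s) ∈ A} with hS
  have hSm : MeasurableSet S := measurable_prodMk_left hA
  have hAS : A = Prod.mk α '' S := by
    ext ⟨β, s⟩
    constructor
    · intro hx
      obtain rfl : β = α := (hAC hx).1
      exact ⟨s, hx, rfl⟩
    · rintro ⟨s', hs', he⟩
      rw [← he]; exact hs'
  have hSI : ∀ s ∈ S, s ∈ Ioo a b ∩ Ico 0 (T.len α) := fun s hs => (hAC hs).2
  have hcd : ∀ s ∈ S, ContDiffAt ℝ 1 (T.γ α) s := fun s hs =>
    h.elim (fun h => (h s (hSI s hs).1).1) fun h => (h s (hSI s hs).1).1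
  rw [T.lineMeasure_apply v hA, Finset.sum_eq_single α]
  · rw [inter_eq_left.2 fun s hs => (hSI s hs).2, hAS, image_image]
    have := lintegral_image_eq_lintegral_abs_deriv_mul hSm
      (fun s hs => (T.hasDerivAt_boundaryCoord v (hcd s hs)).hasDerivWithinAt)
      ((T.injOn_boundaryCoord h).mono fun s hs => (hSI s hs).1) (fun _ => 1)
    simp only [mul_one, lintegral_one, Measure.restrict_apply_univ] at this
    exact this.symm
  · intro β _ hβ
    have : {s | (β, s) ∈ A} = ∅ := by
      refine eq_empty_of_forall_notMem fun s hs => hβ ?_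
      exact (hAC hs).1
    rw [this, empty_inter, Measure.restrict_empty, lintegral_zero_measure]
  · intro h; exact absurd (Finset.mem_univ _) h

/-- Near a transversal point the coordinate has a derivative of constant sign, and intervals with
rational endpoints are enough to catch all such points. -/
theorem exists_cover_transversal (v : ℂ) : ∃ C : ℕ → Set (Fin q × ℝ),
    (∀ n, MeasurableSet (C n)) ∧ T.transversal v ⊆ ⋃ n, C n ∧
    ∀ n A, MeasurableSet A → A ⊆ C n → T.lineMeasure v A = volume (T.boundaryCoord v '' A) := by
  classical
  set P : Fin q → ℝ → ℝ → Prop := fun α a b =>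
    (∀ s ∈ Ioo a b, ContDiffAt ℝ 1 (T.γ α) s ∧ 0 < (v / deriv (T.γ α) s).im) ∨
      (∀ s ∈ Ioo a b, ContDiffAt ℝ 1 (T.γ α) s ∧ (v / deriv (T.γ α) s).im < 0) with hP
  -- The extra index `none` makes the index type nonempty without appeal to q > 0, so that it can be
  -- enumerated by ℕ.
  set C : Option (Fin q × ℚ × ℚ) → Set (Fin q × ℝ) := fun i =>
    match i with
    | none => ∅
    | some (α, a, b) =>
      if P α a b then {α} ×ˢ (Ioo (a : ℝ) b ∩ Ico 0 (T.len α)) else ∅ with hC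
  obtain ⟨e, he⟩ := exists_surjective_nat (Option (Fin q × ℚ × ℚ))
  have hCm : ∀ i, MeasurableSet (C i) := by
    rintro (_ | ⟨α, a, b⟩)
    · exact MeasurableSet.empty
    · simp only [hC]
      split_ifs
      · exact (measurableSet_singleton α).prod (measurableSet_Ioo.inter measurableSet_Ico)
      · exact MeasurableSet.empty
  refine ⟨fun n => C (e n), fun n => hCm _, ?_, ?_⟩
  · rintro ⟨α, s⟩ ⟨hs, hd, him⟩
    simp only at hs hd him
    have hcont : ContinuousAt (fun s => (v / deriv (T.γ α) s).im) s :=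
      Complex.continuous_im.continuousAt.comp
        (continuousAt_const.div hd.continuousAt_deriv_one (T.deriv_γ_ne_zero hd))
    have hev : ∃ δ > 0, P α (s - δ) (s + δ) := by
      have h1 := hd.eventually (by simp)
      rcases him.lt_or_gt with hneg | hpos
      · obtain ⟨δ, hδ, hb⟩ := Metric.eventually_nhds_iff.1
          (h1.and (hcont.eventually_lt continuousAt_const hneg))
        refine ⟨δ, hδ, Or.inr fun s' hs' => hb ?_⟩
        rw [Real.dist_eq, abs_lt]; constructor <;> linarith [hs'.1, hs'.2]
      · obtain ⟨δ, hδ, hb⟩ := Metric.eventually_nhds_iff.1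
          (h1.and (continuousAt_const.eventually_lt hcont hpos))
        refine ⟨δ, hδ, Or.inl fun s' hs' => hb ?_⟩
        rw [Real.dist_eq, abs_lt]; constructor <;> linarith [hs'.1, hs'.2]
    obtain ⟨δ, hδ, hPδ⟩ := hev
    obtain ⟨a, ha1, ha2⟩ := exists_rat_btwn (sub_lt_self s hδ)
    obtain ⟨b, hb1, hb2⟩ := exists_rat_btwn (lt_add_of_pos_right s hδ)
    have hPab : P α a b := by
      have hsub : Ioo (a : ℝ) b ⊆ Ioo (s - δ) (s + δ) := Ioo_subset_Ioo ha1.le hb2.le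
      exact hPδ.imp (fun h x hx => h x (hsub hx)) fun h x hx => h x (hsub hx)
    obtain ⟨n, hn⟩ := he (some (α, a, b))
    refine mem_iUnion.2 ⟨n, ?_⟩
    simp only [hn, hC, if_pos hPab]
    exact ⟨rfl, ⟨ha2, hb1⟩, hs⟩
  · intro n A hA hAC
    rcases hn : e n with _ | ⟨α, a, b⟩
    · simp only [hn, hC] at hAC
      rw [subset_empty_iff.1 hAC]; simp
    · simp only [hn, hC] at hAC
      split_ifs at hAC with hPab
      · exact T.lineMeasure_eq_volume_image hPab hA hAC
      · rw [subset_empty_iff.1 hAC]; simp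

/-- Almost no line of a given direction meets the boundary at a corner or tangentially. -/
theorem volume_image_not_transversal (v : ℂ) :
    volume (T.boundaryCoord v '' {x | x.2 ∈ Ico 0 (T.len x.1) ∧ x ∉ T.transversal v}) = 0 := by
  have hsub : T.boundaryCoord v '' {x | x.2 ∈ Ico 0 (T.len x.1) ∧ x ∉ T.transversal v} ⊆
      ⋃ α, ((fun s => T.boundaryCoord v (α, s)) '' {s | ¬ ContDiffAt ℝ 1 (T.γ α) s} ∪
        (fun s => T.boundaryCoord v (α, s)) ''
          {s | ContDiffAt ℝ 1 (T.γ α) s ∧ (v / deriv (T.γ α) s).im = 0}) := by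
    rintro _ ⟨⟨α, s⟩, ⟨hs, hn⟩, rfl⟩
    refine mem_iUnion.2 ⟨α, ?_⟩
    by_cases hd : ContDiffAt ℝ 1 (T.γ α) s
    · refine Or.inr ⟨s, ⟨hd, ?_⟩, rfl⟩
      by_contra him
      exact hn ⟨hs, hd, him⟩
    · exact Or.inl ⟨s, hd, rfl⟩
  refine measure_mono_null hsub (measure_iUnion_null fun α => measure_union_null ?_ ?_)
  · exact ((T.countable_not_contDiffAt α).image _).measure_zero _
  -- Sard's lemma in dimension one: the tangency points are the critical points of the coordinate.
  · refine addHaar_image_eq_zero_of_det_fderivWithin_eq_zero volume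
      (fun s hs => (T.hasDerivAt_boundaryCoord v hs.1).hasFDerivAt.hasFDerivWithinAt) ?_
    intro s hs
    rw [hs.2]
    simp

theorem liouville_apply {D : Set (PhasePoint q)} (hD : MeasurableSet D) :
    T.liouville D = ∑ α, ∫⁻ s in Ico 0 (T.len α), ∫⁻ θ in Icc 0 Real.pi,
      D.indicator (fun z => ENNReal.ofReal (Real.sin z.2.2)) (α, s, θ) := by
  have hsin : Measurable fun z : PhasePoint q => ENNReal.ofReal (Real.sin z.2.2) := by fun_prop
  have hind := hsin.indicator hD
  rw [liouville, withDensity_apply _ hD, ← lintegral_indicator hD,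
    ← lintegral_indicator T.measurableSet_phaseSpace,
    lintegral_prod _ (hind.indicator T.measurableSet_phaseSpace).aemeasurable, lintegral_count,
    tsum_fintype]
  refine Finset.sum_congr rfl fun α _ => ?_
  have h1 : ∀ p : ℝ × ℝ, T.phaseSpace.indicator
      (D.indicator fun z : PhasePoint q => ENNReal.ofReal (Real.sin z.2.2)) (α, p) =
      (Ico 0 (T.len α) ×ˢ Icc 0 Real.pi).indicator (fun p => D.indicator
        (fun z : PhasePoint q => ENNReal.ofReal (Real.sin z.2.2)) (α, p)) p := fun p => rfl
  simp only [h1]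
  rw [lintegral_indicator (measurableSet_Ico.prod measurableSet_Icc), Measure.volume_eq_prod,
    ← Measure.prod_restrict]
  exact lintegral_prod _ (hind.comp measurable_prodMk_left).aemeasurable

/-- The direction of `v` with respect to the boundary. -/
def phaseOfDirection (v : ℂ) (x : Fin q × ℝ) : PhasePoint q :=
  (x.1, x.2, (v / deriv (T.γ x.1) x.2).arg)

theorem measurable_phaseOfDirection_prod :
    Measurable fun p : ℂ × (Fin q × ℝ) => T.phaseOfDirection p.1 p.2 := by
  have h1 : Measurable fun x : Fin q × ℝ => deriv (T.γ x.1) x.2 :=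
    measurable_from_prod_countable_right fun α => measurable_deriv (T.γ α)
  have h2 : Measurable fun p : ℂ × (Fin q × ℝ) => (p.1 / deriv (T.γ p.2.1) p.2.2).arg :=
    Complex.measurable_arg.comp (measurable_fst.div (h1.comp measurable_snd))
  exact (measurable_fst.comp measurable_snd).prodMk
    ((measurable_snd.comp measurable_snd).prodMk h2)

theorem measurable_phaseOfDirection (v : ℂ) : Measurable (T.phaseOfDirection v) :=
  T.measurable_phaseOfDirection_prod.comp measurable_prodMk_left

/-- The passage from the angle θ with the tangent to the absolute direction ω is a rotation of the
circle, under which sin θ becomes Im(e^{iω}/γ'). Directions that point out of the domain do not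
contribute, since regular angles lie in (0, π). -/
theorem setLIntegral_angle_eq {D : Set (PhasePoint q)} (hDr : D ⊆ T.regular) (α : Fin q) (s : ℝ) :
    ∫⁻ θ in Icc 0 Real.pi, D.indicator (fun z => ENNReal.ofReal (Real.sin z.2.2)) (α, s, θ) =
      ∫⁻ ω in Ioc (-Real.pi) Real.pi,
        {ω : ℝ | T.phaseOfDirection (Complex.exp (ω * Complex.I)) (α, s) ∈ D}.indicator
          (fun ω : ℝ => ENNReal.ofReal |(Complex.exp (ω * Complex.I) / deriv (T.γ α) s).im|) ω := by
  by_cases hd : ContDiffAt ℝ 1 (T.γ α) s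
  · set F : ℂ → ENNReal := {u : ℂ | (α, s, u.arg) ∈ D}.indicator
      (fun u => ENNReal.ofReal |u.im|) with hF
    have h1 := setLIntegral_exp_div F (T.norm_deriv_γ (hd.differentiableAt one_ne_zero))
    have h2 : ∀ ω : ℝ, {ω : ℝ | T.phaseOfDirection (Complex.exp (ω * Complex.I)) (α, s) ∈ D}.indicator
          (fun ω : ℝ => ENNReal.ofReal |(Complex.exp (ω * Complex.I) / deriv (T.γ α) s).im|) ω =
        F (Complex.exp (ω * Complex.I) / deriv (T.γ α) s) := fun ω => rfl
    simp only [h2]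
    rw [h1, ← lintegral_indicator measurableSet_Icc, ← lintegral_indicator measurableSet_Ioc]
    refine lintegral_congr fun θ => ?_
    by_cases hθ : (α, s, θ) ∈ D
    · have hr : θ ∈ Ioo 0 Real.pi := (hDr hθ).2.2
      have hI : θ ∈ Ioc (-Real.pi) Real.pi := ⟨by linarith [hr.1, Real.pi_pos], hr.2.le⟩
      have harg : (Complex.exp (θ * Complex.I)).arg = θ := by
        rw [Complex.arg_exp_mul_I, toIocMod_eq_self]
        exact ⟨hI.1, by linarith [hI.2]⟩
      have hmem : Complex.exp (θ * Complex.I) ∈ {u : ℂ | (α, s, u.arg) ∈ D} := by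
        change (α, s, (Complex.exp (θ * Complex.I)).arg) ∈ D
        rwa [harg]
      rw [indicator_of_mem (Ioo_subset_Icc_self hr), indicator_of_mem hI, indicator_of_mem hθ, hF,
        indicator_of_mem hmem, Complex.exp_ofReal_mul_I_im,
        abs_of_pos (Real.sin_pos_of_mem_Ioo hr)]
    · have h3 : (Icc 0 Real.pi).indicator (fun θ => D.indicator
          (fun z => ENNReal.ofReal (Real.sin z.2.2)) (α, s, θ)) θ = 0 := by
        by_cases hm : θ ∈ Icc 0 Real.pi
        · rw [indicator_of_mem hm, indicator_of_notMem hθ]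
        · rw [indicator_of_notMem hm]
      rw [h3]
      by_cases hm : θ ∈ Ioc (-Real.pi) Real.pi
      · have harg : (Complex.exp (θ * Complex.I)).arg = θ := by
          rw [Complex.arg_exp_mul_I, toIocMod_eq_self]
          exact ⟨hm.1, by linarith [hm.2]⟩
        rw [indicator_of_mem hm, hF, indicator_of_notMem]
        change (α, s, (Complex.exp (θ * Complex.I)).arg) ∉ D
        rwa [harg]
      · rw [indicator_of_notMem hm]
  · have h1 : ∀ θ : ℝ, (α, s, θ) ∉ D := fun θ h => hd (hDr h).2.1
    have h2 : ∀ ω : ℝ, T.phaseOfDirection (Complex.exp (ω * Complex.I)) (α, s) ∉ D :=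
      fun ω => h1 _
    rw [lintegral_congr fun θ => indicator_of_notMem (h1 θ) _,
      lintegral_congr fun ω => indicator_of_notMem (s := {ω : ℝ | T.phaseOfDirection
        (Complex.exp (ω * Complex.I)) (α, s) ∈ D}) (h2 ω) _]
    simp

/-- The Liouville measure in terms of lines: integrate over the direction of motion. -/
theorem liouville_eq_lintegral_lineMeasure {D : Set (PhasePoint q)} (hD : MeasurableSet D)
    (hDr : D ⊆ T.regular) :
    T.liouville D = ∫⁻ ω in Ioc (-Real.pi) Real.pi,
      T.lineMeasure (Complex.exp (ω * Complex.I))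
        (T.phaseOfDirection (Complex.exp (ω * Complex.I)) ⁻¹' D) := by
  have hexp : Measurable fun ω : ℝ => Complex.exp (ω * Complex.I) :=
    Complex.measurable_exp.comp (Complex.measurable_ofReal.mul_const _)
  rw [T.liouville_apply hD]
  set K : Fin q → ℝ → ℝ → ENNReal := fun α s ω =>
    {ω : ℝ | T.phaseOfDirection (Complex.exp (ω * Complex.I)) (α, s) ∈ D}.indicator
      (fun ω : ℝ => ENNReal.ofReal |(Complex.exp (ω * Complex.I) / deriv (T.γ α) s).im|) ω with hK
  have hKm : ∀ α, Measurable (Function.uncurry (K α)) := by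
    intro α
    have h1 : Measurable fun p : ℝ × ℝ => T.phaseOfDirection (Complex.exp (p.2 * Complex.I)) (α, p.1) :=
      T.measurable_phaseOfDirection_prod.comp
        ((hexp.comp measurable_snd).prodMk (measurable_const.prodMk measurable_fst))
    have h2 : Measurable fun p : ℝ × ℝ =>
        ENNReal.ofReal |(Complex.exp (p.2 * Complex.I) / deriv (T.γ α) p.1).im| :=
      (Complex.measurable_im.comp ((hexp.comp measurable_snd).div
        ((measurable_deriv _).comp measurable_fst))).norm.ennreal_ofReal
    exact h2.indicator (h1 hD)
  have hKm' : ∀ α, Measurable fun ω => ∫⁻ s in Ico 0 (T.len α), K α s ω := fun α =>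
    ((hKm α).comp measurable_swap).lintegral_prod_right'
  calc _ = ∑ α, ∫⁻ s in Ico 0 (T.len α), ∫⁻ ω in Ioc (-Real.pi) Real.pi, K α s ω :=
        Finset.sum_congr rfl fun α _ => lintegral_congr fun s => T.setLIntegral_angle_eq hDr α s
    _ = ∑ α, ∫⁻ ω in Ioc (-Real.pi) Real.pi, ∫⁻ s in Ico 0 (T.len α), K α s ω :=
        Finset.sum_congr rfl fun α _ => lintegral_lintegral_swap (hKm α).aemeasurable
    _ = ∫⁻ ω in Ioc (-Real.pi) Real.pi, ∑ α, ∫⁻ s in Ico 0 (T.len α), K α s ω :=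
        (lintegral_finsetSum _ fun α _ => hKm' α).symm
    _ = _ := by
      refine lintegral_congr fun ω => ?_
      have hm := T.measurable_phaseOfDirection (Complex.exp (ω * Complex.I)) hD
      rw [T.lineMeasure_apply _ hm]
      refine Finset.sum_congr rfl fun α _ => ?_
      have hm' : MeasurableSet {s | (α, s) ∈ T.phaseOfDirection (Complex.exp (ω * Complex.I)) ⁻¹' D} :=
        measurable_prodMk_left hm
      rw [← Measure.restrict_restrict hm', ← lintegral_indicator hm']
      rfl

end BilliardTable

/-! ### Invariance of the Liouville measure under the billiard map. -/

namespace BilliardTable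

variable {q : ℕ} (T : BilliardTable q)

theorem phaseOfDirection_outgoing {z : PhasePoint q} (hz : z ∈ T.regular) :
    T.phaseOfDirection (T.outgoing z) (z.1, z.2.1) = z := by
  have hθ := hz.2.2
  have h : (T.outgoing z / deriv (T.γ z.1) z.2.1).arg = z.2.2 := by
    change (T.outgoing z / T.tangent z).arg = z.2.2
    rw [outgoing, mul_div_cancel_left₀ _ (T.tangent_ne_zero hz), Complex.arg_exp_mul_I,
      toIocMod_eq_self]
    exact ⟨by linarith [hθ.1, Real.pi_pos], by linarith [hθ.2]⟩
  exact Prod.ext rfl (Prod.ext rfl h)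

theorem outgoing_phaseOfDirection {v : ℂ} (hv : ‖v‖ = 1) {x : Fin q × ℝ}
    (hx : T.phaseOfDirection v x ∈ T.regular) : T.outgoing (T.phaseOfDirection v x) = v := by
  have hd : ContDiffAt ℝ 1 (T.γ x.1) x.2 := hx.2.1
  have h3 := Complex.norm_mul_exp_arg_mul_I (v / deriv (T.γ x.1) x.2)
  rw [norm_div, hv, T.norm_deriv_γ (hd.differentiableAt one_ne_zero), div_one,
    Complex.ofReal_one, one_mul] at h3
  change deriv (T.γ x.1) x.2 * Complex.exp ((v / deriv (T.γ x.1) x.2).arg * Complex.I) = v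
  rw [h3, mul_div_cancel₀ _ (T.deriv_γ_ne_zero hd)]

theorem mem_transversal_of_phaseOfDirection {v : ℂ} (hv : ‖v‖ = 1) {x : Fin q × ℝ}
    (hx : T.phaseOfDirection v x ∈ T.regular) : x ∈ T.transversal v := by
  refine ⟨hx.1.1, hx.2.1, ?_⟩
  have := T.outgoing_div_tangent_im_pos hx
  rw [T.outgoing_phaseOfDirection hv hx] at this
  exact this.ne'

theorem transversal_neg (v : ℂ) : T.transversal (-v) = T.transversal v := by
  ext x
  simp [transversal, neg_div]

theorem lineMeasure_neg (v : ℂ) : T.lineMeasure (-v) = T.lineMeasure v := by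
  simp [lineMeasure, neg_div]

theorem IsBilliardStep.lineCoord_eq {z w : PhasePoint q} (h : T.IsBilliardStep z w) :
    lineCoord (T.outgoing z) (T.footpoint w) = lineCoord (T.outgoing z) (T.footpoint z) := by
  obtain ⟨-, -, t, -, -, hf, -⟩ := h
  rw [hf, lineCoord_add_mul]

theorem norm_exp_mul_I (ω : ℝ) : ‖Complex.exp (ω * Complex.I)‖ = 1 :=
  Complex.norm_exp_ofReal_mul_I ω

/-- For a fixed direction, the footpoints without a next hit lie on lines that meet the boundary at
a corner or tangentially; these lines form a null set, and so do the footpoints by the coordinate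
description of `lineMeasure`. -/
theorem liouville_regular_diff_mapDomain : T.liouville (T.regular \ T.mapDomain) = 0 := by
  have hm := T.measurableSet_regular.diff T.measurableSet_mapDomain
  rw [T.liouville_eq_lintegral_lineMeasure hm sdiff_subset]
  refine lintegral_eq_zero_of_ae_eq_zero (ae_of_all _ fun ω => ?_)
  set v := Complex.exp (ω * Complex.I) with hv
  have hv1 : ‖v‖ = 1 := norm_exp_mul_I ω
  obtain ⟨C, hC, hcov, hCμ⟩ := T.exists_cover_transversal v
  refine measure_eq_zero_of_coordinate hC hCμ (T.measurable_phaseOfDirection v hm)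
    (fun x hx => hcov (T.mem_transversal_of_phaseOfDirection hv1 hx.1)) ?_
  refine measure_mono_null ?_ (T.volume_image_not_transversal v)
  rintro _ ⟨x, ⟨hx1, hx2⟩, rfl⟩
  by_contra hcon
  refine hx2 (T.mem_mapDomain_of_forall_transversal hx1 fun β s hs he => ?_)
  rw [T.outgoing_phaseOfDirection hv1 hx1] at he ⊢
  by_contra hn
  exact hcon ⟨(β, s), ⟨hs, fun ht => hn ht.2⟩, he⟩

/-- The billiard map followed by the time reversal preserves the Liouville measure, locally on its
domain. -/
theorem liouville_reverse_image {D : Set (PhasePoint q)} (hD : MeasurableSet D)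
    (hDd : D ⊆ T.mapDomain) :
    T.liouville {u | ∃ z ∈ D, T.IsBilliardStep z (reverse u)} = T.liouville D := by
  set E := {u | ∃ z ∈ D, T.IsBilliardStep z (reverse u)} with hE
  have hEm : MeasurableSet E := by
    have := T.measurableSet_mapDomain_inter (measurable_reverse hD)
    convert this using 1
    ext u
    constructor
    · rintro ⟨z, hz, h⟩
      refine ⟨reverse z, by simpa using hz, ?_⟩
      simpa using IsBilliardStep.reverse T h
    · rintro ⟨z, hz, h⟩
      exact ⟨reverse z, hz, IsBilliardStep.reverse T h⟩
  have hEr : E ⊆ T.regular := by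
    rintro u ⟨z, -, h⟩
    simpa using T.reverse_mem_regular h.2.1
  have hDr : D ⊆ T.regular := hDd.trans T.mapDomain_subset_regular
  -- After reversal the ball leaves its hit in direction -v, so the integral for E is rotated by a
  -- half turn, which leaves `lineMeasure` unchanged.
  have hneg : T.liouville E = ∫⁻ ω in Ioc (-Real.pi) Real.pi,
      T.lineMeasure (Complex.exp (ω * Complex.I))
        (T.phaseOfDirection (-Complex.exp (ω * Complex.I)) ⁻¹' E) := by
    rw [T.liouville_eq_lintegral_lineMeasure hEm hEr,
      ← setLIntegral_exp_div (fun u => T.lineMeasure u (T.phaseOfDirection u ⁻¹' E))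
        (τ := -1) (by simp)]
    simp only [div_neg, div_one, T.lineMeasure_neg]
  rw [hneg, T.liouville_eq_lintegral_lineMeasure hD hDr]
  refine lintegral_congr fun ω => ?_
  set v := Complex.exp (ω * Complex.I) with hv
  have hv1 : ‖v‖ = 1 := norm_exp_mul_I ω
  have hv1' : ‖-v‖ = 1 := by rw [norm_neg, hv1]
  obtain ⟨C, hC, hcov, hCμ⟩ := T.exists_cover_transversal v
  have hcovD : T.phaseOfDirection v ⁻¹' D ⊆ ⋃ n, C n := fun x hx =>
    hcov (T.mem_transversal_of_phaseOfDirection hv1 (hDr hx))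
  have hcovE : T.phaseOfDirection (-v) ⁻¹' E ⊆ ⋃ n, C n := fun x hx => by
    have := T.mem_transversal_of_phaseOfDirection hv1' (hEr hx)
    rw [T.transversal_neg] at this
    exact hcov this
  -- For fixed v this sends a footpoint to the next one along the line of direction v. It is
  -- injective by time reversal and keeps the coordinate transversal to v.
  set H : Fin q × ℝ → Fin q × ℝ := fun x =>
    ((T.billiardMap (T.phaseOfDirection v x)).1, (T.billiardMap (T.phaseOfDirection v x)).2.1)
    with hH
  have hHm : Measurable H := by
    have h1 := T.measurable_billiardMap.comp (T.measurable_phaseOfDirection v)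
    exact (measurable_fst.comp h1).prodMk ((measurable_fst.comp measurable_snd).comp h1)
  have hstep : ∀ x ∈ T.phaseOfDirection v ⁻¹' D, T.IsBilliardStep (T.phaseOfDirection v x)
      (T.billiardMap (T.phaseOfDirection v x)) := fun x hx =>
    T.isBilliardStep_billiardMap (hDd hx)
  have hout : ∀ x ∈ T.phaseOfDirection v ⁻¹' D, T.outgoing (T.phaseOfDirection v x) = v :=
    fun x hx => T.outgoing_phaseOfDirection hv1 (hDr hx)
  have hrev : ∀ x ∈ T.phaseOfDirection v ⁻¹' D, T.phaseOfDirection (-v) (H x) =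
      reverse (T.billiardMap (T.phaseOfDirection v x)) := fun x hx => by
    have h1 := hstep x hx
    have h2 := T.phaseOfDirection_outgoing (T.reverse_mem_regular h1.2.1)
    have h3 : T.outgoing (reverse (T.billiardMap (T.phaseOfDirection v x))) = -v := by
      rw [T.outgoing_reverse, h1.2.2.choose_spec.2.2.2, hout x hx]
    rw [h3] at h2
    exact h2
  refine (measure_eq_of_bijOn_of_coordinate hC hCμ (T.measurable_phaseOfDirection v hD) hcovD
    hcovE hHm ⟨?_, ?_, ?_⟩ ?_).symm
  · intro x hx
    change T.phaseOfDirection (-v) (H x) ∈ E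
    rw [hrev x hx]
    exact ⟨_, hx, by rw [reverse_reverse]; exact hstep x hx⟩
  · intro x hx y hy hxy
    have h1 := hrev x hx
    rw [hxy, hrev y hy] at h1
    have h2 : T.billiardMap (T.phaseOfDirection v y) = T.billiardMap (T.phaseOfDirection v x) := by
      rw [← reverse_reverse (T.billiardMap (T.phaseOfDirection v y)), h1, reverse_reverse]
    have h3 := hstep y hy
    rw [h2] at h3
    have h4 := IsBilliardStep.unique_left T (hstep x hx) h3
    exact Prod.ext (congrArg (fun z : PhasePoint q => z.1) h4)
      (congrArg (fun z : PhasePoint q => z.2.1) h4)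
  · intro y hy
    have hyr := hEr hy
    obtain ⟨z, hz, h⟩ : T.phaseOfDirection (-v) y ∈ E := hy
    have h1 : T.outgoing z = v := by
      obtain ⟨-, -, t, -, -, -, hi⟩ := h
      rw [← hi, T.incoming_reverse, T.outgoing_phaseOfDirection hv1' hyr, neg_neg]
    have h2 := T.phaseOfDirection_outgoing (hDr hz)
    rw [h1] at h2
    refine ⟨(z.1, z.2.1), by rw [mem_preimage, h2]; exact hz, ?_⟩
    simp only [hH, h2, h.billiardMap_eq T]
    rfl
  · intro x hx
    have := IsBilliardStep.lineCoord_eq T (hstep x hx)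
    rw [hout x hx] at this
    exact this

theorem measurePreserving_reverse_base : MeasurePreserving (reverse : PhasePoint q → PhasePoint q)
    (Measure.count.prod volume) (Measure.count.prod volume) := by
  have h1 : MeasurePreserving (fun θ : ℝ => Real.pi - θ) volume volume :=
    Measure.measurePreserving_sub_left volume Real.pi
  exact (MeasurePreserving.id _).prod ((MeasurePreserving.id volume).prod h1)

theorem measurePreserving_reverse :
    MeasurePreserving (reverse : PhasePoint q → PhasePoint q) T.liouville T.liouville := by
  refine ⟨measurable_reverse, Measure.ext fun S hS => ?_⟩
  have hsin : Measurable fun z : PhasePoint q => ENNReal.ofReal (Real.sin z.2.2) := by fun_prop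
  have hpre : reverse ⁻¹' T.phaseSpace = T.phaseSpace := by
    ext z
    refine ⟨fun h => ?_, fun h => T.reverse_mem_phaseSpace h⟩
    simpa using T.reverse_mem_phaseSpace h
  have hb := (measurePreserving_reverse_base (q := q)).restrict_preimage T.measurableSet_phaseSpace
  rw [hpre] at hb
  rw [Measure.map_apply measurable_reverse hS, liouville,
    withDensity_apply _ (measurable_reverse hS), withDensity_apply _ hS,
    ← hb.setLIntegral_comp_preimage hS hsin]
  refine lintegral_congr fun z => ?_
  simp [reverse, Real.sin_pi_sub]

theorem liouville_compl_phaseSpace : T.liouville T.phaseSpaceᶜ = 0 := by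
  refine withDensity_absolutelyContinuous _ _ ?_
  rw [Measure.restrict_apply T.measurableSet_phaseSpace.compl, compl_inter_self, measure_empty]

/-- Corners are countable, and at the tangential angles 0 and π the density sin θ vanishes. -/
theorem liouville_phaseSpace_diff_regular : T.liouville (T.phaseSpace \ T.regular) = 0 := by
  rw [T.liouville_apply (T.measurableSet_phaseSpace.diff T.measurableSet_regular)]
  refine Finset.sum_eq_zero fun α _ => ?_
  have h0 : ∀ᵐ s ∂volume.restrict (Ico 0 (T.len α)), ContDiffAt ℝ 1 (T.γ α) s := by
    refine ae_restrict_of_ae ?_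
    have := (T.countable_not_contDiffAt α).measure_zero volume
    rwa [ae_iff]
  refine lintegral_eq_zero_of_ae_eq_zero ?_
  filter_upwards [h0, ae_restrict_mem measurableSet_Ico] with s hs hsI
  refine lintegral_eq_zero_of_ae_eq_zero ?_
  filter_upwards [ae_restrict_mem measurableSet_Icc] with θ hθ
  by_cases hm : (α, s, θ) ∈ T.phaseSpace \ T.regular
  · rw [indicator_of_mem hm]
    have : θ = 0 ∨ θ = Real.pi := by
      by_contra hc
      push Not at hc
      exact hm.2 ⟨hm.1, hs, lt_of_le_of_ne hθ.1 hc.1.symm, lt_of_le_of_ne hθ.2 hc.2⟩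
    rcases this with rfl | rfl <;> simp
  · rw [indicator_of_notMem hm]; rfl

theorem liouville_compl_mapDomain : T.liouville T.mapDomainᶜ = 0 := by
  refine measure_mono_null (t := T.phaseSpaceᶜ ∪ ((T.phaseSpace \ T.regular) ∪
    (T.regular \ T.mapDomain))) (fun z hz => ?_) (measure_union_null T.liouville_compl_phaseSpace
    (measure_union_null T.liouville_phaseSpace_diff_regular T.liouville_regular_diff_mapDomain))
  by_cases h1 : z ∈ T.phaseSpace
  · by_cases h2 : z ∈ T.regular
    · exact Or.inr (Or.inr ⟨h2, hz⟩)
    · exact Or.inr (Or.inl ⟨h1, h2⟩)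
  · exact Or.inl h1

theorem ae_mem_mapDomain : ∀ᵐ z ∂T.liouville, z ∈ T.mapDomain := by
  have := T.liouville_compl_mapDomain
  rwa [← mem_ae_iff] at this

/-- The billiard map preserves the Liouville measure. -/
theorem measurePreserving_billiardMap :
    MeasurePreserving T.billiardMap T.liouville T.liouville := by
  refine ⟨T.measurable_billiardMap, Measure.ext fun B hB => ?_⟩
  rw [Measure.map_apply T.measurable_billiardMap hB]
  set D := T.billiardMap ⁻¹' B ∩ T.mapDomain with hDdef
  have hD : MeasurableSet D := (T.measurable_billiardMap hB).inter T.measurableSet_mapDomain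
  have h1 : T.liouville (T.billiardMap ⁻¹' B) = T.liouville D :=
    (measure_inter_conull (by exact T.liouville_compl_mapDomain)).symm
  -- By reversibility, u has a next step exactly when its reversal is the image of some phase point.
  -- Thus φ⁻¹(B), its reversed image, `reverse ⁻¹' B` and B all have the same measure.
  have h2 : {u | ∃ z ∈ D, T.IsBilliardStep z (reverse u)} = reverse ⁻¹' B ∩ T.mapDomain := by
    ext u
    constructor
    · rintro ⟨z, hz, h⟩
      refine ⟨?_, reverse z, by simpa using IsBilliardStep.reverse T h⟩
      have := hz.1
      rwa [mem_preimage, h.billiardMap_eq T] at this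
    · rintro ⟨hu, w, hw⟩
      have h := IsBilliardStep.reverse T hw
      refine ⟨reverse w, ⟨?_, ⟨_, h⟩⟩, h⟩
      rw [mem_preimage, h.billiardMap_eq T]
      exact hu
  rw [h1, ← T.liouville_reverse_image hD inter_subset_right, h2,
    measure_inter_conull (by exact T.liouville_compl_mapDomain),
    T.measurePreserving_reverse.measure_preimage hB.nullMeasurableSet]

theorem isFiniteMeasure_liouville : IsFiniteMeasure T.liouville := by
  refine ⟨?_⟩
  rw [T.liouville_apply MeasurableSet.univ]
  refine ENNReal.sum_lt_top.2 fun α _ => ?_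
  calc _ ≤ ∫⁻ _ in Ico 0 (T.len α), ∫⁻ _ in Icc 0 Real.pi, 1 := by
        refine lintegral_mono fun s => lintegral_mono fun θ => ?_
        rw [indicator_of_mem (mem_univ _)]
        exact ENNReal.ofReal_le_one.2 (Real.sin_le_one _)
    _ < ⊤ := by
        simp only [lintegral_one, Measure.restrict_apply_univ, lintegral_const, Real.volume_Icc,
          Real.volume_Ico]
        exact ENNReal.mul_lt_top ENNReal.ofReal_lt_top ENNReal.ofReal_lt_top

/-- With an empty frontier Ω would be empty or the whole plane. Needed for ν(Φ) > 0. -/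
theorem exists_component (T : BilliardTable q) : Nonempty (Fin q) := by
  by_contra h
  have h1 : frontier T.Ω = ∅ := by
    rw [T.frontier_eq]
    exact eq_empty_of_forall_notMem fun x hx => h ⟨(mem_iUnion.1 hx).choose⟩
  rcases frontier_eq_empty_iff.1 h1 with h2 | h2
  · exact T.isConnected.nonempty.ne_empty h2
  · have := T.isBounded
    rw [h2] at this
    exact NormedSpace.unbounded_univ ℝ ℂ this

theorem liouville_phaseSpace_pos : 0 < T.liouville T.phaseSpace := by
  obtain ⟨α⟩ := T.exists_component
  rw [T.liouville_apply T.measurableSet_phaseSpace]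
  refine lt_of_lt_of_le ?_ (Finset.single_le_sum (fun _ _ => zero_le) (Finset.mem_univ α))
  have h1 : ∀ s ∈ Ico 0 (T.len α), (∫⁻ θ in Icc 0 Real.pi, T.phaseSpace.indicator
      (fun z : PhasePoint q => ENNReal.ofReal (Real.sin z.2.2)) (α, s, θ)) =
      ∫⁻ θ in Icc 0 Real.pi, ENNReal.ofReal (Real.sin θ) := fun s hs =>
    setLIntegral_congr_fun measurableSet_Icc fun θ hθ => by
      have : (α, s, θ) ∈ T.phaseSpace := ⟨hs, hθ⟩
      simp only [indicator_of_mem this]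
  rw [setLIntegral_congr_fun measurableSet_Ico h1, setLIntegral_const]
  refine ENNReal.mul_pos ?_ (by simp [T.len_pos α])
  refine ((setLIntegral_pos_iff (by fun_prop)).2 ?_).ne'
  refine lt_of_lt_of_le ?_ (measure_mono (s := Ioo 0 Real.pi) ?_)
  · simp [Real.pi_pos]
  · intro θ hθ
    refine ⟨?_, Ioo_subset_Icc_self hθ⟩
    simp [Real.sin_pos_of_mem_Ioo hθ]

end BilliardTable

/-! ### Sums over consecutive visit times. -/

/-- The times `j < k` are consecutive times at which `p` holds. -/
def IsConsecutive (p : ℕ → Prop) (j k : ℕ) : Prop :=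
  j < k ∧ p j ∧ p k ∧ ∀ i, j < i → i < k → ¬ p i

theorem exists_count_eq_of_lt_count (p : ℕ → Prop) [DecidablePred p] {i M : ℕ}
    (h : i < Nat.count p M) : ∃ m < M, p m ∧ Nat.count p m = i := by
  induction M with
  | zero => simp at h
  | succ M ih =>
    rw [Nat.count_succ] at h
    by_cases hlt : i < Nat.count p M
    · obtain ⟨m, hm, h1⟩ := ih hlt
      exact ⟨m, hm.trans (Nat.lt_succ_self M), h1⟩
    · split_ifs at h with hp
      · exact ⟨M, Nat.lt_succ_self M, hp, by omega⟩
      · omega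

namespace IsConsecutive

variable {p : ℕ → Prop} {j k k' : ℕ}

theorem unique (h : IsConsecutive p j k) (h' : IsConsecutive p j k') : k = k' := by
  rcases lt_trichotomy k k' with hlt | heq | hlt
  · exact absurd h.2.2.1 (h'.2.2.2 k h.1 hlt)
  · exact heq
  · exact absurd h'.2.2.1 (h.2.2.2 k' h'.1 hlt)

theorem count_eq [DecidablePred p] (h : IsConsecutive p j k) :
    Nat.count p k = Nat.count p j + 1 := by
  have h1 : Nat.count p (j + 1) = Nat.count p j + 1 := by rw [Nat.count_succ, if_pos h.2.1]
  have h2 : Nat.count p (j + 1) ≤ Nat.count p k := Nat.count_monotone p h.1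
  rcases h2.eq_or_lt with h3 | h3
  · omega
  · obtain ⟨m, hm, hpm, hc⟩ := exists_count_eq_of_lt_count p h3
    refine absurd hpm (h.2.2.2 m ?_ hm)
    by_contra hle
    have := Nat.count_monotone p (not_lt.1 hle)
    omega

theorem shift_iff (j k : ℕ) :
    IsConsecutive (fun i => p (i + j)) 0 k ↔ IsConsecutive p j (k + j) := by
  unfold IsConsecutive
  constructor
  · rintro ⟨h1, h2, h3, h4⟩
    refine ⟨by omega, by simpa using h2, h3, fun i hi hik => ?_⟩
    have : ¬ p (i - j + j) := h4 (i - j) (by omega) (by omega)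
    rwa [Nat.sub_add_cancel hi.le] at this
  · rintro ⟨h1, h2, h3, h4⟩
    exact ⟨by omega, by simpa using h2, h3, fun i hi hik => h4 (i + j) (by omega) (by omega)⟩

theorem reflect_of_le {p' : ℕ → Prop} {N : ℕ} (hp : ∀ i ≤ N, p' i ↔ p (N - i)) (hk : k ≤ N)
    (h : IsConsecutive p' j k) : IsConsecutive p (N - k) (N - j) := by
  obtain ⟨h1, h2, h3, h4⟩ := h
  refine ⟨by omega, (hp k hk).1 h3, (hp j (by omega)).1 h2, fun i hi hij hpi => ?_⟩
  refine h4 (N - i) (by omega) (by omega) ((hp _ (by omega)).2 ?_)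
  rwa [show N - (N - i) = i by omega]

theorem reflect_iff {p' : ℕ → Prop} {N : ℕ} (hp : ∀ i ≤ N, p' i ↔ p (N - i)) (hj : j ≤ N)
    (hk : k ≤ N) : IsConsecutive p' j k ↔ IsConsecutive p (N - k) (N - j) := by
  refine ⟨reflect_of_le hp hk, fun h => ?_⟩
  have := reflect_of_le (p' := p) (p := p') (N := N)
    (fun i hi => by rw [hp (N - i) (by omega), show N - (N - i) = i by omega]) (by omega) h
  rwa [show N - (N - j) = j by omega, show N - (N - k) = k by omega] at this

end IsConsecutive

open Classical in
/-- The sum of `F` over the pairs of consecutive times before `M` at which `p` holds. -/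
def consecutiveSum (p : ℕ → Prop) (F : ℕ → ℕ → ℝ) (M : ℕ) : ℝ :=
  ∑ j ∈ Finset.range M, ∑ k ∈ Finset.range M, if IsConsecutive p j k then F j k else 0

/-- The index of a pair is the number of visits before its first time. Unlike the numbering by
`Nat.nth`, the sum over pairs is visibly symmetric under reversal of time. -/
theorem sum_nth_eq_consecutiveSum (p : ℕ → Prop) [DecidablePred p] (F : ℕ → ℕ → ℝ) (M : ℕ) :
    ∑ i ∈ Finset.range (Nat.count p M - 1), F (Nat.nth p i) (Nat.nth p (i + 1)) =
      consecutiveSum p F M := by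
  classical
  rw [consecutiveSum, ← Finset.sum_product', ← Finset.sum_filter]
  -- Below the count, `Nat.nth` is a genuine visit even if there are only finitely many, so its
  -- default value plays no role.
  have hnth : ∀ i < Nat.count p M, Nat.nth p i < M ∧ p (Nat.nth p i) ∧
      Nat.count p (Nat.nth p i) = i := by
    intro i hi
    obtain ⟨m, hm, hpm, rfl⟩ := exists_count_eq_of_lt_count p hi
    rw [Nat.nth_count hpm]
    exact ⟨hm, hpm, rfl⟩
  refine Finset.sum_bij' (fun i _ => (Nat.nth p i, Nat.nth p (i + 1)))
    (fun x _ => Nat.count p x.1) ?_ ?_ ?_ ?_ ?_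
  · intro i hi
    rw [Finset.mem_range] at hi
    obtain ⟨a1, a2, a3⟩ := hnth i (by omega)
    obtain ⟨b1, b2, b3⟩ := hnth (i + 1) (by omega)
    simp only [Finset.mem_filter, Finset.mem_product, Finset.mem_range]
    refine ⟨⟨a1, b1⟩, ?_, a2, b2, fun m hm1 hm2 hpm => ?_⟩
    · by_contra hle
      have := Nat.count_monotone p (not_lt.1 hle)
      omega
    · have h1 := Nat.count_monotone p (Nat.succ_le_of_lt hm1)
      have h2 := Nat.count_monotone p (Nat.succ_le_of_lt hm2)
      rw [Nat.succ_eq_add_one, Nat.count_succ, if_pos a2] at h1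
      rw [Nat.succ_eq_add_one, Nat.count_succ, if_pos hpm] at h2
      omega
  · rintro ⟨j, k⟩ hx
    simp only [Finset.mem_filter, Finset.mem_product, Finset.mem_range] at hx ⊢
    have h1 := hx.2.count_eq
    have h2 : Nat.count p (k + 1) ≤ Nat.count p M := Nat.count_monotone p hx.1.2
    rw [Nat.count_succ, if_pos hx.2.2.2.1] at h2
    omega
  · intro i hi
    rw [Finset.mem_range] at hi
    exact (hnth i (by omega)).2.2
  · rintro ⟨j, k⟩ hx
    simp only [Finset.mem_filter, Finset.mem_product, Finset.mem_range] at hx ⊢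
    rw [← hx.2.count_eq, Nat.nth_count hx.2.2.1, Nat.nth_count hx.2.2.2.1]
  · intro i _
    rfl

theorem consecutiveSum_const (p : ℕ → Prop) [DecidablePred p] (c : ℝ) (M : ℕ) :
    consecutiveSum p (fun _ _ => c) M = ((Nat.count p M - 1 : ℕ) : ℝ) * c := by
  rw [← sum_nth_eq_consecutiveSum]
  simp

theorem consecutiveSum_le {p : ℕ → Prop} {F G : ℕ → ℕ → ℝ} {M : ℕ}
    (h : ∀ j k, k < M → IsConsecutive p j k → F j k ≤ G j k) :
    consecutiveSum p F M ≤ consecutiveSum p G M := by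
  refine Finset.sum_le_sum fun j _ => Finset.sum_le_sum fun k hk => ?_
  split_ifs with hc
  · exact h j k (Finset.mem_range.1 hk) hc
  · exact le_rfl

theorem consecutiveSum_congr {p : ℕ → Prop} {F G : ℕ → ℕ → ℝ} {M : ℕ}
    (h : ∀ j k, k < M → IsConsecutive p j k → F j k = G j k) :
    consecutiveSum p F M = consecutiveSum p G M :=
  le_antisymm (consecutiveSum_le fun j k hk hc => (h j k hk hc).le)
    (consecutiveSum_le fun j k hk hc => (h j k hk hc).ge)

theorem consecutiveSum_sub (p : ℕ → Prop) (F G : ℕ → ℕ → ℝ) (M : ℕ) :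
    consecutiveSum p (fun j k => F j k - G j k) M =
      consecutiveSum p F M - consecutiveSum p G M := by
  simp only [consecutiveSum, ← Finset.sum_sub_distrib]
  refine Finset.sum_congr rfl fun j _ => Finset.sum_congr rfl fun k _ => ?_
  split_ifs <;> ring

theorem consecutiveSum_reflect {p p' : ℕ → Prop} {N : ℕ} (hp : ∀ i ≤ N, p' i ↔ p (N - i))
    (F : ℕ → ℕ → ℝ) :
    consecutiveSum p' F (N + 1) = consecutiveSum p (fun j k => F (N - k) (N - j)) (N + 1) := by
  classical
  simp only [consecutiveSum]
  rw [Finset.sum_comm, ← Finset.sum_range_reflect]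
  refine Finset.sum_congr rfl fun j hj => ?_
  rw [← Finset.sum_range_reflect]
  refine Finset.sum_congr rfl fun k hk => ?_
  rw [Finset.mem_range] at hj hk
  rw [show N + 1 - 1 - j = N - j by omega, show N + 1 - 1 - k = N - k by omega,
    IsConsecutive.reflect_iff hp (by omega) (by omega), show N - (N - j) = j by omega,
    show N - (N - k) = k by omega]

open Classical in
/-- The value of `F` at the next time after `j` at which `p` holds. -/
def nextValue (p : ℕ → Prop) (F : ℕ → ℕ → ℝ) (j : ℕ) : ℝ :=
  ∑' k, if IsConsecutive p j k then F j k else 0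

theorem nextValue_of_isConsecutive {p : ℕ → Prop} (F : ℕ → ℕ → ℝ) {j k : ℕ}
    (h : IsConsecutive p j k) : nextValue p F j = F j k := by
  classical
  rw [nextValue, tsum_eq_single k, if_pos h]
  intro k' hk'
  rw [if_neg fun h' => hk' (h'.unique h)]

theorem nextValue_of_forall_not {p : ℕ → Prop} (F : ℕ → ℕ → ℝ) {j : ℕ}
    (h : ∀ k, ¬ IsConsecutive p j k) : nextValue p F j = 0 := by
  classical
  simp [nextValue, h]

theorem nextValue_mem_Icc {p : ℕ → Prop} {F : ℕ → ℕ → ℝ} {L : ℝ} (hL : 0 ≤ L) {j : ℕ}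
    (h : ∀ k, IsConsecutive p j k → F j k ∈ Icc 0 L) : nextValue p F j ∈ Icc 0 L := by
  by_cases hex : ∃ k, IsConsecutive p j k
  · obtain ⟨k, hk⟩ := hex
    rw [nextValue_of_isConsecutive F hk]
    exact h k hk
  · rw [nextValue_of_forall_not F (not_exists.1 hex)]
    exact ⟨le_rfl, hL⟩

/-- The sum over consecutive times differs from the sum of the values at the next times at most by
one term. -/
theorem sum_nextValue_sub_consecutiveSum {p : ℕ → Prop} {F : ℕ → ℕ → ℝ} {L : ℝ} (hL : 0 ≤ L)
    (h : ∀ j k, IsConsecutive p j k → F j k ∈ Icc 0 L) (M : ℕ) :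
    ∑ j ∈ Finset.range M, nextValue p F j - consecutiveSum p F M ∈ Icc 0 L := by
  classical
  rw [consecutiveSum, ← Finset.sum_sub_distrib]
  set d : ℕ → ℝ := fun j => nextValue p F j -
    ∑ k ∈ Finset.range M, if IsConsecutive p j k then F j k else 0 with hd
  have hdval : ∀ j, d j ∈ Icc 0 L ∧ (d j ≠ 0 → ∃ k, M ≤ k ∧ IsConsecutive p j k) := by
    intro j
    by_cases hex : ∃ k, IsConsecutive p j k
    · obtain ⟨k, hk⟩ := hex
      have hs : (∑ k' ∈ Finset.range M, if IsConsecutive p j k' then F j k' else 0) =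
          if k < M then F j k else 0 := by
        rw [Finset.sum_congr rfl (g := fun k' => if k' = k then F j k else 0) fun k' _ => ?_]
        · rw [Finset.sum_ite_eq']; simp
        · by_cases he : k' = k
          · subst he; rw [if_pos hk, if_pos rfl]
          · rw [if_neg he, if_neg fun h' => he (h'.unique hk)]
      simp only [hd, hs, nextValue_of_isConsecutive F hk]
      split_ifs with hkM
      · rw [sub_self]; exact ⟨⟨le_rfl, hL⟩, fun h => absurd rfl h⟩
      · rw [sub_zero]; exact ⟨h j k hk, fun _ => ⟨k, not_lt.1 hkM, hk⟩⟩
    · rw [not_exists] at hex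
      have : d j = 0 := by
        simp only [hd]
        rw [nextValue_of_forall_not F hex]
        simp [hex]
      rw [this]
      exact ⟨⟨le_rfl, hL⟩, fun h => absurd rfl h⟩
  -- Only the last visit before M can have its successor at M or later.
  have huniq : ∀ j j', j < M → j' < M → d j ≠ 0 → d j' ≠ 0 → j = j' := by
    intro j j' hj hj' h1 h2
    obtain ⟨k, hk, hc⟩ := (hdval j).2 h1
    obtain ⟨k', hk', hc'⟩ := (hdval j').2 h2
    rcases lt_trichotomy j j' with hlt | heq | hlt
    · exact absurd hc'.2.1 (hc.2.2.2 j' hlt (by omega))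
    · exact heq
    · exact absurd hc.2.1 (hc'.2.2.2 j hlt (by omega))
  refine ⟨Finset.sum_nonneg fun j _ => (hdval j).1.1, ?_⟩
  by_cases hex : ∃ j ∈ Finset.range M, d j ≠ 0
  · obtain ⟨j, hj, hj0⟩ := hex
    rw [Finset.sum_eq_single_of_mem j hj fun j' hj' hne => ?_]
    · exact (hdval j).1.2
    · by_contra hc
      exact hne (huniq j' j (Finset.mem_range.1 hj') (Finset.mem_range.1 hj) hc hj0)
  · push Not at hex
    rw [Finset.sum_eq_zero hex]
    exact hL

/-- Makes the increment that starts at time j a function of the j-th iterate alone, as a Birkhoff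
sum requires. -/
theorem nextValue_shift (p : ℕ → Prop) (F : ℕ → ℕ → ℝ) (j : ℕ) :
    nextValue (fun i => p (i + j)) (fun a b => F (a + j) (b + j)) 0 = nextValue p F j := by
  by_cases hex : ∃ k, IsConsecutive p j k
  · obtain ⟨k, hk⟩ := hex
    obtain ⟨m, rfl⟩ : ∃ m, k = m + j := ⟨k - j, by have := hk.1; omega⟩
    rw [nextValue_of_isConsecutive F hk, nextValue_of_isConsecutive _
      ((IsConsecutive.shift_iff j m).2 hk), zero_add]
  · rw [not_exists] at hex
    rw [nextValue_of_forall_not F hex, nextValue_of_forall_not]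
    exact fun k hk => hex _ ((IsConsecutive.shift_iff j k).1 hk)

theorem footpointIncrement_mem_Ico {L s s' : ℝ} (hs : s ∈ Ico 0 L) (hs' : s' ∈ Ico 0 L) :
    footpointIncrement L s s' ∈ Ico 0 L := by
  unfold footpointIncrement
  split_ifs with h
  · exact ⟨by linarith, by linarith [hs.1, hs'.2]⟩
  · exact ⟨by linarith [hs.2, hs'.1], by linarith [not_le.1 h]⟩

/-- Two distinct points cut the closed curve into two arcs of total length L. For equal points both
increments are zero, which is why exact returns must be excluded. -/
theorem footpointIncrement_swap {L s s' : ℝ} (h : s ≠ s') :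
    footpointIncrement L s' s = L - footpointIncrement L s s' := by
  unfold footpointIncrement
  rcases lt_or_gt_of_ne h with hlt | hlt
  · rw [if_neg (not_le.2 hlt), if_pos hlt.le]; ring
  · rw [if_pos hlt.le, if_neg (not_le.2 hlt)]; ring


/-- The almost everywhere limits of `f N` and of `f N ∘ J N` have the same distribution if the maps
`J N` preserve the measure. -/
theorem map_eq_map_of_tendsto_comp {X : Type*} [MeasurableSpace X] {μ : Measure X}
    [IsFiniteMeasure μ] {f : ℕ → X → ℝ} {J : ℕ → X → X} {a b : X → ℝ}
    (hf : ∀ N, Measurable (f N)) (hJ : ∀ N, MeasurePreserving (J N) μ μ) (ha : AEMeasurable a μ)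
    (hb : AEMeasurable b μ) (hlim : ∀ᵐ x ∂μ, Tendsto (fun N => f N x) atTop (𝓝 (a x)))
    (hlim' : ∀ᵐ x ∂μ, Tendsto (fun N => f N (J N x)) atTop (𝓝 (b x))) : μ.map a = μ.map b := by
  -- For bounded continuous g the integrals of g(f_N) and g(f_N ∘ J_N) agree for every N; dominated
  -- convergence carries the equality to the limits.
  refine ext_of_forall_integral_eq_of_IsFiniteMeasure fun g => ?_
  have hg := g.continuous
  rw [integral_map ha hg.aestronglyMeasurable, integral_map hb hg.aestronglyMeasurable]
  have hconv : ∀ (F : ℕ → X → ℝ) (c : X → ℝ), (∀ N, Measurable (F N)) →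
      (∀ᵐ x ∂μ, Tendsto (fun N => F N x) atTop (𝓝 (c x))) →
      Tendsto (fun N => ∫ x, g (F N x) ∂μ) atTop (𝓝 (∫ x, g (c x) ∂μ)) := fun F c hF hc =>
    tendsto_integral_of_dominated_convergence (fun _ => ‖g‖)
      (fun N => (hg.measurable.comp (hF N)).aestronglyMeasurable) (integrable_const _)
      (fun N => ae_of_all _ fun x => g.norm_coe_le_norm _)
      (hc.mono fun x hx => (hg.tendsto _).comp hx)
  have heq : ∀ N, ∫ x, g (f N (J N x)) ∂μ = ∫ x, g (f N x) ∂μ := fun N => by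
    have := integral_map (μ := μ) (hJ N).aemeasurable (f := fun x => g (f N x))
      (hg.measurable.comp (hf N)).aestronglyMeasurable
    rw [(hJ N).map_eq] at this
    exact this.symm
  have h2 := hconv _ b (fun N => (hf N).comp (hJ N).measurable) hlim'
  exact tendsto_nhds_unique (hconv f a hf hlim) (h2.congr heq)

/-! ### Existence, invariance and symmetry of the rotation number. -/

namespace BilliardTable

variable {q : ℕ} (T : BilliardTable q)

theorem billiardMap_mem_phaseSpace {z : PhasePoint q} (hz : z ∈ T.phaseSpace) :
    T.billiardMap z ∈ T.phaseSpace := by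
  by_cases h : z ∈ T.mapDomain
  · exact (T.isBilliardStep_billiardMap h).2.1.1
  · rwa [T.billiardMap_of_notMem h]

theorem iterate_mem_phaseSpace {z : PhasePoint q} (hz : z ∈ T.phaseSpace) (k : ℕ) :
    T.billiardMap^[k] z ∈ T.phaseSpace := by
  induction k with
  | zero => exact hz
  | succ k ih => rw [Function.iterate_succ_apply']; exact T.billiardMap_mem_phaseSpace ih

/-- The orbit of `z` visits the boundary component `α` at time `k`. -/
def Visits (α : Fin q) (z : PhasePoint q) (k : ℕ) : Prop := (T.billiardMap^[k] z).1 = α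

instance (α : Fin q) (z : PhasePoint q) : DecidablePred (T.Visits α z) :=
  fun k => inferInstanceAs (Decidable ((T.billiardMap^[k] z).1 = α))

/-- The footpoint increment along `α` between two times. -/
def orbitIncrement (α : Fin q) (z : PhasePoint q) (j k : ℕ) : ℝ :=
  footpointIncrement (T.len α) (T.billiardMap^[j] z).arc (T.billiardMap^[k] z).arc

theorem gainSum_eq_consecutiveSum (α : Fin q) (z : PhasePoint q) (N : ℕ) :
    T.gainSum α z N = consecutiveSum (T.Visits α z) (T.orbitIncrement α z) (N + 1) :=
  sum_nth_eq_consecutiveSum (T.Visits α z) (T.orbitIncrement α z) (N + 1)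

theorem arc_mem_Ico_of_visits {α : Fin q} {z : PhasePoint q} (hz : z ∈ T.phaseSpace) {k : ℕ}
    (h : T.Visits α z k) : (T.billiardMap^[k] z).arc ∈ Ico 0 (T.len α) := by
  have := (T.iterate_mem_phaseSpace hz k).1
  rwa [show (T.billiardMap^[k] z).comp = α from h] at this

theorem orbitIncrement_mem_Icc {α : Fin q} {z : PhasePoint q} (hz : z ∈ T.phaseSpace) {j k : ℕ}
    (h : IsConsecutive (T.Visits α z) j k) : T.orbitIncrement α z j k ∈ Icc 0 (T.len α) :=
  Ico_subset_Icc_self (footpointIncrement_mem_Ico (T.arc_mem_Ico_of_visits hz h.2.1)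
    (T.arc_mem_Ico_of_visits hz h.2.2.1))

theorem gainSum_nonneg (α : Fin q) {z : PhasePoint q} (hz : z ∈ T.phaseSpace) (N : ℕ) :
    0 ≤ T.gainSum α z N := by
  rw [T.gainSum_eq_consecutiveSum]
  have := consecutiveSum_le (p := T.Visits α z) (F := fun _ _ => 0) (G := T.orbitIncrement α z)
    (M := N + 1) fun j k _ h => (T.orbitIncrement_mem_Icc hz h).1
  rwa [consecutiveSum_const, mul_zero] at this

theorem gainSum_le (α : Fin q) {z : PhasePoint q} (hz : z ∈ T.phaseSpace) (N : ℕ) :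
    T.gainSum α z N ≤ ((Nat.count (T.Visits α z) (N + 1) - 1 : ℕ) : ℝ) * T.len α := by
  rw [T.gainSum_eq_consecutiveSum, ← consecutiveSum_const]
  exact consecutiveSum_le fun j k _ h => (T.orbitIncrement_mem_Icc hz h).2

/-- Every footpoint lies on exactly one component. This one count yields both ρ ≤ 1 and the constant
1 in the symmetry ρ ↦ 1 - ρ. -/
theorem sum_count_visits (z : PhasePoint q) (M : ℕ) :
    ∑ α, Nat.count (T.Visits α z) M = M := by
  induction M with
  | zero => simp
  | succ M ih =>
    simp only [Nat.count_succ, Finset.sum_add_distrib, ih]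
    congr 1
    refine (Finset.sum_eq_single (T.billiardMap^[M] z).1
      (fun β _ hβ => if_neg fun h => hβ (Eq.symm h))
      (fun h => absurd (Finset.mem_univ _) h)).trans ?_
    exact if_pos rfl

/-- The sum of the footpoint increments, in units of the lengths of the boundary components. -/
def turnSum (z : PhasePoint q) (N : ℕ) : ℝ := ∑ α, T.gainSum α z N / T.len α

theorem turnSum_nonneg {z : PhasePoint q} (hz : z ∈ T.phaseSpace) (N : ℕ) :
    0 ≤ T.turnSum z N :=
  Finset.sum_nonneg fun α _ => div_nonneg (T.gainSum_nonneg α hz N) (T.len_pos α).le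

theorem turnSum_le {z : PhasePoint q} (hz : z ∈ T.phaseSpace) (N : ℕ) :
    T.turnSum z N ≤ N + 1 := by
  calc T.turnSum z N ≤ ∑ α, (Nat.count (T.Visits α z) (N + 1) : ℝ) := by
        refine Finset.sum_le_sum fun α _ => ?_
        rw [div_le_iff₀ (T.len_pos α)]
        refine (T.gainSum_le α hz N).trans ?_
        gcongr
        · exact (T.len_pos α).le
        · exact Nat.sub_le _ _
    _ = N + 1 := by
        rw [← Nat.cast_sum, T.sum_count_visits]; push_cast; rfl

theorem tendsto_turnSum_div {z : PhasePoint q} (hz : z ∈ T.rotationDomain) :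
    Tendsto (fun N : ℕ => T.turnSum z N / N) atTop (𝓝 (T.rotationNumber z)) := by
  have h : Tendsto (fun N : ℕ => ∑ α, T.gainSum α z N / N / T.len α) atTop
      (𝓝 (T.rotationNumber z)) := by
    refine tendsto_finsetSum _ fun α _ => ?_
    obtain ⟨v, hv⟩ := hz.2.2 α
    exact (tendsto_nhds_limUnder ⟨v, hv⟩).div_const _
  refine h.congr fun N => ?_
  rw [turnSum, Finset.sum_div]
  exact Finset.sum_congr rfl fun α _ => div_right_comm _ _ _

theorem tendsto_natCast_add_const_div (c : ℝ) :
    Tendsto (fun N : ℕ => ((N : ℝ) + c) / N) atTop (𝓝 1) := by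
  have h := (tendsto_const_div_atTop_nhds_zero_nat c).const_add 1
  rw [add_zero] at h
  refine h.congr' ?_
  filter_upwards [eventually_gt_atTop 0] with N hN
  have : (N : ℝ) ≠ 0 := by exact_mod_cast hN.ne'
  field_simp

theorem rotationNumber_mem_Icc {z : PhasePoint q} (hz : z ∈ T.rotationDomain) :
    T.rotationNumber z ∈ Icc (0 : ℝ) 1 := by
  have h := T.tendsto_turnSum_div hz
  refine ⟨ge_of_tendsto' h fun N => div_nonneg (T.turnSum_nonneg hz.1 N) (Nat.cast_nonneg N),
    le_of_tendsto_of_tendsto' h (tendsto_natCast_add_const_div 1) fun N => ?_⟩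
  exact div_le_div_of_nonneg_right (T.turnSum_le hz.1 N) (Nat.cast_nonneg N)

theorem measurableSet_visits (α : Fin q) (k : ℕ) : MeasurableSet {z | T.Visits α z k} :=
  (measurable_fst.comp (T.measurable_billiardMap.iterate k)) (measurableSet_singleton α)

theorem measurableSet_isConsecutive_visits (α : Fin q) (j k : ℕ) :
    MeasurableSet {z | IsConsecutive (T.Visits α z) j k} := by
  have h := T.measurableSet_visits α
  have h3 : {z | IsConsecutive (T.Visits α z) j k} = {_z | j < k} ∩ ({z | T.Visits α z j} ∩
      ({z | T.Visits α z k} ∩ ⋂ i, {_z | j < i → i < k → False} ∪ {z | T.Visits α z i}ᶜ)) := by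
    ext z
    simp only [mem_inter_iff, mem_iInter, mem_union, mem_compl_iff, mem_ofPred_eq, IsConsecutive]
    refine and_congr_right fun _ => and_congr_right fun _ => and_congr_right fun _ =>
      forall_congr' fun i => ?_
    tauto
  rw [h3]
  exact (MeasurableSet.const _).inter ((h j).inter ((h k).inter
    (MeasurableSet.iInter fun i => (MeasurableSet.const _).union (h i).compl)))

theorem measurable_orbitIncrement (α : Fin q) (j k : ℕ) :
    Measurable fun z => T.orbitIncrement α z j k := by
  have h : ∀ k, Measurable fun z => (T.billiardMap^[k] z).2.1 := fun k =>
    (measurable_fst.comp measurable_snd).comp (T.measurable_billiardMap.iterate k)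
  exact Measurable.ite (measurableSet_le (h j) (h k)) ((h k).sub (h j))
    (((h k).add_const _).sub (h j))

theorem measurable_gainSum (α : Fin q) (N : ℕ) : Measurable fun z => T.gainSum α z N := by
  classical
  simp only [T.gainSum_eq_consecutiveSum, consecutiveSum]
  exact Finset.measurable_sum _ fun j _ => Finset.measurable_sum _ fun k _ =>
    Measurable.ite (T.measurableSet_isConsecutive_visits α j k)
      (T.measurable_orbitIncrement α j k) measurable_const

theorem measurable_turnSum (N : ℕ) : Measurable fun z => T.turnSum z N :=
  Finset.measurable_sum _ fun α _ => (T.measurable_gainSum α N).div_const _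

theorem measurableSet_rotationDomain : MeasurableSet T.rotationDomain := by
  have h1 : MeasurableSet {z | ∀ k : ℕ, T.billiardMap^[k] z ∈ T.mapDomain} := by
    have : {z | ∀ k : ℕ, T.billiardMap^[k] z ∈ T.mapDomain} =
        ⋂ k : ℕ, T.billiardMap^[k] ⁻¹' T.mapDomain := by ext z; simp
    rw [this]
    exact MeasurableSet.iInter fun k => (T.measurable_billiardMap.iterate k)
      T.measurableSet_mapDomain
  have h2 : MeasurableSet {z | ∀ α, ∃ v, T.HasFootpointGain α z v} := by
    have : {z | ∀ α, ∃ v, T.HasFootpointGain α z v} =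
        ⋂ α, {z | ∃ v, T.HasFootpointGain α z v} := by ext z; simp
    rw [this]
    exact MeasurableSet.iInter fun α => measurableSet_exists_tendsto fun N =>
      (T.measurable_gainSum α N).div_const _
  exact T.measurableSet_phaseSpace.inter (h1.inter h2)

theorem measurable_rotationNumber :
    Measurable (fun z : T.rotationDomain => T.rotationNumber z) :=
  measurable_of_tendsto_metrizable
    (fun N : ℕ => ((T.measurable_turnSum N).div_const (N : ℝ)).comp measurable_subtype_coe)
    (tendsto_pi_nhds.2 fun z => T.tendsto_turnSum_div z.2)

/-- The footpoint increment along `α` until the first return to `α`. -/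
def returnIncrement (α : Fin q) : PhasePoint q → ℝ :=
  T.phaseSpace.indicator fun z => nextValue (T.Visits α z) (T.orbitIncrement α z) 0

/-- The ergodic theorem asks for a bound at every point; the indicator in the definition provides it
off the phase space, where arclength coordinates are unrestricted. -/
theorem returnIncrement_mem_Icc (α : Fin q) (z : PhasePoint q) :
    T.returnIncrement α z ∈ Icc 0 (T.len α) := by
  by_cases hz : z ∈ T.phaseSpace
  · rw [returnIncrement, indicator_of_mem hz]
    exact nextValue_mem_Icc (T.len_pos α).le fun k h => T.orbitIncrement_mem_Icc hz h
  · rw [returnIncrement, indicator_of_notMem hz]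
    exact ⟨le_rfl, (T.len_pos α).le⟩

theorem measurable_returnIncrement (α : Fin q) : Measurable (T.returnIncrement α) := by
  classical
  refine Measurable.indicator ?_ T.measurableSet_phaseSpace
  refine measurable_of_tendsto_metrizable (f := fun (M : ℕ) z => ∑ k ∈ Finset.range M,
    if IsConsecutive (T.Visits α z) 0 k then T.orbitIncrement α z 0 k else 0) (fun M => ?_) ?_
  · exact Finset.measurable_sum _ fun k _ =>
      Measurable.ite (T.measurableSet_isConsecutive_visits α 0 k)
        (T.measurable_orbitIncrement α 0 k) measurable_const
  · refine tendsto_pi_nhds.2 fun z => ?_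
    have hs : Summable fun k => if IsConsecutive (T.Visits α z) 0 k then
        T.orbitIncrement α z 0 k else 0 := by
      refine summable_of_hasFiniteSupport (Set.Subsingleton.finite fun k hk k' hk' => ?_)
      have h1 : IsConsecutive (T.Visits α z) 0 k := by
        by_contra h; exact hk (if_neg h)
      have h2 : IsConsecutive (T.Visits α z) 0 k' := by
        by_contra h; exact hk' (if_neg h)
      exact h1.unique h2
    exact hs.hasSum.tendsto_sum_nat

theorem returnIncrement_iterate (α : Fin q) {z : PhasePoint q} (hz : z ∈ T.phaseSpace) (j : ℕ) :
    T.returnIncrement α (T.billiardMap^[j] z) =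
      nextValue (T.Visits α z) (T.orbitIncrement α z) j := by
  rw [returnIncrement, indicator_of_mem (T.iterate_mem_phaseSpace hz j),
    ← nextValue_shift (T.Visits α z) (T.orbitIncrement α z) j]
  simp only [Visits, orbitIncrement, Function.iterate_add_apply]
  rfl

theorem birkhoffSum_returnIncrement_sub_gainSum (α : Fin q) {z : PhasePoint q}
    (hz : z ∈ T.phaseSpace) (N : ℕ) :
    birkhoffSum T.billiardMap (T.returnIncrement α) (N + 1) z - T.gainSum α z N ∈
      Icc 0 (T.len α) := by
  have := sum_nextValue_sub_consecutiveSum (T.len_pos α).le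
    (fun j k h => T.orbitIncrement_mem_Icc (α := α) hz h) (N + 1)
  rw [T.gainSum_eq_consecutiveSum, birkhoffSum]
  simpa only [T.returnIncrement_iterate α hz] using this

theorem hasFootpointGain_iff (α : Fin q) {z : PhasePoint q} (hz : z ∈ T.phaseSpace) (v : ℝ) :
    T.HasFootpointGain α z v ↔
      Tendsto (fun n => birkhoffAverage ℝ T.billiardMap (T.returnIncrement α) n z) atTop
        (𝓝 v) := by
  have h0 : Tendsto (fun N : ℕ => birkhoffAverage ℝ T.billiardMap (T.returnIncrement α) N z -
      T.gainSum α z N / N) atTop (𝓝 0) := by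
    refine squeeze_zero_norm (a := fun N : ℕ => (T.len α) / N) (fun N => ?_)
      (tendsto_const_div_atTop_nhds_zero_nat _)
    have h1 := T.birkhoffSum_returnIncrement_sub_gainSum α hz N
    have h2 := T.returnIncrement_mem_Icc α (T.billiardMap^[N] z)
    -- The gain up to time N belongs to the Birkhoff sum of length N + 1. Dropping the last summand
    -- costs at most one length, so the difference lies in [-L, L].
    rw [birkhoffSum_succ] at h1
    have h3 : |birkhoffSum T.billiardMap (T.returnIncrement α) N z - T.gainSum α z N| ≤
        T.len α := by
      rw [abs_le]; constructor <;> linarith [h1.1, h1.2, h2.1, h2.2]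
    rw [birkhoffAverage, smul_eq_mul, ← div_eq_inv_mul, ← sub_div, Real.norm_eq_abs, abs_div,
      Nat.abs_cast]
    exact div_le_div_of_nonneg_right h3 (Nat.cast_nonneg N)
  constructor
  · intro h
    have := h0.add h
    simpa using this
  · intro h
    have := h.sub h0
    simpa [HasFootpointGain] using this

theorem ae_mem_phaseSpace : ∀ᵐ z ∂T.liouville, z ∈ T.phaseSpace := by
  have := T.liouville_compl_phaseSpace
  rwa [← mem_ae_iff] at this

theorem ae_forall_iterate_mem_mapDomain :
    ∀ᵐ z ∂T.liouville, ∀ k : ℕ, T.billiardMap^[k] z ∈ T.mapDomain :=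
  ae_all_iff.2 fun k =>
    (T.measurePreserving_billiardMap.iterate k).quasiMeasurePreserving.ae T.ae_mem_mapDomain

theorem ae_mem_rotationDomain : ∀ᵐ z ∂T.liouville, z ∈ T.rotationDomain := by
  have := T.isFiniteMeasure_liouville
  have h : ∀ᵐ z ∂T.liouville, ∀ α, ∃ l, Tendsto (fun n =>
      birkhoffAverage ℝ T.billiardMap (T.returnIncrement α) n z) atTop (𝓝 l) :=
    ae_all_iff.2 fun α => ae_exists_tendsto_birkhoffAverage T.measurePreserving_billiardMap
      (T.measurable_returnIncrement α) (C := T.len α) fun z => by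
        have := T.returnIncrement_mem_Icc α z
        rw [abs_of_nonneg this.1]
        exact this.2
  filter_upwards [T.ae_mem_phaseSpace, T.ae_forall_iterate_mem_mapDomain, h] with z h1 h2 h3
  exact ⟨h1, h2, fun α => (h3 α).imp fun v hv => (T.hasFootpointGain_iff α h1 v).2 hv⟩

theorem aemeasurable_rotationNumber : AEMeasurable T.rotationNumber T.liouville :=
  aemeasurable_of_tendsto_metrizable_ae atTop
    (fun N : ℕ => ((T.measurable_turnSum N).div_const (N : ℝ)).aemeasurable)
    (T.ae_mem_rotationDomain.mono fun _ hz => T.tendsto_turnSum_div hz)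

/-- Birkhoff averages of a bounded function at z and at φ(z) have the same limit. -/
theorem rotationNumber_billiardMap {z : PhasePoint q} (hz : z ∈ T.rotationDomain) :
    T.rotationNumber (T.billiardMap z) = T.rotationNumber z := by
  refine Finset.sum_congr rfl fun α _ => ?_
  obtain ⟨v, hv⟩ := hz.2.2 α
  have h1 := (T.hasFootpointGain_iff α hz.1 v).1 hv
  have hbdd : Bornology.IsBounded (range (T.returnIncrement α)) :=
    (Metric.isBounded_Icc 0 (T.len α)).subset
      (range_subset_iff.2 fun z => T.returnIncrement_mem_Icc α z)
  have h2 := (tendsto_birkhoffAverage_apply_sub_birkhoffAverage' ℝ hbdd T.billiardMap z).add h1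
  simp only [sub_add_cancel, zero_add] at h2
  have h3 := (T.hasFootpointGain_iff α (T.billiardMap_mem_phaseSpace hz.1) v).2 h2
  have e1 : T.footpointGain α (T.billiardMap z) = v := h3.limUnder_eq
  have e2 : T.footpointGain α z = v := Tendsto.limUnder_eq hv
  rw [rotationVector, rotationVector, e1, e2]

/-- Time reversal turns each step around, so the reversed ball passes through the reversed phase
points in the opposite order. -/
theorem iterate_reverse_iterate {z : PhasePoint q}
    (hz : ∀ k : ℕ, T.billiardMap^[k] z ∈ T.mapDomain) {N k : ℕ} (hk : k ≤ N) :
    T.billiardMap^[k] (reverse (T.billiardMap^[N] z)) = reverse (T.billiardMap^[N - k] z) := by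
  induction k with
  | zero => rfl
  | succ k ih =>
    rw [Function.iterate_succ_apply', ih (by omega)]
    have h := T.isBilliardStep_billiardMap (hz (N - (k + 1)))
    rw [← Function.iterate_succ_apply' T.billiardMap, show (N - (k + 1)).succ = N - k by omega] at h
    exact (IsBilliardStep.reverse T h).billiardMap_eq T

theorem arc_ne_of_isConsecutive {α : Fin q} {z : PhasePoint q}
    (hz : ∀ k : ℕ, T.billiardMap^[k] z ∈ T.mapDomain)
    (hl : ∀ k : ℕ, T.billiardMap^[k] z ∉ T.returnLoops) {j k : ℕ}
    (h : IsConsecutive (T.Visits α z) j k) :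
    (T.billiardMap^[j] z).arc ≠ (T.billiardMap^[k] z).arc := by
  intro he
  obtain ⟨h1, h2, h3, h4⟩ := h
  obtain ⟨m, rfl⟩ : ∃ m, k = m + j := ⟨k - j, by omega⟩
  have h2' : (T.billiardMap^[j] z).comp = α := h2
  have h3' : (T.billiardMap^[m + j] z).comp = α := h3
  rw [Function.iterate_add_apply] at h3' he
  rcases Nat.lt_or_ge m 2 with hm | hm
  -- A single flight has positive length, so it cannot end where it began. A return after two or
  -- more steps to the same footpoint is a return loop.
  · obtain rfl : m = 1 := by omega
    obtain ⟨hr, -, t, ht, -, hf, -⟩ := T.isBilliardStep_billiardMap (hz j)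
    rw [Function.iterate_one] at h3' he
    have hf' : T.footpoint (T.billiardMap (T.billiardMap^[j] z)) =
        T.footpoint (T.billiardMap^[j] z) := by
      rw [footpoint, footpoint, h2', h3', he]
    rw [hf', left_eq_add, mul_eq_zero] at hf
    rcases hf with hf | hf
    · exact ht.ne' (by exact_mod_cast hf)
    · have := T.norm_outgoing hr
      rw [hf, norm_zero] at this
      exact zero_ne_one this
  · refine hl j ⟨m, hm, fun i hi him hc => ?_, h3'.trans h2'.symm, he.symm⟩
    refine h4 (i + j) (by omega) (by omega) ?_
    rw [Visits, Function.iterate_add_apply]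
    exact hc.trans h2'

/-- The footpoint gain of the reversed orbit. -/
theorem gainSum_reverse (α : Fin q) {z : PhasePoint q}
    (hz : ∀ k : ℕ, T.billiardMap^[k] z ∈ T.mapDomain)
    (hl : ∀ k : ℕ, T.billiardMap^[k] z ∉ T.returnLoops) (N : ℕ) :
    T.gainSum α (reverse (T.billiardMap^[N] z)) N =
      ((Nat.count (T.Visits α z) (N + 1) - 1 : ℕ) : ℝ) * T.len α - T.gainSum α z N := by
  have hp : ∀ i ≤ N, T.Visits α (reverse (T.billiardMap^[N] z)) i ↔ T.Visits α z (N - i) := by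
    intro i hi
    rw [Visits, T.iterate_reverse_iterate hz hi]
    rfl
  rw [T.gainSum_eq_consecutiveSum, T.gainSum_eq_consecutiveSum, consecutiveSum_reflect hp,
    ← consecutiveSum_const, ← consecutiveSum_sub]
  -- The pair (j, k) of the orbit is run through from k to j by the reversed orbit, and the
  -- increment becomes its complement.
  refine consecutiveSum_congr fun j k hk h => ?_
  have hjk := h.1
  rw [orbitIncrement, T.iterate_reverse_iterate hz (by omega),
    T.iterate_reverse_iterate hz (by omega), show N - (N - j) = j by omega,
    show N - (N - k) = k by omega]
  exact footpointIncrement_swap (T.arc_ne_of_isConsecutive hz hl h)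

/-- A component with n > 0 visits has n - 1 increments. The visits number N + 1 in all, so the
increments number between N + 1 - q and N + 1. -/
theorem turnSum_reverse {z : PhasePoint q}
    (hz : ∀ k : ℕ, T.billiardMap^[k] z ∈ T.mapDomain)
    (hl : ∀ k : ℕ, T.billiardMap^[k] z ∉ T.returnLoops) (N : ℕ) :
    |T.turnSum (reverse (T.billiardMap^[N] z)) N - (N - T.turnSum z N)| ≤ q + 1 := by
  have h1 : T.turnSum (reverse (T.billiardMap^[N] z)) N =
      ∑ α, ((Nat.count (T.Visits α z) (N + 1) - 1 : ℕ) : ℝ) - T.turnSum z N := by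
    simp only [turnSum, ← Finset.sum_sub_distrib]
    refine Finset.sum_congr rfl fun α _ => ?_
    rw [T.gainSum_reverse α hz hl, sub_div, mul_div_cancel_right₀ _ (T.len_pos α).ne']
  have h2 := T.sum_count_visits z (N + 1)
  have h3 : ∑ α, (Nat.count (T.Visits α z) (N + 1) - 1) ≤ N + 1 := by
    refine le_trans (Finset.sum_le_sum fun α _ => ?_) h2.le
    exact Nat.sub_le _ _
  have h4 : N + 1 ≤ ∑ α, (Nat.count (T.Visits α z) (N + 1) - 1) + q := by
    calc N + 1 = ∑ α, Nat.count (T.Visits α z) (N + 1) := h2.symm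
      _ ≤ ∑ α : Fin q, (Nat.count (T.Visits α z) (N + 1) - 1 + 1) :=
        Finset.sum_le_sum fun α _ => by omega
      _ = _ := by rw [Finset.sum_add_distrib]; simp
  have h3' : ∑ α, ((Nat.count (T.Visits α z) (N + 1) - 1 : ℕ) : ℝ) ≤ N + 1 := by exact_mod_cast h3
  have h4' : (N : ℝ) + 1 ≤ ∑ α, ((Nat.count (T.Visits α z) (N + 1) - 1 : ℕ) : ℝ) + q := by
    exact_mod_cast h4
  rw [h1, abs_le]
  constructor <;> linarith [(Nat.cast_nonneg q : (0 : ℝ) ≤ q)]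

theorem tendsto_turnSum_reverse_div {z : PhasePoint q} (hz : z ∈ T.rotationDomain)
    (hl : ∀ k : ℕ, T.billiardMap^[k] z ∉ T.returnLoops) :
    Tendsto (fun N : ℕ => T.turnSum (reverse (T.billiardMap^[N] z)) N / N) atTop
      (𝓝 (1 - T.rotationNumber z)) := by
  have h1 : Tendsto (fun N : ℕ => T.turnSum (reverse (T.billiardMap^[N] z)) N / N -
      (1 - T.turnSum z N / N)) atTop (𝓝 0) := by
    refine squeeze_zero_norm' (a := fun N : ℕ => ((q : ℝ) + 1) / N) ?_
      (tendsto_const_div_atTop_nhds_zero_nat _)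
    filter_upwards [eventually_gt_atTop 0] with N hN
    have hN' : (0 : ℝ) < N := by exact_mod_cast hN
    have e : T.turnSum (reverse (T.billiardMap^[N] z)) N / N - (1 - T.turnSum z N / N) =
        (T.turnSum (reverse (T.billiardMap^[N] z)) N - (N - T.turnSum z N)) / N := by
      field_simp
    rw [e, Real.norm_eq_abs, abs_div, abs_of_pos hN']
    exact div_le_div_of_nonneg_right (T.turnSum_reverse hz.2.1 hl N) hN'.le
  have h2 := h1.add ((T.tendsto_turnSum_div hz).const_sub 1)
  simpa only [sub_add_cancel, zero_add] using h2

theorem ae_forall_iterate_notMem_returnLoops (hloop : T.liouville T.returnLoops = 0) :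
    ∀ᵐ z ∂T.liouville, ∀ k : ℕ, T.billiardMap^[k] z ∉ T.returnLoops :=
  ae_all_iff.2 fun k => (T.measurePreserving_billiardMap.iterate k).quasiMeasurePreserving.ae
    (p := fun z => z ∉ T.returnLoops) (measure_eq_zero_iff_ae_notMem.1 hloop)

/-- The distribution of the rotation number is symmetric. -/
theorem map_rotationNumber_eq (hloop : T.liouville T.returnLoops = 0) :
    T.liouville.map T.rotationNumber = T.liouville.map fun z => 1 - T.rotationNumber z := by
  have := T.isFiniteMeasure_liouville
  have hl := T.ae_forall_iterate_notMem_returnLoops hloop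
  have hf : ∀ N : ℕ, Measurable fun z => T.turnSum z N / N := fun N =>
    (T.measurable_turnSum N).div_const _
  -- The reversing map changes with N, so no pointwise relation between ρ at z and at its reversal
  -- is claimed; only the distributions are compared.
  have hJ : ∀ N : ℕ, MeasurePreserving (reverse ∘ T.billiardMap^[N]) T.liouville T.liouville :=
    fun N => T.measurePreserving_reverse.comp (T.measurePreserving_billiardMap.iterate N)
  refine map_eq_map_of_tendsto_comp hf hJ T.aemeasurable_rotationNumber
    (T.aemeasurable_rotationNumber.const_sub 1)
    (T.ae_mem_rotationDomain.mono fun z hz => T.tendsto_turnSum_div hz) ?_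
  filter_upwards [T.ae_mem_rotationDomain, hl] with z hz hzl
  simp only [Function.comp_apply]
  exact T.tendsto_turnSum_reverse_div hz hzl

theorem integrable_rotationNumber : Integrable T.rotationNumber T.liouville := by
  have := T.isFiniteMeasure_liouville
  refine Integrable.of_bound T.aemeasurable_rotationNumber.aestronglyMeasurable 1 ?_
  filter_upwards [T.ae_mem_rotationDomain] with z hz
  have := T.rotationNumber_mem_Icc hz
  rw [Real.norm_of_nonneg this.1]
  exact this.2

theorem liouville_univ_eq : T.liouville univ = T.liouville T.phaseSpace := by
  have := measure_inter_conull (s := univ) (t := T.phaseSpace) (μ := T.liouville)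
    T.liouville_compl_phaseSpace
  rw [← this, univ_inter]

theorem integral_rotationNumber (hloop : T.liouville T.returnLoops = 0) :
    ∫ z, T.rotationNumber z ∂T.liouville = T.liouville.real univ / 2 := by
  have := T.isFiniteMeasure_liouville
  have hae := T.aemeasurable_rotationNumber
  have h1 : ∫ y, y ∂T.liouville.map T.rotationNumber = ∫ z, T.rotationNumber z ∂T.liouville :=
    integral_map hae aestronglyMeasurable_id
  have h2 : ∫ y, y ∂T.liouville.map (fun z => 1 - T.rotationNumber z) =
      ∫ z, (1 - T.rotationNumber z) ∂T.liouville :=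
    integral_map (hae.const_sub 1) aestronglyMeasurable_id
  -- The functions ρ and 1 - ρ have equal laws and hence equal integrals.
  rw [T.map_rotationNumber_eq hloop, h2,
    integral_sub (integrable_const 1) T.integrable_rotationNumber] at h1
  simp only [integral_const, smul_eq_mul, mul_one] at h1
  linarith

end BilliardTable
theorem mainTheorem3 {q : ℕ} (T : BilliardTable q) :
    -- the rotation number is defined almost everywhere, measurable, with values in `[0, 1]`
    (MeasurableSet T.rotationDomain ∧
      T.liouville (T.phaseSpace \ T.rotationDomain) = 0 ∧
      Measurable (fun z : T.rotationDomain => T.rotationNumber z) ∧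
      ∀ z ∈ T.rotationDomain, T.rotationNumber z ∈ Set.Icc (0 : ℝ) 1) ∧
    -- no increment between consecutive visits vanishes, up to a null set (automatic if `q = 1`)
    (T.liouville T.returnLoops = 0 →
      (∀ X : Set ℝ, X ⊆ Set.Icc 0 1 → MeasurableSet X →
        T.liouville {z ∈ T.rotationDomain | T.rotationNumber z ∈ (fun x => 1 - x) '' X} =
          T.liouville {z ∈ T.rotationDomain | T.rotationNumber z ∈ X}) ∧
      (MeasureTheory.IntegrableOn T.rotationNumber T.rotationDomain T.liouville ∧
        (∫ z in T.rotationDomain, T.rotationNumber z ∂T.liouville) /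
          (T.liouville T.phaseSpace).toReal = 1 / 2) ∧
      (Ergodic T.billiardMap T.liouville →
        ∀ᵐ z ∂T.liouville, z ∈ T.rotationDomain ∧ T.rotationNumber z = 1 / 2)) := by
  have hfin := T.isFiniteMeasure_liouville
  have hdom := T.ae_mem_rotationDomain
  have hrestr : T.liouville.restrict T.rotationDomain = T.liouville :=
    Measure.restrict_eq_self_of_ae_mem hdom
  have hpos : 0 < T.liouville.real univ := by
    rw [measureReal_def, T.liouville_univ_eq]
    refine ENNReal.toReal_pos T.liouville_phaseSpace_pos.ne' ?_
    exact measure_ne_top _ _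
  refine ⟨⟨T.measurableSet_rotationDomain, ?_, T.measurable_rotationNumber,
    fun z hz => T.rotationNumber_mem_Icc hz⟩, fun hloop => ⟨fun X _ hX => ?_, ⟨?_, ?_⟩,
    fun herg => ?_⟩⟩
  · exact measure_mono_null (fun z hz => hz.2) (mem_ae_iff.1 hdom)
  · have hset : ∀ Y : Set ℝ, T.liouville {z ∈ T.rotationDomain | T.rotationNumber z ∈ Y} =
        T.liouville (T.rotationNumber ⁻¹' Y) := fun Y => measure_congr (by
      filter_upwards [hdom] with z hz
      exact propext ⟨fun h => h.2, fun h => ⟨hz, h⟩⟩)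
    -- The map x ↦ 1 - x is an involution, so images are preimages and the equality of laws applies.
    have himage : (fun x : ℝ => 1 - x) '' X = (fun x : ℝ => 1 - x) ⁻¹' X := by
      ext y
      constructor
      · rintro ⟨x, hx, rfl⟩
        simpa using hx
      · exact fun hy => ⟨1 - y, hy, by simp⟩
    have h := congrArg (fun μ => μ X) (T.map_rotationNumber_eq hloop)
    simp only [Measure.map_apply_of_aemeasurable T.aemeasurable_rotationNumber hX,
      Measure.map_apply_of_aemeasurable (T.aemeasurable_rotationNumber.const_sub 1) hX] at h
    rw [hset, hset, himage, h]
    rfl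
  · exact T.integrable_rotationNumber.integrableOn
  · rw [hrestr, T.integral_rotationNumber hloop, ← T.liouville_univ_eq, ← measureReal_def]
    field_simp
  · have hinv : T.rotationNumber ∘ T.billiardMap =ᵐ[T.liouville] T.rotationNumber :=
      hdom.mono fun z hz => T.rotationNumber_billiardMap hz
    -- An invariant function is constant under ergodicity, and its mean determines the constant
    -- because ν(Φ) > 0.
    obtain ⟨c, hc⟩ := herg.ae_eq_const_of_ae_eq_comp_ae
      T.aemeasurable_rotationNumber.aestronglyMeasurable hinv
    have h1 := T.integral_rotationNumber hloop
    rw [integral_congr_ae hc] at h1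
    simp only [Function.const_apply, integral_const, smul_eq_mul] at h1
    have hc2 : c = 1 / 2 := by
      have : T.liouville.real univ * (c - 1 / 2) = 0 := by linarith
      rcases mul_eq_zero.1 this with h | h
      · exact absurd h hpos.ne'
      · linarith
    filter_upwards [hdom, hc] with z hz hcz
    exact ⟨hz, hcz.trans hc2⟩

end
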